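/- \textbf{Theorem.} The equational theory of System $F_\omega^{ha}$ is consistent: the closed terms $\mathit{tt}$ and $\mathit{ff}$ of type $\mathit{bool}$ are not judgementally equal, i.e. $\mathit{tt} = \mathit{ff} : \mathit{tm}\;\mathit{bool}$ is not derivable in the empty context. Here System $F_\omega^{ha}$ is the theory presented by the signature below in the following logical framework. \emph{Logical framework.} It is a dependent type theory with judgemental equality and a universe $\mathbb J$ whose elements are types. $\mathbb J$ is closed under the type formers of extensional Martin-L\"of type theory: the unit type $1$, $\Sigma$-types, $\Pi$-types (with their $\beta$- and $\eta$-rules) and extensional equality types $a = b$ (with equality reflection and uniqueness of equality proofs). Outside $\mathbb J$ there are $\mathbb J$ itself, $1$, all $\Sigma$-types, and those $\Pi$-types $(a:A)\to B$ whose domain $A$ is in $\mathbb J$. A signature is a list of declared names with their types, each type depending only on earlier names; judgements over a signature are the judgements derivable in the framework with the declared names as additional constants. Records are iterated $\Sigma$-types, arguments in braces are implicit, and $A \cong B$ is the record of $\mathit{fwd}: A\to B$, $\mathit{bwd}: B\to A$ and proofs of $\mathit{bwd}(\mathit{fwd}\,a)=a$ for all $a : A$ and $\mathit{fwd}(\mathit{bwd}\,b)=b$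 for all $b : B$. \emph{Signature, first part (System $F_\omega$).} \begin{align*} &\mathit{ki}:\mathbb J,\quad \mathit{el}:\mathit{ki}\to\mathbb J,\quad \mathit{ty}:\mathit{ki},\quad (\Rightarrow_k):\mathit{ki}\to\mathit{ki}\to\mathit{ki},\\ &\mathit{unit},\mathit{bool}:\mathit{el}\,\mathit{ty},\quad (\Rightarrow_t):\mathit{el}\,\mathit{ty}\to\mathit{el}\,\mathit{ty}\to\mathit{el}\,\mathit{ty},\quad \bar\forall:(k:\mathit{ki})\to(\mathit{el}\,k\to\mathit{el}\,\mathit{ty})\to\mathit{el}\,\mathit{ty},\\ &{\Rightarrow_k}\text{-}\mathit{iso}:\{k,l:\mathit{ki}\}\to\mathit{el}\,(k\Rightarrow_k l)\cong(\mathit{el}\,k\to\mathit{el}\,l),\\ &\mathit{tm}:\mathit{el}\,\mathit{ty}\to\mathbb J,\quad \mathit{unit}\text{-}\mathit{iso}:\mathit{tm}\,\mathit{unit}\cong 1,\\ &{\Rightarrow_t}\text{-}\mathit{iso}:\{A,B:\mathit{el}\,\mathit{ty}\}\to\mathit{tm}\,(A\Rightarrow_t B)\cong(\mathit{tm}\,A\to\mathit{tm}\,B),\\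 &\bar\forall\text{-}\mathit{iso}:\{k:\mathit{ki}\}\,\{A:\mathit{el}\,k\to\mathit{el}\,\mathit{ty}\}\to\mathit{tm}\,(\bar\forall\,k\,A)\cong((\alpha:\mathit{el}\,k)\to\mathit{tm}\,(A\,\alpha)),\\ &\mathit{tt},\mathit{ff}:\mathit{tm}\,\mathit{bool}. \end{align*} \emph{Derived notions.} Applications of the isomorphisms ${\Rightarrow_k}\text{-}\mathit{iso}$, ${\Rightarrow_t}\text{-}\mathit{iso}$, $\bar\forall\text{-}\mathit{iso}$ are left implicit, and for a record $X$ below with a field $0$, $X$ also denotes $X.0$. Let $\mathit{efty}=(\mathit{ty}\Rightarrow_k\mathit{ty})$. For $F,G:\mathit{el}\,\mathit{efty}$ let $\mathit{fmap\text{-}ty}\,F=\bar\forall\,\mathit{ty}\,(\lambda\alpha.\,\bar\forall\,\mathit{ty}\,(\lambda\beta.\,(\alpha\Rightarrow_t\beta)\Rightarrow_t(F\alpha\Rightarrow_t F\beta)))$ and $\mathit{trans}\,F\,G=\bar\forall\,\mathit{ty}\,(\lambda\alpha.\,F\alpha\Rightarrow_t G\alpha)$. The following records are elements of $\mathbb J$.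 \begin{itemize} \item $\mathit{RawFunctor}$: $0:\mathit{el}\,\mathit{efty}$; $\mathit{fmap}:\mathit{tm}\,(\mathit{fmap\text{-}ty}\,0)$. \item $\mathit{RawMonad}$: $0:\mathit{el}\,\mathit{efty}$; $\mathit{ret}:\mathit{tm}\,(\bar\forall\,\mathit{ty}\,(\lambda\alpha.\,\alpha\Rightarrow_t 0\,\alpha))$; $\mathit{bind}:\mathit{tm}\,(\bar\forall\,\mathit{ty}\,(\lambda\alpha.\,\bar\forall\,\mathit{ty}\,(\lambda\beta.\,0\,\alpha\Rightarrow_t(\alpha\Rightarrow_t 0\,\beta)\Rightarrow_t 0\,\beta)))$. \item $\mathit{RawHFunctor}$: $0:\mathit{el}\,(\mathit{efty}\Rightarrow_k\mathit{efty})$; $\mathit{hfmap}:(F:\mathit{RawFunctor})\to\mathit{tm}\,(\mathit{fmap\text{-}ty}\,(0\,(F.0)))$; $\mathit{hmap}:(F,G:\mathit{RawFunctor})\to\mathit{tm}\,(\mathit{trans}\,(F.0)\,(G.0))\to\mathit{tm}\,(\mathit{trans}\,(0\,(F.0))\,(0\,(G.0)))$. \item $\mathit{Handler}\,H$, for $H:\mathit{RawHFunctor}$: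 $M:\mathit{RawMonad}$; $\mathit{malg}:\mathit{tm}\,(\mathit{trans}\,(H.0\,(M.0))\,(M.0))$. For $h:\mathit{Handler}\,H$, the fields $0,\mathit{ret},\mathit{bind}$ of $h$ are those of $h.M$. \end{itemize} A raw monad $m$ gives the raw functor $\mathit{fct}\,m$ with $0=m.0$ and $\mathit{fmap}\,\alpha\,\beta\,f\,c=m.\mathit{bind}\,\alpha\,\beta\,c\,(\lambda a.\,m.\mathit{ret}\,\beta\,(f\,a))$. \emph{Signature, second part (computations).} Below $H:\mathit{RawHFunctor}$ and $A,B,C:\mathit{el}\,\mathit{ty}$ are arguments of every declaration in which they occur (implicit, except in the types of $\mathit{co}$ and $\mathit{th}$). \begin{align*} &\mathit{co}:\mathit{RawHFunctor}\to\mathit{el}\,\mathit{ty}\to\mathbb J,\\ &\mathit{val}:\mathit{tm}\,A\to\mathit{co}\,H\,A,\quad \mathit{let}:\mathit{co}\,H\,A\to(\mathit{tm}\,A\to\mathit{co}\,H\,B)\to\mathit{co}\,H\,B,\\ &\mathit{let}\,(\mathit{val}\,a)\,k=k\,a,\quad \mathit{let}\,m\,\mathit{val}=m,\quad \mathit{let}\,(\mathit{let}\,m_1\,m_2)\,m_3=\mathit{let}\,m_1\,(\lambda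 a.\,\mathit{let}\,(m_2\,a)\,m_3),\\ &\mathit{th}:\mathit{RawHFunctor}\to\mathit{el}\,\mathit{ty}\to\mathit{el}\,\mathit{ty},\quad \mathit{th}\text{-}\mathit{iso}:\mathit{tm}\,(\mathit{th}\,H\,A)\cong\mathit{co}\,H\,A,\\ &\mathit{op}:\mathit{tm}\,(H\,(\mathit{th}\,H)\,A)\to(\mathit{tm}\,A\to\mathit{co}\,H\,B)\to\mathit{co}\,H\,B,\\ &\mathit{let}\,(\mathit{op}\,p\,k)\,k'=\mathit{op}\,p\,(\lambda a.\,\mathit{let}\,(k\,a)\,k'),\\ &\mathit{hdl}:(h:\mathit{Handler}\,H)\to\mathit{co}\,H\,A\to\mathit{tm}\,(h\,A),\quad \mathit{hdl}\,h\,(\mathit{val}\,a)=h.\mathit{ret}\,A\,a,\\ &\mathit{hdl}\,h\,(\mathit{op}\,p\,k)=h.\mathit{bind}\,A\,B\,(h.\mathit{malg}\,A\,p')\,(\lambda a.\,\mathit{hdl}\,h\,(k\,a)). \end{align*} Each displayed equation stands for the declaration of a name whose type is this equality type, universally quantified over all the variables that occur in it (of the evident types; in the equations for $\mathit{op}$,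 $p:\mathit{tm}\,(H\,(\mathit{th}\,H)\,A)$ and $k:\mathit{tm}\,A\to\mathit{co}\,H\,B$). Write $\Uparrow$ and $\Downarrow$ for the forward and backward directions of $\mathit{th}\text{-}\mathit{iso}$. In the last equation, $p'=H.\mathit{hmap}\,(\mathit{fct}\,(\mathit{th\text{-}mnd}\,H))\,(\mathit{fct}\,(h.M))\,(\lambda\alpha\,c.\,\mathit{hdl}\,h\,(\Uparrow c))\,A\,p$, where $\mathit{th\text{-}mnd}\,H$ is the raw monad with $0=\mathit{th}\,H$, $\mathit{ret}\,\alpha\,x=\Downarrow(\mathit{val}\,x)$ and $\mathit{bind}\,\alpha\,\beta\,m\,k=\Downarrow(\mathit{let}\,(\Uparrow m)\,(\lambda a.\,\Uparrow(k\,a)))$. -/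

import Mathlib

/-! ## The logical framework

Raw syntax uses de Bruijn indices.  There is one grammar for types and terms, because the
elements of the universe `univ` (written `𝕁` on paper) are themselves types (Russell style).
`K` is the set of names that are declared by a signature. -/

namespace LccLF

/-- Raw terms.  The second argument of `pi`, `lam` and `sigma` is under one binder. -/
inductive Tm (K : Type) : Type
  | var (i : ℕ)
  | con (c : K)
  | univ
  | pi (A B : Tm K)
  | lam (A t : Tm K)
  | app (f a : Tm K)
  | sigma (A B : Tm K)
  | pair (a b : Tm K)
  | fst (p : Tm K)
  | snd (p : Tm K)
  | unit
  | star
  | eq (A a b : Tm K)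
  | refl (a : Tm K)

namespace Tm

variable {K : Type}

/-- Extend a renaming under a binder. -/
def liftRen (r : ℕ → ℕ) : ℕ → ℕ
  | 0 => 0
  | i + 1 => r i + 1

/-- Renaming of variables. -/
def rename : (ℕ → ℕ) → Tm K → Tm K
  | r, var i => var (r i)
  | _, con c => con c
  | _, univ => univ
  | r, pi A B => pi (rename r A) (rename (liftRen r) B)
  | r, lam A t => lam (rename r A) (rename (liftRen r) t)
  | r, app f a => app (rename r f) (rename r a)
  | r, sigma A B => sigma (rename r A) (rename (liftRen r) B)
  | r, pair a b => pair (rename r a) (rename r b)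
  | r, fst p => fst (rename r p)
  | r, snd p => snd (rename r p)
  | _, unit => unit
  | _, star => star
  | r, eq A a b => eq (rename r A) (rename r a) (rename r b)
  | r, refl a => refl (rename r a)

/-- Weakening by `n` variables. -/
def wk (n : ℕ) (t : Tm K) : Tm K := rename (fun i => i + n) t

/-- Extend a substitution under a binder. -/
def liftSub (s : ℕ → Tm K) : ℕ → Tm K
  | 0 => var 0
  | i + 1 => wk 1 (s i)

/-- Simultaneous capture-avoiding substitution. -/
def subst : (ℕ → Tm K) → Tm K → Tm K
  | s, var i => s i
  | _, con c => con c
  | _, univ => univ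
  | s, pi A B => pi (subst s A) (subst (liftSub s) B)
  | s, lam A t => lam (subst s A) (subst (liftSub s) t)
  | s, app f a => app (subst s f) (subst s a)
  | s, sigma A B => sigma (subst s A) (subst (liftSub s) B)
  | s, pair a b => pair (subst s a) (subst s b)
  | s, fst p => fst (subst s p)
  | s, snd p => snd (subst s p)
  | _, unit => unit
  | _, star => star
  | s, eq A a b => eq (subst s A) (subst s a) (subst s b)
  | s, refl a => refl (subst s a)

/-- The substitution that replaces variable `0` by `a` and lowers the other variables. -/
def single (a : Tm K) : ℕ → Tm K
  | 0 => a
  | i + 1 => var i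

/-- `t.inst a` is `t[a/x]`, where `x` is variable `0` of `t`. -/
def inst (t a : Tm K) : Tm K := subst (single a) t

/-- Non-dependent function type. -/
def arrow (A B : Tm K) : Tm K := pi A (wk 1 B)

/-- Non-dependent pair type. -/
def prod (A B : Tm K) : Tm K := sigma A (wk 1 B)

end Tm

/-- Contexts; the head of the list is the most recent variable. -/
abbrev Ctx (K : Type) := List (Tm K)

/-- The judgement forms of the framework. -/
inductive Judgement (K : Type) : Type
  /-- `Γ` is a well-formed context. -/
  | ctx (Γ : Ctx K)
  /-- `A` is a type in context `Γ`. -/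
  | type (Γ : Ctx K) (A : Tm K)
  /-- `t` is an element of the type `A` in context `Γ`. -/
  | term (Γ : Ctx K) (t A : Tm K)
  /-- `A` and `B` are judgementally equal types in context `Γ`. -/
  | tyEq (Γ : Ctx K) (A B : Tm K)
  /-- `t` and `u` are judgementally equal elements of `A` in context `Γ`. -/
  | tmEq (Γ : Ctx K) (t u A : Tm K)

open Judgement Tm

/-- Derivability over a signature `S`, which gives each declared name its closed type.

Inside the universe there are the type formers of extensional Martin-Löf type theory:
`unit`, `sigma`, `pi` and `eq`.  Outside there are `univ` itself, `unit`, all `sigma`-types, and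
the `pi`-types whose domain is in the universe. -/
inductive Derivable {K : Type} (S : K → Tm K) : Judgement K → Prop
  -- contexts, variables and declared names
  | ctx_nil : Derivable S (ctx [])
  | ctx_cons {Γ A} : Derivable S (ctx Γ) → Derivable S (type Γ A) → Derivable S (ctx (A :: Γ))
  | var {Γ : Ctx K} {i : ℕ} {A : Tm K} : Derivable S (ctx Γ) → Γ[i]? = some A →
      Derivable S (term Γ (.var i) (wk (i + 1) A))
  | con {Γ} (c : K) : Derivable S (ctx Γ) → Derivable S (term Γ (.con c) (S c))
  -- judgemental equality is an equivalence relation, and equal types have the same elements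
  | ty_refl {Γ A} : Derivable S (type Γ A) → Derivable S (tyEq Γ A A)
  | ty_symm {Γ A B} : Derivable S (tyEq Γ A B) → Derivable S (tyEq Γ B A)
  | ty_trans {Γ A B C} : Derivable S (tyEq Γ A B) → Derivable S (tyEq Γ B C) →
      Derivable S (tyEq Γ A C)
  | tm_refl {Γ t A} : Derivable S (term Γ t A) → Derivable S (tmEq Γ t t A)
  | tm_symm {Γ t u A} : Derivable S (tmEq Γ t u A) → Derivable S (tmEq Γ u t A)
  | tm_trans {Γ t u v A} : Derivable S (tmEq Γ t u A) → Derivable S (tmEq Γ u v A) →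
      Derivable S (tmEq Γ t v A)
  | conv {Γ t A B} : Derivable S (term Γ t A) → Derivable S (tyEq Γ A B) →
      Derivable S (term Γ t B)
  | conv_eq {Γ t u A B} : Derivable S (tmEq Γ t u A) → Derivable S (tyEq Γ A B) →
      Derivable S (tmEq Γ t u B)
  -- the universe
  | univ_type {Γ} : Derivable S (ctx Γ) → Derivable S (type Γ univ)
  | el_type {Γ A} : Derivable S (term Γ A univ) → Derivable S (type Γ A)
  | el_eq {Γ A B} : Derivable S (tmEq Γ A B univ) → Derivable S (tyEq Γ A B)
  -- the unit type
  | unit_univ {Γ} : Derivable S (ctx Γ) → Derivable S (term Γ unit univ)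
  | star {Γ} : Derivable S (ctx Γ) → Derivable S (term Γ star unit)
  | unit_eta {Γ t} : Derivable S (term Γ t unit) → Derivable S (tmEq Γ t star unit)
  -- dependent function types
  | pi_type {Γ A B} : Derivable S (term Γ A univ) → Derivable S (type (A :: Γ) B) →
      Derivable S (type Γ (pi A B))
  | pi_type_congr {Γ A A' B B'} : Derivable S (tmEq Γ A A' univ) →
      Derivable S (tyEq (A :: Γ) B B') → Derivable S (tyEq Γ (pi A B) (pi A' B'))
  | pi_univ {Γ A B} : Derivable S (term Γ A univ) → Derivable S (term (A :: Γ) B univ) →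
      Derivable S (term Γ (pi A B) univ)
  | pi_univ_congr {Γ A A' B B'} : Derivable S (tmEq Γ A A' univ) →
      Derivable S (tmEq (A :: Γ) B B' univ) → Derivable S (tmEq Γ (pi A B) (pi A' B') univ)
  | lam {Γ A t B} : Derivable S (term Γ A univ) → Derivable S (term (A :: Γ) t B) →
      Derivable S (term Γ (lam A t) (pi A B))
  | lam_congr {Γ A A' t t' B} : Derivable S (tmEq Γ A A' univ) →
      Derivable S (tmEq (A :: Γ) t t' B) → Derivable S (tmEq Γ (lam A t) (lam A' t') (pi A B))
  | app {Γ f a A B} : Derivable S (term Γ f (pi A B)) → Derivable S (term Γ a A) →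
      Derivable S (term Γ (app f a) (inst B a))
  | app_congr {Γ f f' a a' A B} : Derivable S (tmEq Γ f f' (pi A B)) →
      Derivable S (tmEq Γ a a' A) → Derivable S (tmEq Γ (app f a) (app f' a') (inst B a))
  | pi_beta {Γ A t B a} : Derivable S (term Γ A univ) → Derivable S (term (A :: Γ) t B) →
      Derivable S (term Γ a A) →
      Derivable S (tmEq Γ (app (lam A t) a) (inst t a) (inst B a))
  | pi_eta {Γ f A B} : Derivable S (term Γ f (pi A B)) →
      Derivable S (tmEq Γ (lam A (app (wk 1 f) (.var 0))) f (pi A B))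
  -- dependent pair types
  | sigma_type {Γ A B} : Derivable S (type Γ A) → Derivable S (type (A :: Γ) B) →
      Derivable S (type Γ (sigma A B))
  | sigma_type_congr {Γ A A' B B'} : Derivable S (tyEq Γ A A') →
      Derivable S (tyEq (A :: Γ) B B') → Derivable S (tyEq Γ (sigma A B) (sigma A' B'))
  | sigma_univ {Γ A B} : Derivable S (term Γ A univ) → Derivable S (term (A :: Γ) B univ) →
      Derivable S (term Γ (sigma A B) univ)
  | sigma_univ_congr {Γ A A' B B'} : Derivable S (tmEq Γ A A' univ) →
      Derivable S (tmEq (A :: Γ) B B' univ) →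
      Derivable S (tmEq Γ (sigma A B) (sigma A' B') univ)
  | pair {Γ a b A B} : Derivable S (type (A :: Γ) B) → Derivable S (term Γ a A) →
      Derivable S (term Γ b (inst B a)) → Derivable S (term Γ (pair a b) (sigma A B))
  | pair_congr {Γ a a' b b' A B} : Derivable S (type (A :: Γ) B) →
      Derivable S (tmEq Γ a a' A) → Derivable S (tmEq Γ b b' (inst B a)) →
      Derivable S (tmEq Γ (pair a b) (pair a' b') (sigma A B))
  | fst {Γ p A B} : Derivable S (term Γ p (sigma A B)) → Derivable S (term Γ (fst p) A)
  | fst_congr {Γ p p' A B} : Derivable S (tmEq Γ p p' (sigma A B)) →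
      Derivable S (tmEq Γ (fst p) (fst p') A)
  | snd {Γ p A B} : Derivable S (term Γ p (sigma A B)) →
      Derivable S (term Γ (snd p) (inst B (fst p)))
  | snd_congr {Γ p p' A B} : Derivable S (tmEq Γ p p' (sigma A B)) →
      Derivable S (tmEq Γ (snd p) (snd p') (inst B (fst p)))
  | sigma_beta_fst {Γ a b A B} : Derivable S (type (A :: Γ) B) → Derivable S (term Γ a A) →
      Derivable S (term Γ b (inst B a)) → Derivable S (tmEq Γ (fst (pair a b)) a A)
  | sigma_beta_snd {Γ a b A B} : Derivable S (type (A :: Γ) B) → Derivable S (term Γ a A) →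
      Derivable S (term Γ b (inst B a)) → Derivable S (tmEq Γ (snd (pair a b)) b (inst B a))
  | sigma_eta {Γ p A B} : Derivable S (term Γ p (sigma A B)) →
      Derivable S (tmEq Γ (pair (fst p) (snd p)) p (sigma A B))
  -- extensional equality types: equality reflection and uniqueness of proofs
  | eq_univ {Γ A a b} : Derivable S (term Γ A univ) → Derivable S (term Γ a A) →
      Derivable S (term Γ b A) → Derivable S (term Γ (eq A a b) univ)
  | eq_univ_congr {Γ A A' a a' b b'} : Derivable S (tmEq Γ A A' univ) →
      Derivable S (tmEq Γ a a' A) → Derivable S (tmEq Γ b b' A) →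
      Derivable S (tmEq Γ (eq A a b) (eq A' a' b') univ)
  | refl {Γ A a} : Derivable S (term Γ A univ) → Derivable S (term Γ a A) →
      Derivable S (term Γ (refl a) (eq A a a))
  | reflection {Γ A a b p} : Derivable S (term Γ p (eq A a b)) → Derivable S (tmEq Γ a b A)
  | eq_unique {Γ A a b p q} : Derivable S (term Γ p (eq A a b)) →
      Derivable S (term Γ q (eq A a b)) → Derivable S (tmEq Γ p q (eq A a b))

end LccLF

/-! ## The signature of System Fω with higher-order effect handlers -/

namespace Fha

open LccLF LccLF.Tm

/-- The declared names, in the order of declaration. -/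
inductive Name : Type
  | ki | el | ty | kfun
  | unit | bool | tfun | all
  | kfunIso
  | tm | unitIso | tfunIso | allIso | tt | ff
  | co | val | letIn | valLet | letVal | letAssoc
  | th | thIso
  | op | letOp
  | hdl | hdlVal | hdlOp

/-- Raw terms of the framework over the declared names. -/
abbrev T := Tm Name

/-- de Bruijn variables. -/
abbrev v (i : ℕ) : T := .var i

/-- `f a b` -/
def app2 (f a b : T) : T := app (app f a) b
/-- `f a b c` -/
def app3 (f a b c : T) : T := app (app2 f a b) c

/-- The record type `A ≅ B` of isomorphisms, with fields
`fwd : A → B`, `bwd : B → A`, `(a : A) → bwd (fwd a) = a`, `(b : B) → fwd (bwd b) = b`. -/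
def iso (A B : T) : T :=
  sigma (arrow A B) (sigma (wk 1 (arrow B A)) (prod
    (pi (wk 2 A) (eq (wk 3 A) (app (v 1) (app (v 2) (v 0))) (v 0)))
    (pi (wk 2 B) (eq (wk 3 B) (app (v 2) (app (v 1) (v 0))) (v 0)))))

/-- Forward direction of an isomorphism. -/
def fwd (i : T) : T := fst i
/-- Backward direction of an isomorphism. -/
def bwd (i : T) : T := fst (snd i)

/-! ### Kinds, types and terms -/

def ki : T := con .ki
def el (k : T) : T := app (con .el) k
def ty : T := con .ty
/-- `k ⇒ₖ l` -/
def kfun (k l : T) : T := app2 (con .kfun) k l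

def unit : T := con .unit
def bool : T := con .bool
/-- `A ⇒ₜ B` -/
def tfun (A B : T) : T := app2 (con .tfun) A B
/-- `∀̄ k F`, where `F` is an element of `el k → el ty`. -/
def all (k F : T) : T := app2 (con .all) k F

def tm (A : T) : T := app (con .tm) A
def tt : T := con .tt
def ff : T := con .ff

/-- Application of an element of a function kind: `f a` for `f : el (k ⇒ₖ l)` and `a : el k`. -/
def appK (k l f a : T) : T := app2 (fwd (app2 (con .kfunIso) k l)) f a
/-- Abstraction `λ α. t : el (k ⇒ₖ l)`, where `t` is under the binder `α : el k`. -/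
def absK (k l t : T) : T := app (bwd (app2 (con .kfunIso) k l)) (lam (el k) t)
/-- Application of a term `f : tm (A ⇒ₜ B)` to `a : tm A`. -/
def appT (A B f a : T) : T := app2 (fwd (app2 (con .tfunIso) A B)) f a
/-- The term of type `A ⇒ₜ B` that is given by the function `f : tm A → tm B`. -/
def absT (A B f : T) : T := app (bwd (app2 (con .tfunIso) A B)) f
/-- Application of `t : tm (∀̄ k F)` to `a : el k`. -/
def appAll (k F t a : T) : T := app2 (fwd (app2 (con .allIso) k F)) t a
/-- Polymorphic abstraction `λ α. t : tm (∀̄ k F)`, where `t` is under the binder `α : el k`. -/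
def absAll (k F t : T) : T := app (bwd (app2 (con .allIso) k F)) (lam (el k) t)

/-! ### Raw functors, raw monads and raw higher-order functors

A name that ends in `Fam` denotes the family over which the type with that name quantifies. -/

/-- `ty ⇒ₖ ty` -/
def efty : T := kfun ty ty
/-- `F A` for `F : el efty` and `A : el ty`. -/
def efApp (F A : T) : T := appK ty ty F A
/-- `efty ⇒ₖ efty` -/
def htyco : T := kfun efty efty
/-- `H F` for `H : el htyco` and `F : el efty`. -/
def hApp (H F : T) : T := appK efty efty H F

/-- `λ β. (A ⇒ₜ β) ⇒ₜ (F A ⇒ₜ F β)` -/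
def fmapFam₂ (F A : T) : T :=
  lam (el ty) (tfun (tfun (wk 1 A) (v 0)) (tfun (efApp (wk 1 F) (wk 1 A)) (efApp (wk 1 F) (v 0))))
/-- `λ α. ∀̄ ty (λ β. (α ⇒ₜ β) ⇒ₜ (F α ⇒ₜ F β))` -/
def fmapFam₁ (F : T) : T := lam (el ty) (all ty (fmapFam₂ (wk 1 F) (v 0)))
def fmapTy (F : T) : T := all ty (fmapFam₁ F)

/-- Record with fields `0 : el efty` and `fmap : tm (fmapTy 0)`. -/
def RawFunctor : T := sigma (el efty) (tm (fmapTy (v 0)))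

/-- `λ α. α ⇒ₜ M α` -/
def retFam (M : T) : T := lam (el ty) (tfun (v 0) (efApp (wk 1 M) (v 0)))
def retTy (M : T) : T := all ty (retFam M)
/-- `λ β. M A ⇒ₜ (A ⇒ₜ M β) ⇒ₜ M β` -/
def bindFam₂ (M A : T) : T :=
  lam (el ty) (tfun (efApp (wk 1 M) (wk 1 A))
    (tfun (tfun (wk 1 A) (efApp (wk 1 M) (v 0))) (efApp (wk 1 M) (v 0))))
/-- `λ α. ∀̄ ty (λ β. M α ⇒ₜ (α ⇒ₜ M β) ⇒ₜ M β)` -/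
def bindFam₁ (M : T) : T := lam (el ty) (all ty (bindFam₂ (wk 1 M) (v 0)))
def bindTy (M : T) : T := all ty (bindFam₁ M)

/-- Record with fields `0 : el efty`, `ret : tm (retTy 0)` and `bind : tm (bindTy 0)`. -/
def RawMonad : T := sigma (el efty) (prod (tm (retTy (v 0))) (tm (bindTy (v 0))))

/-- `m .0 A` -/
def mApp (m A : T) : T := efApp (fst m) A
/-- `m .ret A a` -/
def mRet (m A a : T) : T := appT A (mApp m A) (appAll ty (retFam (fst m)) (fst (snd m)) A) a
/-- `m .bind A B c k`, for `c : tm (m .0 A)` and `k : tm (A ⇒ₜ m .0 B)`. -/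
def mBind (m A B c k : T) : T :=
  appT (tfun A (mApp m B)) (mApp m B)
    (appT (mApp m A) (tfun (tfun A (mApp m B)) (mApp m B))
      (appAll ty (bindFam₂ (fst m) A)
        (appAll ty (bindFam₁ (fst m)) (snd (snd m)) A) B) c) k

/-- `λ α. F α ⇒ₜ G α` -/
def transFam (F G : T) : T := lam (el ty) (tfun (efApp (wk 1 F) (v 0)) (efApp (wk 1 G) (v 0)))
def trans (F G : T) : T := all ty (transFam F G)

/-- Record with fields `0 : el htyco`,
`hfmap : (F : RawFunctor) → tm (fmapTy (0 (F .0)))` and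
`hmap : (F G : RawFunctor) → tm (trans (F .0) (G .0)) → tm (trans (0 (F .0)) (0 (G .0)))`. -/
def RawHFunctor : T :=
  sigma (el htyco) (prod
    (pi RawFunctor (tm (fmapTy (hApp (v 1) (fst (v 0))))))
    (pi RawFunctor (pi RawFunctor (arrow
      (tm (trans (fst (v 1)) (fst (v 0))))
      (tm (trans (hApp (v 2) (fst (v 1))) (hApp (v 2) (fst (v 0)))))))))

/-- `H .0 F A` -/
def hfApp (H F A : T) : T := efApp (hApp (fst H) F) A
/-- `H .hmap F G t` -/
def hmap (H F G t : T) : T := app3 (snd (snd H)) F G t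

/-- The raw functor of a raw monad: `fmap α β f c = bind α β c (λ a. ret β (f a))`. -/
def fctOfMnd (m : T) : T :=
  Tm.pair (fst m)
    (absAll ty (fmapFam₁ (fst m))
      (absAll ty (fmapFam₂ (wk 1 (fst m)) (v 0))
        -- here `α = v 1` and `β = v 0`
        (absT (tfun (v 1) (v 0)) (tfun (mApp (wk 2 m) (v 1)) (mApp (wk 2 m) (v 0)))
          (lam (tm (tfun (v 1) (v 0)))
            -- here `f = v 0`, `β = v 1` and `α = v 2`
            (absT (mApp (wk 3 m) (v 2)) (mApp (wk 3 m) (v 1))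
              (lam (tm (mApp (wk 3 m) (v 2)))
                -- here `c = v 0`, `f = v 1`, `β = v 2` and `α = v 3`
                (mBind (wk 4 m) (v 3) (v 2) (v 0)
                  (absT (v 3) (mApp (wk 4 m) (v 2))
                    (lam (tm (v 3))
                      (mRet (wk 5 m) (v 3) (appT (v 4) (v 3) (v 2) (v 0))))))))))))

/-! ### Computations, thunks, operations and handling -/

def co (H A : T) : T := app2 (con .co) H A
/-- The function `val : tm A → co H A`. -/
def valFun (H A : T) : T := app2 (con .val) H A
def val (H A a : T) : T := app (valFun H A) a
/-- `let-in m k`, for `m : co H A` and `k : tm A → co H B`. -/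
def letIn (H A B m k : T) : T := app2 (app3 (con .letIn) H A B) m k

def th (H A : T) : T := app2 (con .th) H A
/-- `th H` as an element of `el efty`. -/
def thFun (H : T) : T := absK ty ty (th (wk 1 H) (v 0))
/-- `⇑ : tm (th H A) → co H A` -/
def up (H A t : T) : T := app (fwd (app2 (con .thIso) H A)) t
/-- `⇓ : co H A → tm (th H A)` -/
def down (H A c : T) : T := app (bwd (app2 (con .thIso) H A)) c

/-- The raw monad of thunks: `ret α x = ⇓ (val x)` and
`bind α β m k = ⇓ (let-in (⇑ m) (λ a. ⇑ (k a)))`. -/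
def thMnd (H : T) : T :=
  Tm.pair (thFun H) (Tm.pair
    (absAll ty (retFam (thFun H))
      (absT (v 0) (efApp (wk 1 (thFun H)) (v 0))
        (lam (tm (v 0)) (down (wk 2 H) (v 1) (val (wk 2 H) (v 1) (v 0))))))
    (absAll ty (bindFam₁ (thFun H))
      (absAll ty (bindFam₂ (wk 1 (thFun H)) (v 0))
        -- here `α = v 1` and `β = v 0`
        (absT (efApp (wk 2 (thFun H)) (v 1))
          (tfun (tfun (v 1) (efApp (wk 2 (thFun H)) (v 0))) (efApp (wk 2 (thFun H)) (v 0)))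
          (lam (tm (efApp (wk 2 (thFun H)) (v 1)))
            -- here `m = v 0`, `β = v 1` and `α = v 2`
            (absT (tfun (v 2) (efApp (wk 3 (thFun H)) (v 1))) (efApp (wk 3 (thFun H)) (v 1))
              (lam (tm (tfun (v 2) (efApp (wk 3 (thFun H)) (v 1))))
                -- here `k = v 0`, `m = v 1`, `β = v 2` and `α = v 3`
                (down (wk 4 H) (v 2)
                  (letIn (wk 4 H) (v 3) (v 2) (up (wk 4 H) (v 3) (v 1))
                    (lam (tm (v 3))
                      (up (wk 5 H) (v 3)
                        (appT (v 4) (efApp (wk 5 (thFun H)) (v 3)) (v 1) (v 0)))))))))))))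

/-- The type `H (th H) A` of operation calls. -/
def opTy (H A : T) : T := hfApp H (thFun H) A
/-- `op p k`, for `p : tm (H (th H) A)` and `k : tm A → co H B`. -/
def op (H A B p k : T) : T := app2 (app3 (con .op) H A B) p k

/-- Record with fields `M : RawMonad` and `malg : tm (trans (H .0 (M .0)) (M .0))`. -/
def Handler (H : T) : T :=
  sigma RawMonad (tm (trans (hApp (fst (wk 1 H)) (fst (v 0))) (fst (v 0))))
/-- `h .malg A o`, for `o : tm (H .0 (h .0) A)`. -/
def malg (H h A o : T) : T :=
  appT (hfApp H (fst (fst h)) A) (mApp (fst h) A)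
    (appAll ty (transFam (hApp (fst H) (fst (fst h))) (fst (fst h))) (snd h) A) o

/-- `hdl h c`, for `h : Handler H` and `c : co H A`. -/
def hdl (H A h c : T) : T := app2 (app2 (con .hdl) H A) h c

/-- The transformation `λ α c. hdl h (⇑ c)` from `th H` to `h .0`. -/
def hdlTrans (H h : T) : T :=
  absAll ty (transFam (thFun H) (fst (fst h)))
    (absT (efApp (wk 1 (thFun H)) (v 0)) (mApp (wk 1 (fst h)) (v 0))
      (lam (tm (efApp (wk 1 (thFun H)) (v 0)))
        (hdl (wk 2 H) (v 1) (wk 2 h) (up (wk 2 H) (v 1) (v 0)))))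

/-- The operation call `p : tm (H (th H) A)` with `h` recursively applied to it:
`H .hmap T M (λ α c. hdl h (⇑ c)) A p : tm (H .0 (h .0) A)`, where `T` and `M` are the raw functors
of the raw monads `thMnd H` and `h .M`. -/
def hdlArg (H A h p : T) : T :=
  appT (opTy H A) (hfApp H (fst (fst h)) A)
    (appAll ty (transFam (hApp (fst H) (thFun H)) (hApp (fst H) (fst (fst h))))
      (hmap H (fctOfMnd (thMnd H)) (fctOfMnd (fst h)) (hdlTrans H h)) A) p

/-- Iterated dependent function type; each type in the list may use the variables before it. -/
def pis (Δ : List T) (B : T) : T := Δ.foldr pi B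

/-- The signature: the type of each declared name.  Arguments that are implicit on paper come
first.  The comment before a declaration names the variables of its telescope. -/
def signature : Name → T
  | .ki => univ
  | .el => arrow ki univ
  | .ty => ki
  | .kfun => arrow ki (arrow ki ki)
  | .unit => el ty
  | .bool => el ty
  | .tfun => arrow (el ty) (arrow (el ty) (el ty))
  | .all => pi ki (arrow (arrow (el (v 0)) (el ty)) (el ty))
  -- `k l`
  | .kfunIso => pis [ki, ki] (iso (el (kfun (v 1) (v 0))) (arrow (el (v 1)) (el (v 0))))
  | .tm => arrow (el ty) univ
  | .unitIso => iso (tm unit) Tm.unit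
  -- `A B`
  | .tfunIso => pis [el ty, el ty] (iso (tm (tfun (v 1) (v 0))) (arrow (tm (v 1)) (tm (v 0))))
  -- `k F`, and `α` in the codomain
  | .allIso => pis [ki, arrow (el (v 0)) (el ty)]
      (iso (tm (all (v 1) (v 0))) (pi (el (v 1)) (tm (app (v 1) (v 0)))))
  | .tt => tm bool
  | .ff => tm bool
  | .co => arrow RawHFunctor (arrow (el ty) univ)
  -- `H A`
  | .val => pis [RawHFunctor, el ty] (arrow (tm (v 0)) (co (v 1) (v 0)))
  -- `H A B`
  | .letIn => pis [RawHFunctor, el ty, el ty]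
      (arrow (co (v 2) (v 1)) (arrow (arrow (tm (v 1)) (co (v 2) (v 0))) (co (v 2) (v 0))))
  -- `H A B a k`: let-in (val a) k = k a
  | .valLet => pis [RawHFunctor, el ty, el ty, tm (v 1), arrow (tm (v 2)) (co (v 3) (v 1))]
      (eq (co (v 4) (v 2))
        (letIn (v 4) (v 3) (v 2) (val (v 4) (v 3) (v 1)) (v 0))
        (app (v 0) (v 1)))
  -- `H A m`: let-in m val = m
  | .letVal => pis [RawHFunctor, el ty, co (v 1) (v 0)]
      (eq (co (v 2) (v 1))
        (letIn (v 2) (v 1) (v 1) (v 0) (valFun (v 2) (v 1)))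
        (v 0))
  -- `H A B C m₁ m₂ m₃`: let-in (let-in m₁ m₂) m₃ = let-in m₁ (λ a. let-in (m₂ a) m₃)
  | .letAssoc => pis [RawHFunctor, el ty, el ty, el ty, co (v 3) (v 2),
        arrow (tm (v 3)) (co (v 4) (v 2)), arrow (tm (v 3)) (co (v 5) (v 2))]
      (eq (co (v 6) (v 3))
        (letIn (v 6) (v 4) (v 3) (letIn (v 6) (v 5) (v 4) (v 2) (v 1)) (v 0))
        (letIn (v 6) (v 5) (v 3) (v 2)
          (lam (tm (v 5)) (letIn (v 7) (v 5) (v 4) (app (v 2) (v 0)) (v 1)))))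
  | .th => arrow RawHFunctor (arrow (el ty) (el ty))
  -- `H A`
  | .thIso => pis [RawHFunctor, el ty] (iso (tm (th (v 1) (v 0))) (co (v 1) (v 0)))
  -- `H A B`
  | .op => pis [RawHFunctor, el ty, el ty]
      (arrow (tm (opTy (v 2) (v 1)))
        (arrow (arrow (tm (v 1)) (co (v 2) (v 0))) (co (v 2) (v 0))))
  -- `H A B C p k k'`: let-in (op p k) k' = op p (λ a. let-in (k a) k')
  | .letOp => pis [RawHFunctor, el ty, el ty, el ty, tm (opTy (v 3) (v 2)),
        arrow (tm (v 3)) (co (v 4) (v 2)), arrow (tm (v 3)) (co (v 5) (v 2))]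
      (eq (co (v 6) (v 3))
        (letIn (v 6) (v 4) (v 3) (op (v 6) (v 5) (v 4) (v 2) (v 1)) (v 0))
        (op (v 6) (v 5) (v 3) (v 2)
          (lam (tm (v 5)) (letIn (v 7) (v 5) (v 4) (app (v 2) (v 0)) (v 1)))))
  -- `H A h`
  | .hdl => pis [RawHFunctor, el ty, Handler (v 1)]
      (arrow (co (v 2) (v 1)) (tm (mApp (fst (v 0)) (v 1))))
  -- `H A h a`: hdl h (val a) = h .ret A a
  | .hdlVal => pis [RawHFunctor, el ty, Handler (v 1), tm (v 1)]
      (eq (tm (mApp (fst (v 1)) (v 2)))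
        (hdl (v 3) (v 2) (v 1) (val (v 3) (v 2) (v 0)))
        (mRet (fst (v 1)) (v 2) (v 0)))
  -- `H A B h p k`: hdl h (op p k) = h .bind A B (h .malg A p') (λ a. hdl h (k a)),
  -- where p' is `hdlArg H A h p`
  | .hdlOp => pis [RawHFunctor, el ty, el ty, Handler (v 2), tm (opTy (v 3) (v 2)),
        arrow (tm (v 3)) (co (v 4) (v 2))]
      (eq (tm (mApp (fst (v 2)) (v 3)))
        (hdl (v 5) (v 3) (v 2) (op (v 5) (v 4) (v 3) (v 1) (v 0)))
        (mBind (fst (v 2)) (v 4) (v 3)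
          (malg (v 5) (v 2) (v 4) (hdlArg (v 5) (v 4) (v 2) (v 1)))
          (absT (v 4) (mApp (fst (v 2)) (v 3))
            (lam (tm (v 4)) (hdl (v 6) (v 4) (v 3) (app (v 1) (v 0)))))))

/-- `t` and `u` are judgementally equal closed terms of the object type `A`. -/
def ClosedEq (t u A : T) : Prop := Derivable signature (.tmEq [] t u (tm A))

end Fha

/-! The proof is by a realizability model in which `tt` and `ff` have different values. Full
set-theoretic function spaces cannot interpret the impredicative quantifier `all`, so every type
carries realizers from the graph model `D` of the untyped λ-calculus. A framework type denotes a
class of sets with a relation to realizers (an assembly). A judgement `t : A` in context means that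
one λ-term computes a realizer of `t` from realizers of the variables. The elements of the universe
are the types whose class is coded by a single set; this covers the framework's large types as well,
since only the domain of a function type has to be small.

Object types are the modest classes, where a realizer determines the element. Up to isomorphism
these are partial equivalence relations on `D`, so they form a set (`bdd_TY`). Modesty passes to
products over an arbitrary base (`mod_PI`), and every modest class is isomorphic, with the identity
as realizer, to a chosen object type `mo C`. Hence `tfun` and `all` exist with the required
isomorphisms. Kinds are codes of simple types over `ty`, and `kfun` is interpreted by the function
class itself.

A computation in `CO H A` takes a handler `h`, a result type `B` and a continuation from `A` to `h
B`, and returns an element of `h B`. This class is modest because `h B` is an object type. Since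
`let` composes continuations, its three laws hold although raw monads satisfy no laws. Handling runs
a computation with the continuation `ret`. An operation `op p k` is defined to be the right-hand
side of its handling equation with an arbitrary continuation in place of `ret`; both equations for
`op` then follow by unfolding (`letV_op`, `hdlV_op`). There is no recursion here: `th H` and `hdl`
are already given before `op` is interpreted.

`soundness` turns realizers for all declared names (`realized`) into validity of all derivable
judgements, and `tt_ne_ff` contradicts the validity of `tt = ff`. -/

/-! ## The graph model of the untyped λ-calculus -/

/-- Extension of an environment by a value for variable `0`. -/
def scons {α : Type*} (x : α) (ρ : ℕ → α) : ℕ → α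
  | 0 => x
  | i + 1 => ρ i

infixr:67 " ∷ₛ " => scons

@[simp] theorem scons_zero {α : Type*} (x : α) (ρ : ℕ → α) : (x ∷ₛ ρ) 0 = x := (rfl)
@[simp] theorem scons_succ {α : Type*} (x : α) (ρ : ℕ → α) (i : ℕ) : (x ∷ₛ ρ) (i + 1) = ρ i := (rfl)
@[simp] theorem scons_one {α : Type*} (x : α) (ρ : ℕ → α) : (x ∷ₛ ρ) 1 = ρ 0 := (rfl)

namespace Graph

/-- Tokens of the graph model; `arr F b` is a step of a function graph. -/
inductive Tok : Type
  | atom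
  | arr (F : List Tok) (b : Tok)

/-- Elements of the graph model. -/
abbrev D : Type := Set Tok

/-- The finite element given by a list. -/
def fin (F : List Tok) : D := {x | x ∈ F}

def dapp (f a : D) : D := {b | ∃ F : List Tok, fin F ⊆ a ∧ Tok.arr F b ∈ f}

infixl:70 " ⬝ " => dapp

/-- Untyped λ-terms with constants from the graph model. -/
inductive Lm : Type
  | var (i : ℕ)
  | cst (d : D)
  | app (f a : Lm)
  | lam (t : Lm)

/-- The graph of an abstraction records its results on finite arguments only; continuity recovers
the rest. No η-law for realizers is needed, because the η-rule of the framework concerns the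
set-theoretic values. -/
def ev : Lm → (ℕ → D) → D
  | .var i, γ => γ i
  | .cst d, _ => d
  | .app f a, γ => ev f γ ⬝ ev a γ
  | .lam t, γ => {x | ∃ F b, x = Tok.arr F b ∧ b ∈ ev t (fin F ∷ₛ γ)}

theorem dapp_mono {f f' a a' : D} (hf : f ⊆ f') (ha : a ⊆ a') : f ⬝ a ⊆ f' ⬝ a' :=
  fun _ ⟨F, h, h'⟩ => ⟨F, h.trans ha, hf h'⟩

theorem scons_le {γ γ' : ℕ → D} {a a' : D} (ha : a ⊆ a') (h : ∀ i, γ i ⊆ γ' i) (i : ℕ) :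
    (a ∷ₛ γ) i ⊆ (a' ∷ₛ γ') i := by
  cases i with
  | zero => exact ha
  | succ i => exact h i

theorem ev_mono (t : Lm) : ∀ {γ γ' : ℕ → D}, (∀ i, γ i ⊆ γ' i) → ev t γ ⊆ ev t γ' := by
  induction t with
  | var i => exact fun h => h i
  | cst d => exact fun _ => subset_rfl
  | app f a hf ha => exact fun h => dapp_mono (hf h) (ha h)
  | lam t ht =>
    rintro γ γ' h _ ⟨F, b, rfl, hb⟩
    exact ⟨F, b, rfl, ht (scons_le subset_rfl h) hb⟩

/-! ### Continuity of evaluation and the β-law -/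

theorem fin_append (F F' : List Tok) : fin (F ++ F') = fin F ∪ fin F' := by
  ext; simp [fin]

/-- Unions of finitely many finite approximations are finite, so approximation of single tokens
extends to finite sets. The application case of `ev_cont` needs this for the finite part of the
argument that is consumed. -/
theorem ev_fin_list {t : Lm} {γ : ℕ → D}
    (ht : ∀ b ∈ ev t γ, ∃ φ : ℕ → List Tok, (∀ i, fin (φ i) ⊆ γ i) ∧ b ∈ ev t fun i => fin (φ i))
    (F : List Tok) (hF : fin F ⊆ ev t γ) :
    ∃ φ : ℕ → List Tok, (∀ i, fin (φ i) ⊆ γ i) ∧ fin F ⊆ ev t fun i => fin (φ i) := by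
  induction F with
  | nil => exact ⟨fun _ => [], fun i => by simp [fin], by simp [fin]⟩
  | cons x F ih =>
    obtain ⟨φ, h₁, h₂⟩ := ih fun y hy => hF (List.mem_cons_of_mem _ hy)
    obtain ⟨ψ, h₃, h₄⟩ := ht x (hF (by simp [fin]))
    refine ⟨fun i => φ i ++ ψ i, fun i => ?_, fun y hy => ?_⟩
    · rw [fin_append]; exact Set.union_subset (h₁ i) (h₃ i)
    · rcases List.mem_cons.1 hy with rfl | hy
      · exact ev_mono t (fun i => by rw [fin_append]; exact Set.subset_union_right) h₄
      · exact ev_mono t (fun i => by rw [fin_append]; exact Set.subset_union_left) (h₂ hy)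

/-- A token in the denotation of a term is produced in finitely many steps and so consumes only a
finite part of each variable. Together with monotonicity this gives the β-law. -/
theorem ev_cont (t : Lm) : ∀ (γ : ℕ → D), ∀ b ∈ ev t γ,
    ∃ φ : ℕ → List Tok, (∀ i, fin (φ i) ⊆ γ i) ∧ b ∈ ev t fun i => fin (φ i) := by
  classical
  induction t with
  | var i =>
    intro γ b hb
    refine ⟨fun j => if j = i then [b] else [], fun j => ?_, by simp [ev, fin]⟩
    by_cases hj : j = i
    · subst hj; simpa [fin, ev] using hb
    · simp [fin, hj]
  | cst d => exact fun γ b hb => ⟨fun _ => [], fun i => by simp [fin], hb⟩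
  | app f a hf ha =>
    rintro γ b ⟨F, hF, hb⟩
    obtain ⟨φ, h₁, h₂⟩ := hf γ _ hb
    obtain ⟨ψ, h₃, h₄⟩ := ev_fin_list (ha γ) F hF
    refine ⟨fun i => φ i ++ ψ i, fun i => ?_, F, h₄.trans ?_, ?_⟩
    · rw [fin_append]; exact Set.union_subset (h₁ i) (h₃ i)
    · exact ev_mono a fun i => by rw [fin_append]; exact Set.subset_union_right
    · exact ev_mono f (fun i => by rw [fin_append]; exact Set.subset_union_left) h₂
  | lam t ht =>
    rintro γ _ ⟨F, b, rfl, hb⟩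
    obtain ⟨φ, h₁, h₂⟩ := ht _ b hb
    -- The approximation for variable `0` is contained in the finite set `F` already recorded in the
    -- token, so it is dropped and the indices shift by one.
    exact ⟨fun i => φ (i + 1), fun i => h₁ (i + 1), F, b, rfl, ev_mono t (fun i => by
      cases i with
      | zero => exact h₁ 0
      | succ i => exact subset_rfl) h₂⟩

@[simp] theorem ev_var (i : ℕ) (γ : ℕ → D) : ev (.var i) γ = γ i := rfl
@[simp] theorem ev_cst (d : D) (γ : ℕ → D) : ev (.cst d) γ = d := rfl
@[simp] theorem ev_app (f a : Lm) (γ : ℕ → D) : ev (.app f a) γ = ev f γ ⬝ ev a γ := rfl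

@[simp] theorem ev_lam_dapp (t : Lm) (γ : ℕ → D) (a : D) : ev (.lam t) γ ⬝ a = ev t (a ∷ₛ γ) := by
  ext b
  constructor
  · rintro ⟨F, hF, F', b', h, hb⟩
    cases h
    exact ev_mono t (scons_le hF fun _ => subset_rfl) hb
  · intro hb
    obtain ⟨φ, h₁, h₂⟩ := ev_cont t _ b hb
    -- The finite part of the argument used by the body is the finite set that labels the step in
    -- the graph.
    refine ⟨φ 0, h₁ 0, φ 0, b, rfl, ev_mono t (fun i => ?_) h₂⟩
    cases i with
    | zero => exact subset_rfl
    | succ i => exact h₁ (i + 1)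

/-- The element denoted by a closed λ-term. -/
def cl (t : Lm) : D := ev t fun _ => ∅

@[simp] theorem cl_lam_dapp (t : Lm) (a : D) : cl (.lam t) ⬝ a = ev t (a ∷ₛ fun _ => ∅) :=
  ev_lam_dapp ..

def dpair : D := cl (.lam (.lam (.lam (.app (.app (.var 0) (.var 2)) (.var 1)))))
def dtrue : D := cl (.lam (.lam (.var 1)))
def dfalse : D := cl (.lam (.lam (.var 0)))
def did : D := cl (.lam (.var 0))
/-- First projection of a realizer. -/
def d₁ (r : D) : D := r ⬝ dtrue
/-- Second projection of a realizer. -/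
def d₂ (r : D) : D := r ⬝ dfalse

@[simp] theorem d₁_pair (a b : D) : d₁ (dpair ⬝ a ⬝ b) = a := by simp [d₁, dpair, dtrue]
@[simp] theorem d₂_pair (a b : D) : d₂ (dpair ⬝ a ⬝ b) = b := by simp [d₂, dpair, dfalse]
@[simp] theorem did_dapp (a : D) : did ⬝ a = a := by simp [did]

end Graph

/-! ## Classes of sets with realizers -/

namespace Realiz

open Graph

/-- Values. -/
abbrev V : Type 1 := ZFSet.{0}

/-- A class of values with realizers; an element is a value that has a realizer. -/
abbrev Cls : Type 1 := V → D → Prop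

/-! ### Coding bounded classes by single sets -/

/-- A well-ordering of the type sends its elements to distinct ordinals, and these are sets. -/
theorem exists_inj (α : Type) : ∃ f : α → V, Function.Injective f := by
  refine ⟨fun a => (Ordinal.typein (WellOrderingRel (α := α)) a).toZFSet, fun a b h => ?_⟩
  exact Ordinal.typein_injective _ (Ordinal.toZFSet_injective h)

/-- An injection of a small type into the values. -/
noncomputable def inj {α : Type} : α → V := (exists_inj α).choose

theorem inj_injective {α : Type} : Function.Injective (inj (α := α)) := (exists_inj α).choose_spec

@[simp] theorem inj_inj {α : Type} {a b : α} : inj a = inj b ↔ a = b := inj_injective.eq_iff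

/-- The class whose realizability relation is coded by a set. -/
def decode (X : V) : Cls := fun x r => ZFSet.pair (inj r) x ∈ X

/-- The elements of the class form a set. -/
def Bdd (C : Cls) : Prop := ∃ Y : V, ∀ x r, C x r → x ∈ Y

-- The chosen bound is immaterial, since separation keeps exactly the realized pairs. An unbounded
-- class receives the default code `∅`, which does not decode to it.
open Classical in
noncomputable def encode (C : Cls) : V :=
  if h : Bdd C then
    (ZFSet.prod (ZFSet.range (inj (α := D))) h.choose).sep
      fun p => ∃ x r, p = ZFSet.pair (inj r) x ∧ C x r
  else ∅

/-- In a Kuratowski pair the second component lies two membership levels below the pair's container,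
so the double union bounds all elements. -/
theorem bdd_decode (X : V) : Bdd (decode X) := by
  refine ⟨(X.sUnion).sUnion, fun x r h => ?_⟩
  exact ZFSet.mem_sUnion_of_mem (z := {inj r, x}) (ZFSet.mem_pair.2 (.inr rfl))
    (ZFSet.mem_sUnion_of_mem (by simp [ZFSet.pair]) h)

theorem decode_encode {C : Cls} (h : Bdd C) : decode (encode C) = C := by
  funext x r
  simp only [decode, encode, dif_pos h, ZFSet.mem_sep, ZFSet.pair_mem_prod, ZFSet.pair_inj, inj_inj,
    ZFSet.mem_range_self, true_and, eq_iff_iff]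
  constructor
  · rintro ⟨-, x', r', ⟨rfl, rfl⟩, h⟩; exact h
  · exact fun hx => ⟨h.choose_spec _ _ hx, x, r, ⟨rfl, rfl⟩, hx⟩

theorem decode_encode_iff {C : Cls} : C = decode (encode C) ↔ Bdd C :=
  ⟨fun h => h ▸ bdd_decode _, fun h => (decode_encode h).symm⟩

/-! ### Functions and pairs as values -/

open Classical in
/-- The function on the elements of `C` that is given by `g`, as a set of pairs. -/
noncomputable def Lam (C : Cls) (g : V → V) : V :=
  if h : Bdd C then
    letI := Classical.allZFSetDefinable fun v : Fin 1 → V => ZFSet.pair (v 0) (g (v 0))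
    ZFSet.image (fun x => ZFSet.pair x (g x)) (h.choose.sep fun x => ∃ r, C x r)
  else ∅

open Classical in
noncomputable def App (f x : V) : V := if h : ∃ y, ZFSet.pair x y ∈ f then h.choose else ∅

/-- Membership does not mention the bound chosen in `Lam`; all later reasoning about graphs goes
through this description. -/
theorem mem_Lam {C : Cls} (h : Bdd C) {g : V → V} {p : V} :
    p ∈ Lam C g ↔ ∃ x, (∃ r, C x r) ∧ ZFSet.pair x (g x) = p := by
  simp only [Lam, dif_pos h, ZFSet.mem_image, ZFSet.mem_sep]
  constructor
  · rintro ⟨x, ⟨-, hx⟩, rfl⟩; exact ⟨x, hx, rfl⟩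
  · rintro ⟨x, ⟨r, hx⟩, rfl⟩; exact ⟨x, ⟨h.choose_spec _ _ hx, r, hx⟩, rfl⟩

theorem App_Lam {C : Cls} (h : Bdd C) {g : V → V} {x : V} {r : D} (hx : C x r) :
    App (Lam C g) x = g x := by
  have h' : ∃ y, ZFSet.pair x y ∈ Lam C g := ⟨g x, (mem_Lam h).2 ⟨x, ⟨r, hx⟩, rfl⟩⟩
  rw [App, dif_pos h']
  obtain ⟨x', -, e⟩ := (mem_Lam h).1 h'.choose_spec
  obtain ⟨rfl, e⟩ := ZFSet.pair_inj.1 e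
  exact e.symm

theorem Lam_congr {C : Cls} {g g' : V → V} (h : ∀ x r, C x r → g x = g' x) :
    Lam C g = Lam C g' := by
  by_cases hC : Bdd C
  · ext p
    rw [mem_Lam hC, mem_Lam hC]
    exact exists_congr fun x => and_congr_right fun ⟨r, hx⟩ => by rw [h x r hx]
  · simp [Lam, hC]

/-- Every abstraction is a graph in canonical form, as the first condition of `PI` demands. That
condition is what validates the η-rule. -/
theorem Lam_App_Lam (C : Cls) (g : V → V) : Lam C (App (Lam C g)) = Lam C g := by
  by_cases h : Bdd C
  · exact Lam_congr fun x r hx => App_Lam h hx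
  · simp [Lam, h]

open Classical in
noncomputable def fstV (p : V) : V := if h : ∃ a b, p = ZFSet.pair a b then h.choose else ∅

open Classical in
noncomputable def sndV (p : V) : V := if h : ∃ b a, p = ZFSet.pair a b then h.choose else ∅

@[simp] theorem fstV_pair (a b : V) : fstV (ZFSet.pair a b) = a := by
  have h : ∃ a' b', ZFSet.pair a b = ZFSet.pair a' b' := ⟨a, b, rfl⟩
  rw [fstV, dif_pos h]
  obtain ⟨b', e⟩ := h.choose_spec
  exact (ZFSet.pair_inj.1 e).1.symm

@[simp] theorem sndV_pair (a b : V) : sndV (ZFSet.pair a b) = b := by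
  have h : ∃ b' a', ZFSet.pair a b = ZFSet.pair a' b' := ⟨b, a, rfl⟩
  rw [sndV, dif_pos h]
  obtain ⟨a', e⟩ := h.choose_spec
  exact (ZFSet.pair_inj.1 e).2.symm

/-! ### Type formers on classes -/

/-- Dependent products. -/
def PI (A : Cls) (B : V → Cls) : Cls := fun f r =>
  f = Lam A (App f) ∧ ∀ x s, A x s → B x (App f x) (r ⬝ s)

/-- Dependent sums. -/
def SG (A : Cls) (B : V → Cls) : Cls := fun p r =>
  p = ZFSet.pair (fstV p) (sndV p) ∧ A (fstV p) (d₁ r) ∧ B (fstV p) (sndV p) (d₂ r)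

/-- The unit class. -/
def UN : Cls := fun x _ => x = ∅

theorem PI_congr {A A' : Cls} {B B' : V → Cls} (hA : A = A')
    (hB : ∀ x r, A x r → B x = B' x) : PI A B = PI A' B' := by
  subst hA
  funext f r
  exact propext (and_congr_right fun _ => forall_congr' fun x => forall_congr' fun s =>
    forall_congr' fun hx => by rw [hB x s hx])

theorem SG_congr {A A' : Cls} {B B' : V → Cls} (hA : A = A')
    (hB : ∀ x r, A x r → B x = B' x) : SG A B = SG A' B' := by
  subst hA
  funext p r
  exact propext (and_congr_right fun _ => and_congr_right fun hx => by rw [hB _ _ hx])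

theorem bdd_UN : Bdd UN := ⟨{∅}, fun _ _ h => ZFSet.mem_singleton.2 h⟩

/-- Replacement along the bounded base followed by union gives one bound for all fibres; fibres over
unrealized values play no role. -/
theorem exists_bdd_family {A : Cls} {B : V → Cls} (hA : Bdd A) (hB : ∀ x r, A x r → Bdd (B x)) :
    ∃ Y : V, ∀ x r, A x r → ∀ y s, B x y s → y ∈ Y := by
  classical
  obtain ⟨Z, hZ⟩ := hA
  let g : V → V := fun x => if h : Bdd (B x) then h.choose else ∅
  let := Classical.allZFSetDefinable fun v : Fin 1 → V => g (v 0)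
  refine ⟨(ZFSet.image g Z).sUnion, fun x r hx y s hy => ?_⟩
  refine ZFSet.mem_sUnion_of_mem (z := g x) ?_ (ZFSet.mem_image.2 ⟨x, hZ x r hx, rfl⟩)
  have h := hB x r hx
  simp only [g, dif_pos h]
  exact h.choose_spec _ _ hy

theorem bdd_PI {A : Cls} {B : V → Cls} (hA : Bdd A) (hB : ∀ x r, A x r → Bdd (B x)) :
    Bdd (PI A B) := by
  obtain ⟨Y, hY⟩ := exists_bdd_family hA hB
  obtain ⟨Z, hZ⟩ := id hA
  refine ⟨ZFSet.powerset (ZFSet.prod Z Y), fun f r ⟨hf, h⟩ => ?_⟩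
  rw [ZFSet.mem_powerset, hf]
  intro p hp
  obtain ⟨x, ⟨s, hx⟩, rfl⟩ := (mem_Lam hA).1 hp
  exact ZFSet.pair_mem_prod.2 ⟨hZ x s hx, hY x s hx _ _ (h x s hx)⟩

theorem bdd_SG {A : Cls} {B : V → Cls} (hA : Bdd A) (hB : ∀ x r, A x r → Bdd (B x)) :
    Bdd (SG A B) := by
  obtain ⟨Y, hY⟩ := exists_bdd_family hA hB
  obtain ⟨Z, hZ⟩ := id hA
  refine ⟨ZFSet.prod Z Y, fun p r ⟨hp, h₁, h₂⟩ => ?_⟩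
  rw [hp]
  exact ZFSet.pair_mem_prod.2 ⟨hZ _ _ h₁, hY _ _ h₁ _ _ h₂⟩

/-! ## Interpretation of raw terms -/

open LccLF LccLF.Tm LccLF.Judgement

variable {K : Type}

/-- A value, viewed also as a type. -/
def ofV (x : V) : V × Cls := (x, decode x)

/-- A class, viewed also as a value. -/
noncomputable def ofC (C : Cls) : V × Cls := (encode C, C)

/-- The value of a small type determines its class. -/
def Sm (p : V × Cls) : Prop := p.2 = decode p.1

theorem sm_ofV (x : V) : Sm (ofV x) := rfl

theorem sm_ofC {C : Cls} : Sm (ofC C) ↔ Bdd C := decode_encode_iff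

theorem Sm.eq {p q : V × Cls} (hp : Sm p) (hq : Sm q) (h : p.1 = q.1) : p = q :=
  Prod.ext h (by rw [hp, hq, h])

theorem Sm.bdd {p : V × Cls} (hp : Sm p) : Bdd p.2 := by rw [hp]; exact bdd_decode _

/-- The class of proofs of an equation; they carry the realizers of the left-hand side. -/
def EQ (A a b : V × Cls) : Cls := fun x r => x = ∅ ∧ a.1 = b.1 ∧ A.2 a.1 r ∧ Sm a ∧ Sm b

theorem bdd_EQ (A a b : V × Cls) : Bdd (EQ A a b) := ⟨{∅}, fun _ _ h => ZFSet.mem_singleton.2 h.1⟩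

/-- The interpretation of a raw term as an element and as a type, where `κ` interprets the
declared names. -/
noncomputable def interp (κ : K → V) : Tm K → (ℕ → V) → V × Cls
  | var i, ρ => ofV (ρ i)
  | con c, _ => ofV (κ c)
  -- This class is unbounded, so the value component is the default of `encode` and carries no
  -- information. Only the class component of a large type is used.
  | univ, _ => ofC fun _ _ => True
  | pi A B, ρ => ofC (PI (interp κ A ρ).2 fun x => (interp κ B (x ∷ₛ ρ)).2)
  | lam A t, ρ => ofV (Lam (interp κ A ρ).2 fun x => (interp κ t (x ∷ₛ ρ)).1)
  | app f a, ρ => ofV (App (interp κ f ρ).1 (interp κ a ρ).1)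
  | sigma A B, ρ => ofC (SG (interp κ A ρ).2 fun x => (interp κ B (x ∷ₛ ρ)).2)
  | pair a b, ρ => ofV (ZFSet.pair (interp κ a ρ).1 (interp κ b ρ).1)
  | fst p, ρ => ofV (fstV (interp κ p ρ).1)
  | snd p, ρ => ofV (sndV (interp κ p ρ).1)
  | unit, _ => ofC UN
  | Tm.star, _ => ofV ∅
  | eq A a b, ρ => ofC (EQ (interp κ A ρ) (interp κ a ρ) (interp κ b ρ))
  | Tm.refl _, _ => ofV ∅

noncomputable def val (κ : K → V) (t : Tm K) (ρ : ℕ → V) : V := (interp κ t ρ).1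
noncomputable def cls (κ : K → V) (t : Tm K) (ρ : ℕ → V) : Cls := (interp κ t ρ).2

theorem scons_liftRen (r : ℕ → ℕ) (x : V) (ρ : ℕ → V) :
    (fun i => (x ∷ₛ ρ) (liftRen r i)) = x ∷ₛ fun i => ρ (r i) := by
  funext i; cases i <;> rfl

theorem interp_rename (κ : K → V) (t : Tm K) : ∀ (r : ℕ → ℕ) (ρ : ℕ → V),
    interp κ (rename r t) ρ = interp κ t fun i => ρ (r i) := by
  induction t <;> intro r ρ <;> simp_all [rename, interp, scons_liftRen]

theorem interp_wk (κ : K → V) (n : ℕ) (t : Tm K) (ρ : ℕ → V) :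
    interp κ (wk n t) ρ = interp κ t fun i => ρ (i + n) := interp_rename ..

theorem interp_wk_one (κ : K → V) (t : Tm K) (x : V) (ρ : ℕ → V) :
    interp κ (wk 1 t) (x ∷ₛ ρ) = interp κ t ρ := interp_rename ..

theorem interp_liftSub (κ : K → V) (s : ℕ → Tm K) (x : V) (ρ : ℕ → V) (i : ℕ) :
    interp κ (liftSub s i) (x ∷ₛ ρ) = if i = 0 then ofV x else interp κ (s (i - 1)) ρ := by
  cases i with
  | zero => rfl
  | succ i => exact interp_wk_one ..

/-- Environments store values only, and a variable recovers its class by decoding. Substitution is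
therefore sound only for terms whose class is determined by their value, which is the reason that
`HasTm` includes smallness. -/
theorem interp_subst (κ : K → V) (t : Tm K) : ∀ (s : ℕ → Tm K) (ρ : ℕ → V),
    (∀ i, Sm (interp κ (s i) ρ)) →
    interp κ (subst s t) ρ = interp κ t fun i => (interp κ (s i) ρ).1 := by
  have lift : ∀ (s : ℕ → Tm K) (ρ : ℕ → V) (x : V), (∀ i, Sm (interp κ (s i) ρ)) →
      (∀ i, Sm (interp κ (liftSub s i) (x ∷ₛ ρ))) ∧
      (fun i => (interp κ (liftSub s i) (x ∷ₛ ρ)).1) = x ∷ₛ fun i => (interp κ (s i) ρ).1 := by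
    intro s ρ x h
    constructor
    · intro i
      cases i with
      | zero => exact sm_ofV x
      | succ i => rw [interp_liftSub]; exact h i
    · funext i
      cases i with
      | zero => rfl
      | succ i => rw [interp_liftSub]; rfl
  induction t <;> intro s ρ h
  case var i => exact (h i).eq (sm_ofV _) rfl
  case pi A B hA hB =>
    simp only [subst, interp, hA s ρ h]
    congr; funext x; rw [hB _ _ (lift s ρ x h).1, (lift s ρ x h).2]
  case sigma A B hA hB =>
    simp only [subst, interp, hA s ρ h]
    congr; funext x; rw [hB _ _ (lift s ρ x h).1, (lift s ρ x h).2]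
  case lam A t hA ht =>
    simp only [subst, interp, hA s ρ h]
    congr; funext x; rw [ht _ _ (lift s ρ x h).1, (lift s ρ x h).2]
  all_goals simp_all [subst, interp]

theorem interp_inst (κ : K → V) (t a : Tm K) (ρ : ℕ → V) (h : Sm (interp κ a ρ)) :
    interp κ (inst t a) ρ = interp κ t (val κ a ρ ∷ₛ ρ) := by
  rw [inst, interp_subst]
  · congr; funext i; cases i <;> rfl
  · intro i
    cases i with
    | zero => exact h
    | succ i => exact sm_ofV _

/-! ## Soundness -/

/-- The environment `ρ`, with realizers `γ`, satisfies the context. -/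
def Sat (κ : K → V) : Ctx K → (ℕ → V) → (ℕ → D) → Prop
  | [], _, _ => True
  | A :: Γ, ρ, γ => Sat κ Γ (fun i => ρ (i + 1)) (fun i => γ (i + 1)) ∧
      cls κ A (fun i => ρ (i + 1)) (ρ 0) (γ 0)

theorem Sat.cons {κ : K → V} {Γ : Ctx K} {A : Tm K} {ρ : ℕ → V} {γ : ℕ → D} {x : V} {r : D}
    (h : Sat κ Γ ρ γ) (hx : cls κ A ρ x r) : Sat κ (A :: Γ) (x ∷ₛ ρ) (r ∷ₛ γ) := ⟨h, hx⟩

theorem Sat.var {κ : K → V} : ∀ {Γ : Ctx K} {i : ℕ} {A : Tm K} {ρ : ℕ → V} {γ : ℕ → D},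
    Γ[i]? = some A → Sat κ Γ ρ γ → cls κ (wk (i + 1) A) ρ (ρ i) (γ i)
  | B :: Γ, 0, A, ρ, γ, h, hs => by
    obtain rfl : B = A := by simpa using h
    simpa [cls, interp_wk] using hs.2
  | B :: Γ, i + 1, A, ρ, γ, h, hs => by
    have := Sat.var (Γ := Γ) (i := i) (A := A) (by simpa using h) hs.1
    simpa [cls, interp_wk, add_assoc, add_comm, add_left_comm] using this

/-- Semantic typing: `t` is small, and some λ-term computes realizers of `t` from those of the
variables. -/
def HasTm (κ : K → V) (Γ : Ctx K) (t A : Tm K) : Prop :=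
  (∃ e : Lm, ∀ ρ γ, Sat κ Γ ρ γ → cls κ A ρ (val κ t ρ) (ev e γ)) ∧
  ∀ ρ γ, Sat κ Γ ρ γ → Sm (interp κ t ρ)

/-- Semantic validity of judgements. -/
def Valid (κ : K → V) : Judgement K → Prop
  | ctx _ => True
  | type _ _ => True
  | term Γ t A => HasTm κ Γ t A
  | tyEq Γ A B => ∀ ρ γ, Sat κ Γ ρ γ → cls κ A ρ = cls κ B ρ
  | tmEq Γ t u A => HasTm κ Γ t A ∧ ∀ ρ γ, Sat κ Γ ρ γ → interp κ t ρ = interp κ u ρ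

theorem HasTm.of_eq {κ : K → V} {Γ : Ctx K} {t u A B : Tm K} (h : HasTm κ Γ t A)
    (hA : ∀ ρ γ, Sat κ Γ ρ γ → cls κ A ρ = cls κ B ρ)
    (ht : ∀ ρ γ, Sat κ Γ ρ γ → interp κ t ρ = interp κ u ρ) : HasTm κ Γ u B := by
  obtain ⟨⟨e, he⟩, hs⟩ := h
  refine ⟨⟨e, fun ρ γ hρ => ?_⟩, fun ρ γ hρ => ht ρ γ hρ ▸ hs ρ γ hρ⟩
  rw [← hA ρ γ hρ, val, ← ht ρ γ hρ]
  exact he ρ γ hρ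

theorem HasTm.sm {κ : K → V} {Γ : Ctx K} {t A : Tm K} (h : HasTm κ Γ t A)
    {ρ : ℕ → V} {γ : ℕ → D} (hρ : Sat κ Γ ρ γ) : Sm (interp κ t ρ) := h.2 ρ γ hρ

theorem HasTm.pi_intro {κ : K → V} {Γ : Ctx K} {A t B : Tm K} (hA : HasTm κ Γ A univ)
    (ht : HasTm κ (A :: Γ) t B) : HasTm κ Γ (lam A t) (pi A B) := by
  obtain ⟨⟨e, he⟩, -⟩ := ht
  refine ⟨⟨.lam e, fun ρ γ hρ => ⟨(Lam_App_Lam _ _).symm, fun x s hx => ?_⟩⟩,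
    fun ρ γ hρ => sm_ofV _⟩
  have : App (val κ (lam A t) ρ) x = val κ t (x ∷ₛ ρ) := App_Lam (hA.sm hρ).bdd hx
  rw [this, ev_lam_dapp]
  exact he _ _ (hρ.cons hx)

theorem interp_pi_congr {κ : K → V} {Γ : Ctx K} {A A' B B' : Tm K}
    (hA : ∀ ρ γ, Sat κ Γ ρ γ → cls κ A ρ = cls κ A' ρ)
    (hB : ∀ ρ γ, Sat κ (A :: Γ) ρ γ → cls κ B ρ = cls κ B' ρ) {ρ : ℕ → V} {γ : ℕ → D}
    (hρ : Sat κ Γ ρ γ) : interp κ (pi A B) ρ = interp κ (pi A' B') ρ :=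
  congrArg ofC (PI_congr (hA ρ γ hρ) fun _ _ hx => hB _ _ (hρ.cons hx))

theorem interp_sigma_congr {κ : K → V} {Γ : Ctx K} {A A' B B' : Tm K}
    (hA : ∀ ρ γ, Sat κ Γ ρ γ → cls κ A ρ = cls κ A' ρ)
    (hB : ∀ ρ γ, Sat κ (A :: Γ) ρ γ → cls κ B ρ = cls κ B' ρ) {ρ : ℕ → V} {γ : ℕ → D}
    (hρ : Sat κ Γ ρ γ) : interp κ (sigma A B) ρ = interp κ (sigma A' B') ρ :=
  congrArg ofC (SG_congr (hA ρ γ hρ) fun _ _ hx => hB _ _ (hρ.cons hx))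

theorem HasTm.app {κ : K → V} {Γ : Ctx K} {f a A B : Tm K} (hf : HasTm κ Γ f (pi A B))
    (ha : HasTm κ Γ a A) : HasTm κ Γ (app f a) (inst B a) := by
  obtain ⟨⟨e, he⟩, -⟩ := hf
  obtain ⟨e', he'⟩ := ha.1
  refine ⟨⟨.app e e', fun ρ γ hρ => ?_⟩, fun ρ γ hρ => sm_ofV _⟩
  rw [cls, interp_inst _ _ _ _ (ha.sm hρ)]
  exact (he ρ γ hρ).2 _ _ (he' ρ γ hρ)

theorem HasTm.pair {κ : K → V} {Γ : Ctx K} {a b A B : Tm K} (ha : HasTm κ Γ a A)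
    (hb : HasTm κ Γ b (inst B a)) : HasTm κ Γ (pair a b) (sigma A B) := by
  obtain ⟨e, he⟩ := ha.1
  obtain ⟨⟨e', he'⟩, -⟩ := hb
  refine ⟨⟨.app (.app (.cst dpair) e) e', fun ρ γ hρ => ?_⟩, fun ρ γ hρ => sm_ofV _⟩
  have h := he' ρ γ hρ
  rw [cls, interp_inst _ _ _ _ (ha.sm hρ)] at h
  refine ⟨?_, ?_, ?_⟩
  · simp [val, interp, ofV]
  · simpa [val, interp, ofV, cls] using he ρ γ hρ
  · simpa [val, interp, ofV] using h

theorem HasTm.fst {κ : K → V} {Γ : Ctx K} {p A B : Tm K} (hp : HasTm κ Γ p (sigma A B)) :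
    HasTm κ Γ (fst p) A := by
  obtain ⟨⟨e, he⟩, -⟩ := hp
  exact ⟨⟨.app e (.cst dtrue), fun ρ γ hρ => (he ρ γ hρ).2.1⟩, fun ρ γ hρ => sm_ofV _⟩

theorem HasTm.snd {κ : K → V} {Γ : Ctx K} {p A B : Tm K} (hp : HasTm κ Γ p (sigma A B)) :
    HasTm κ Γ (snd p) (inst B (Tm.fst p)) := by
  have hf := hp.fst
  obtain ⟨⟨e, he⟩, -⟩ := hp
  refine ⟨⟨.app e (.cst dfalse), fun ρ γ hρ => ?_⟩, fun ρ γ hρ => sm_ofV _⟩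
  rw [cls, interp_inst _ _ _ _ (hf.sm hρ)]
  exact (he ρ γ hρ).2.2

/-- Any realizer realizes any value as an element of the universe, so membership reduces to
smallness. -/
theorem hasTm_univ {κ : K → V} {Γ : Ctx K} {A : Tm K}
    (h : ∀ ρ γ, Sat κ Γ ρ γ → Sm (interp κ A ρ)) : HasTm κ Γ A univ :=
  ⟨⟨.cst ∅, fun _ _ _ => trivial⟩, h⟩

/-- Induction on derivations. Type formation carries no semantic content because the interpretation
is total; closure of the universe is boundedness of `PI`, `SG` and `EQ`. Equalities of terms are
proved on values and extended to classes by smallness of both sides. -/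
theorem soundness (κ : K → V) (S : K → Tm K)
    (hS : ∀ c, ∃ d : D, ∀ ρ, cls κ (S c) ρ (κ c) d) {J : Judgement K} (h : Derivable S J) :
    Valid κ J := by
  induction h with
  | ctx_nil => trivial
  | ctx_cons => trivial
  | @var Γ i A _ hA =>
    exact ⟨⟨.var i, fun ρ γ hρ => hρ.var hA⟩, fun ρ γ hρ => sm_ofV _⟩
  | con c =>
    obtain ⟨d, hd⟩ := hS c
    exact ⟨⟨.cst d, fun ρ γ hρ => hd ρ⟩, fun ρ γ hρ => sm_ofV _⟩
  | ty_refl => exact fun _ _ _ => rfl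
  | ty_symm _ h => exact fun ρ γ hρ => (h ρ γ hρ).symm
  | ty_trans _ _ h h' => exact fun ρ γ hρ => (h ρ γ hρ).trans (h' ρ γ hρ)
  | tm_refl _ h => exact ⟨h, fun _ _ _ => rfl⟩
  | tm_symm _ h => exact ⟨h.1.of_eq (fun _ _ _ => rfl) h.2, fun ρ γ hρ => (h.2 ρ γ hρ).symm⟩
  | tm_trans _ _ h h' => exact ⟨h.1, fun ρ γ hρ => (h.2 ρ γ hρ).trans (h'.2 ρ γ hρ)⟩
  | conv _ _ h h' => exact h.of_eq h' fun _ _ _ => rfl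
  | conv_eq _ _ h h' => exact ⟨h.1.of_eq h' fun _ _ _ => rfl, h.2⟩
  | univ_type => trivial
  | el_type => trivial
  | el_eq _ h => exact fun ρ γ hρ => congrArg Prod.snd (h.2 ρ γ hρ)
  | unit_univ => exact hasTm_univ fun _ _ _ => sm_ofC.2 bdd_UN
  | star => exact ⟨⟨.cst ∅, fun _ _ _ => rfl⟩, fun _ _ _ => sm_ofV _⟩
  | unit_eta _ h =>
    obtain ⟨e, he⟩ := h.1
    exact ⟨h, fun ρ γ hρ => (h.sm hρ).eq (sm_ofV _) (he ρ γ hρ)⟩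
  | pi_type => trivial
  | pi_type_congr _ _ hA hB =>
    exact fun ρ γ hρ => congrArg Prod.snd
      (interp_pi_congr (fun ρ γ hρ => congrArg Prod.snd (hA.2 ρ γ hρ)) hB hρ)
  | pi_univ _ _ hA hB =>
    exact hasTm_univ fun ρ γ hρ =>
      sm_ofC.2 (bdd_PI (hA.sm hρ).bdd fun x r hx => (hB.sm (hρ.cons hx)).bdd)
  | pi_univ_congr _ _ hA hB =>
    exact ⟨hasTm_univ fun ρ γ hρ =>
      sm_ofC.2 (bdd_PI (hA.1.sm hρ).bdd fun x r hx => (hB.1.sm (hρ.cons hx)).bdd),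
      fun ρ γ hρ => interp_pi_congr (fun ρ γ hρ => congrArg Prod.snd (hA.2 ρ γ hρ))
        (fun ρ γ hρ => congrArg Prod.snd (hB.2 ρ γ hρ)) hρ⟩
  | lam _ _ hA ht => exact hA.pi_intro ht
  | lam_congr _ _ hA ht =>
    refine ⟨hA.1.pi_intro ht.1, fun ρ γ hρ => congrArg ofV ?_⟩
    rw [hA.2 ρ γ hρ]
    refine Lam_congr fun x r hx => congrArg Prod.fst (ht.2 _ _ (hρ.cons (r := r) ?_))
    rw [cls, hA.2 ρ γ hρ]
    exact hx
  | app _ _ hf ha => exact hf.app ha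
  | app_congr _ _ hf ha =>
    exact ⟨hf.1.app ha.1, fun ρ γ hρ => by simp only [interp, hf.2 ρ γ hρ, ha.2 ρ γ hρ]⟩
  | @pi_beta Γ A t B a _ _ _ hA ht ha =>
    refine ⟨(hA.pi_intro ht).app ha, fun ρ γ hρ => ?_⟩
    obtain ⟨e, he⟩ := ha.1
    have hρ' := hρ.cons (he ρ γ hρ)
    rw [interp_inst _ _ _ _ (ha.sm hρ)]
    exact (sm_ofV _).eq (ht.sm hρ') (App_Lam (hA.sm hρ).bdd (he ρ γ hρ))
  | @pi_eta Γ f A B _ h =>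
    obtain ⟨e, he⟩ := h.1
    have hf : ∀ ρ γ, Sat κ Γ ρ γ →
        interp κ (.lam A (.app (wk 1 f) (.var 0))) ρ = interp κ f ρ := by
      intro ρ γ hρ
      -- An element of a product equals the graph of its own application; this is the first
      -- component of membership in `PI`.
      refine (sm_ofV _).eq (h.sm hρ) (Eq.trans ?_ (he ρ γ hρ).1.symm)
      simp only [interp, interp_wk_one]
      rfl
    exact ⟨h.of_eq (fun _ _ _ => rfl) fun ρ γ hρ => (hf ρ γ hρ).symm, hf⟩
  | sigma_type => trivial
  | sigma_type_congr _ _ hA hB =>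
    exact fun ρ γ hρ => congrArg Prod.snd (interp_sigma_congr hA hB hρ)
  | sigma_univ _ _ hA hB =>
    exact hasTm_univ fun ρ γ hρ =>
      sm_ofC.2 (bdd_SG (hA.sm hρ).bdd fun x r hx => (hB.sm (hρ.cons hx)).bdd)
  | sigma_univ_congr _ _ hA hB =>
    exact ⟨hasTm_univ fun ρ γ hρ =>
      sm_ofC.2 (bdd_SG (hA.1.sm hρ).bdd fun x r hx => (hB.1.sm (hρ.cons hx)).bdd),
      fun ρ γ hρ => interp_sigma_congr (fun ρ γ hρ => congrArg Prod.snd (hA.2 ρ γ hρ))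
        (fun ρ γ hρ => congrArg Prod.snd (hB.2 ρ γ hρ)) hρ⟩
  | pair _ _ _ _ ha hb => exact ha.pair hb
  | pair_congr _ _ _ _ ha hb =>
    exact ⟨ha.1.pair hb.1, fun ρ γ hρ => by simp only [interp, ha.2 ρ γ hρ, hb.2 ρ γ hρ]⟩
  | fst _ h => exact h.fst
  | fst_congr _ h => exact ⟨h.1.fst, fun ρ γ hρ => by simp only [interp, h.2 ρ γ hρ]⟩
  | snd _ h => exact h.snd
  | snd_congr _ h => exact ⟨h.1.snd, fun ρ γ hρ => by simp only [interp, h.2 ρ γ hρ]⟩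
  | @sigma_beta_fst Γ a b A B _ _ _ _ ha hb =>
    have h : ∀ ρ γ, Sat κ Γ ρ γ → interp κ (.fst (.pair a b)) ρ = interp κ a ρ :=
      fun ρ γ hρ => (sm_ofV _).eq (ha.sm hρ) (fstV_pair _ _)
    exact ⟨ha.of_eq (fun _ _ _ => rfl) fun ρ γ hρ => (h ρ γ hρ).symm, h⟩
  | @sigma_beta_snd Γ a b A B _ _ _ _ ha hb =>
    have h : ∀ ρ γ, Sat κ Γ ρ γ → interp κ (.snd (.pair a b)) ρ = interp κ b ρ :=
      fun ρ γ hρ => (sm_ofV _).eq (hb.sm hρ) (sndV_pair _ _)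
    exact ⟨hb.of_eq (fun _ _ _ => rfl) fun ρ γ hρ => (h ρ γ hρ).symm, h⟩
  | @sigma_eta Γ p A B _ hp =>
    obtain ⟨e, he⟩ := hp.1
    have h : ∀ ρ γ, Sat κ Γ ρ γ → interp κ (.pair (.fst p) (.snd p)) ρ = interp κ p ρ :=
      fun ρ γ hρ => (sm_ofV _).eq (hp.sm hρ) (he ρ γ hρ).1.symm
    exact ⟨hp.of_eq (fun _ _ _ => rfl) fun ρ γ hρ => (h ρ γ hρ).symm, h⟩
  | eq_univ => exact hasTm_univ fun ρ γ hρ => sm_ofC.2 (bdd_EQ _ _ _)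
  | eq_univ_congr _ _ _ hA ha hb =>
    exact ⟨hasTm_univ fun ρ γ hρ => sm_ofC.2 (bdd_EQ _ _ _), fun ρ γ hρ => by
      simp only [interp, hA.2 ρ γ hρ, ha.2 ρ γ hρ, hb.2 ρ γ hρ]⟩
  | refl _ _ _ ha =>
    obtain ⟨e, he⟩ := ha.1
    exact ⟨⟨e, fun ρ γ hρ => ⟨rfl, rfl, he ρ γ hρ, ha.sm hρ, ha.sm hρ⟩⟩, fun ρ γ hρ => sm_ofV _⟩
  | reflection _ h =>
    -- The rule has no premise typing the two sides. The realizer of the left side and the smallness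
    -- of both sides are read off from the proof, which is why `EQ` includes them.
    obtain ⟨⟨e, he⟩, -⟩ := h
    exact ⟨⟨⟨e, fun ρ γ hρ => (he ρ γ hρ).2.2.1⟩, fun ρ γ hρ => (he ρ γ hρ).2.2.2.1⟩,
      fun ρ γ hρ => (he ρ γ hρ).2.2.2.1.eq (he ρ γ hρ).2.2.2.2 (he ρ γ hρ).2.1⟩
  | eq_unique _ _ hp hq =>
    obtain ⟨e, he⟩ := hp.1
    obtain ⟨e', he'⟩ := hq.1
    -- Every proof of an equation has the value `∅`.
    exact ⟨hp, fun ρ γ hρ => (hp.sm hρ).eq (hq.sm hρ) ((he ρ γ hρ).1.trans (he' ρ γ hρ).1.symm)⟩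

end Realiz

namespace Realiz

open Graph

/-! ## Modest classes and object types -/

/-- A class is modest if a realizer determines the element. -/
def Mod (C : Cls) : Prop := ∀ x y r, C x r → C y r → x = y

/-- The class whose elements are the sets in `R`, realized by their members. -/
def perC (R : Set (Set D)) : Cls := fun x r => ∃ c ∈ R, x = inj c ∧ r ∈ c

theorem bdd_perC (R : Set (Set D)) : Bdd (perC R) :=
  ⟨ZFSet.range (inj (α := Set D)), fun _ _ ⟨c, _, h, _⟩ => ZFSet.mem_range.2 ⟨c, h.symm⟩⟩

/-- Codes of object types: partial equivalence relations on realizers. -/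
def IsTy (A : V) : Prop :=
  ∃ R : Set (Set D), (∀ c ∈ R, ∀ c' ∈ R, ∀ r, r ∈ c → r ∈ c' → c = c') ∧ A = encode (perC R)

/-- The class of object types, with trivial realizers. -/
def TY : Cls := fun A _ => IsTy A

/-- Object types are indexed by sets of sets of realizers, a small type. Quantification over all
object types is therefore a product over a small class, as impredicativity requires. -/
theorem bdd_TY : Bdd TY :=
  ⟨ZFSet.range fun R : Set (Set D) => encode (perC R),
    fun _ _ ⟨R, _, h⟩ => ZFSet.mem_range.2 ⟨R, h.symm⟩⟩

theorem IsTy.mod {A : V} (h : IsTy A) : Mod (decode A) := by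
  obtain ⟨R, hR, rfl⟩ := h
  rw [decode_encode (bdd_perC R)]
  rintro _ _ r ⟨c, hc, rfl, hr⟩ ⟨c', hc', rfl, hr'⟩
  rw [hR c hc c' hc' r hr hr']

/-- If `r` realizes two functions, then `r ⬝ s` realizes both of their values at any argument with
realizer `s`, so the values agree. The base need not be modest, which makes impredicative products
possible. -/
theorem mod_PI {A : Cls} {B : V → Cls} (hB : ∀ x r, A x r → Mod (B x)) : Mod (PI A B) := by
  rintro f g r ⟨hf, h⟩ ⟨hg, h'⟩
  rw [hf, hg]
  exact Lam_congr fun x s hx => hB x s hx _ _ _ (h x s hx) (h' x s hx)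

/-! ### Replacing a modest class by an isomorphic object type -/

/-- The object type that is isomorphic to the modest class `C`. -/
noncomputable def mo (C : Cls) : V := encode (perC {c | Mod C ∧ ∃ x r, C x r ∧ c = {r | C x r}})

/-- The element of `mo C` that corresponds to `x`. -/
noncomputable def quo (C : Cls) (x : V) : V := inj {r | C x r}

open Classical in
/-- The element of `C` that corresponds to `y`. -/
noncomputable def rep (C : Cls) (y : V) : V :=
  if h : ∃ x r, C x r ∧ y = quo C x then h.choose else ∅

-- Two realizer sets with a common member come from the same element by modesty. For a class that is
-- not modest the family is empty, so no hypothesis is needed.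
@[simp] theorem isTy_mo (C : Cls) : IsTy (mo C) := by
  refine ⟨_, ?_, rfl⟩
  rintro _ ⟨h, x, s, hx, rfl⟩ _ ⟨-, y, t, hy, rfl⟩ r hr hr'
  rw [h x y r hr hr']

/-- The element corresponding to `x` keeps exactly the realizers of `x`, so both directions of the
isomorphism are realized by the identity. -/
theorem decode_mo {C : Cls} (h : Mod C) {y : V} {r : D} :
    decode (mo C) y r ↔ ∃ x, C x r ∧ y = quo C x := by
  rw [mo, decode_encode (bdd_perC _)]
  constructor
  · rintro ⟨_, ⟨-, x, s, hx, rfl⟩, rfl, hr⟩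
    exact ⟨x, hr, rfl⟩
  · rintro ⟨x, hx, rfl⟩
    exact ⟨_, ⟨h, x, r, hx, rfl⟩, rfl, hx⟩

theorem quo_mem {C : Cls} (h : Mod C) {x : V} {r : D} (hx : C x r) : decode (mo C) (quo C x) r :=
  (decode_mo h).2 ⟨x, hx, rfl⟩

/-- A preimage chosen by `rep` has the same realizers as `x`; sharing one of them, it equals `x` by
modesty. -/
theorem rep_quo {C : Cls} (h : Mod C) {x : V} {r : D} (hx : C x r) : rep C (quo C x) = x := by
  have h' : ∃ x' r, C x' r ∧ quo C x = quo C x' := ⟨x, r, hx, rfl⟩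
  rw [rep, dif_pos h']
  obtain ⟨s, -, e⟩ := h'.choose_spec
  exact (h x _ r hx (Set.ext_iff.1 (inj_injective e) r |>.1 hx)).symm

theorem rep_mem {C : Cls} (h : Mod C) {y : V} {r : D} (hy : decode (mo C) y r) : C (rep C y) r := by
  obtain ⟨x, hx, rfl⟩ := (decode_mo h).1 hy
  rwa [rep_quo h hx]

theorem quo_rep {C : Cls} (h : Mod C) {y : V} {r : D} (hy : decode (mo C) y r) :
    quo C (rep C y) = y := by
  obtain ⟨x, hx, rfl⟩ := (decode_mo h).1 hy
  rw [rep_quo h hx]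

/-! ## Kinds -/

inductive Kind : Type
  | ty
  | fn (k l : Kind)

/-- The class of elements of a kind. -/
def elK : Kind → Cls
  | .ty => TY
  | .fn k l => PI (elK k) fun _ => elK l

/-- Codes of kinds. -/
def IsKi (x : V) : Prop := ∃ k : Kind, x = inj k
def KI : Cls := fun x _ => IsKi x

open Classical in
noncomputable def kind (x : V) : Kind := if h : ∃ k : Kind, x = inj k then h.choose else .ty

@[simp] theorem kind_inj (k : Kind) : kind (inj k) = k := by
  have h : ∃ l : Kind, inj k = inj l := ⟨k, rfl⟩
  rw [kind, dif_pos h]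
  exact (inj_injective h.choose_spec).symm

/-- The class of elements of the kind with a given code. -/
noncomputable def EL (x : V) : Cls := elK (kind x)

noncomputable def tyV : V := inj Kind.ty
noncomputable def kfunV (k l : V) : V := inj (Kind.fn (kind k) (kind l))

@[simp] theorem EL_tyV : EL tyV = TY := by simp [EL, tyV, elK]
-- The elements of a function kind are the functions themselves, so the isomorphism for `kfun` can
-- be the identity.
theorem EL_kfunV (k l : V) : EL (kfunV k l) = PI (EL k) fun _ => EL l := by
  simp [EL, kfunV, elK]

theorem bdd_KI : Bdd KI :=
  ⟨ZFSet.range (inj (α := Kind)), fun _ _ ⟨k, h⟩ => ZFSet.mem_range.2 ⟨k, h.symm⟩⟩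

theorem bdd_elK : ∀ k, Bdd (elK k)
  | .ty => bdd_TY
  | .fn k l => bdd_PI (bdd_elK k) fun _ _ _ => bdd_elK l

theorem bdd_EL (x : V) : Bdd (EL x) := bdd_elK _

@[simp] theorem isKi_tyV : IsKi tyV := ⟨_, rfl⟩
@[simp] theorem isKi_kfunV (k l : V) : IsKi (kfunV k l) := ⟨_, rfl⟩

theorem PI_Lam {A : Cls} {B : V → Cls} {g : V → V} {d : D} (hA : Bdd A)
    (h : ∀ x r, A x r → B x (g x) (d ⬝ r)) : PI A B (Lam A g) d :=
  ⟨(Lam_App_Lam A g).symm, fun x r hx => by rw [App_Lam hA hx]; exact h x r hx⟩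

theorem SG_pair {A : Cls} {B : V → Cls} {a b : V} {d e : D} (ha : A a d) (hb : B a b e) :
    SG A B (ZFSet.pair a b) (dpair ⬝ d ⬝ e) := by
  simp [SG, ha, hb]

/-- Type operators. -/
def IsEf (F : V) : Prop := F = Lam TY (App F) ∧ ∀ A, IsTy A → IsTy (App F A)
def EF : Cls := fun F _ => IsEf F

/-- Operators on type operators. -/
def IsHt (H : V) : Prop := H = Lam EF (App H) ∧ ∀ F, IsEf F → IsEf (App H F)
def HT : Cls := fun H _ => IsHt H

/-- Realizers of object types are arbitrary, so the realizer condition of the product is vacuous and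
`∅` serves as a sample realizer. -/
theorem EF_eq : EF = PI TY fun _ => TY := by
  funext F r
  exact propext ⟨fun h => ⟨h.1, fun A _ hA => h.2 A hA⟩, fun h => ⟨h.1, fun A hA => h.2 A ∅ hA⟩⟩

theorem HT_eq : HT = PI EF fun _ => EF := by
  funext F r
  exact propext ⟨fun h => ⟨h.1, fun A _ hA => h.2 A hA⟩, fun h => ⟨h.1, fun A hA => h.2 A ∅ hA⟩⟩

@[simp] theorem EL_efty : EL (kfunV tyV tyV) = EF := by simp [EL_kfunV, EF_eq]
@[simp] theorem EL_htyco : EL (kfunV (kfunV tyV tyV) (kfunV tyV tyV)) = HT := by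
  rw [EL_kfunV, EL_efty, HT_eq]

@[simp] theorem EF_iff {F : V} {r : D} : EF F r ↔ IsEf F := Iff.rfl
@[simp] theorem HT_iff {H : V} {r : D} : HT H r ↔ IsHt H := Iff.rfl
theorem bdd_EF : Bdd EF := EL_efty ▸ bdd_EL _
theorem bdd_HT : Bdd HT := EL_htyco ▸ bdd_EL _

theorem isEf_Lam {g : V → V} (h : ∀ A, IsTy A → IsTy (g A)) : IsEf (Lam TY g) :=
  ⟨(Lam_App_Lam _ _).symm, fun A hA => by rw [App_Lam bdd_TY (r := ∅) hA]; exact h A hA⟩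

theorem IsEf.app {F A : V} (hF : IsEf F) (hA : IsTy A) : IsTy (App F A) := hF.2 A hA
theorem IsHt.app {H F : V} (hH : IsHt H) (hF : IsEf F) : IsEf (App H F) := hH.2 F hF

/-! ## Object types -/

/-- The class of functions between object types. -/
def FN (A B : V) : Cls := PI (decode A) fun _ => decode B
/-- The class of polymorphic functions. -/
def ALL (C : Cls) (g : V → V) : Cls := PI C fun x => decode (g x)
noncomputable def tfunV (A B : V) : V := mo (FN A B)
noncomputable def allV (C : Cls) (g : V → V) : V := mo (ALL C g)

@[simp] theorem isTy_tfunV (A B : V) : IsTy (tfunV A B) := isTy_mo _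
@[simp] theorem isTy_allV (C : Cls) (g : V → V) : IsTy (allV C g) := isTy_mo _

theorem bdd_FN (A B : V) : Bdd (FN A B) := bdd_PI (bdd_decode A) fun _ _ _ => bdd_decode B
theorem bdd_ALL {C : Cls} (h : Bdd C) (g : V → V) : Bdd (ALL C g) :=
  bdd_PI h fun _ _ _ => bdd_decode _
theorem mod_FN (A : V) {B : V} (h : IsTy B) : Mod (FN A B) := mod_PI fun _ _ _ => h.mod
theorem mod_ALL {C : Cls} {g : V → V} (h : ∀ x r, C x r → IsTy (g x)) : Mod (ALL C g) :=
  mod_PI fun x r hx => (h x r hx).mod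

theorem ALL_congr {C : Cls} {g g' : V → V} (h : ∀ x r, C x r → g x = g' x) :
    ALL C g = ALL C g' := PI_congr rfl fun x r hx => by rw [h x r hx]

theorem allV_congr {C : Cls} {g g' : V → V} (h : ∀ x r, C x r → g x = g' x) :
    allV C g = allV C g' := congrArg mo (ALL_congr h)

noncomputable def appTV (A B f a : V) : V := App (rep (FN A B) f) a
noncomputable def appAllV (g : V → V) (t α : V) : V := App (rep (ALL TY g) t) α

theorem appTV_mem {A B f a : V} {d e : D} (hB : IsTy B) (hf : decode (tfunV A B) f d)
    (ha : decode A a e) : decode B (appTV A B f a) (d ⬝ e) :=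
  (rep_mem (mod_FN A hB) hf).2 a e ha

theorem appAllV_mem {g : V → V} {t α : V} {d e : D} (hg : ∀ α, IsTy α → IsTy (g α))
    (ht : decode (allV TY g) t d) (hα : IsTy α) : decode (g α) (appAllV g t α) (d ⬝ e) :=
  (rep_mem (mod_ALL fun x _ hx => hg x hx) ht).2 α e hα

/-! ### Isomorphisms -/

noncomputable def isoV (C C' : Cls) (f g : V → V) : V :=
  ZFSet.pair (Lam C f) (ZFSet.pair (Lam C' g)
    (ZFSet.pair (Lam C fun _ => ∅) (Lam C' fun _ => ∅)))

def isoR : D := dpair ⬝ did ⬝ (dpair ⬝ did ⬝ (dpair ⬝ did ⬝ did))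

/-- The isomorphism between `mo C` and `C`. -/
noncomputable def moIso (C : Cls) : V := isoV (decode (mo C)) C (rep C) (quo C)

/-! ### Raw functors, monads, higher-order functors and handlers -/

noncomputable def fmapTyV (F : V) : V :=
  allV TY fun α => allV TY fun β => tfunV (tfunV α β) (tfunV (App F α) (App F β))
noncomputable def retTyV (M : V) : V := allV TY fun α => tfunV α (App M α)
noncomputable def bindTyV (M : V) : V :=
  allV TY fun α => allV TY fun β =>
    tfunV (App M α) (tfunV (tfunV α (App M β)) (App M β))
noncomputable def transV (F G : V) : V := allV TY fun α => tfunV (App F α) (App G α)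

/-- Raw functors. -/
noncomputable def RF : Cls := SG EF fun F => decode (fmapTyV F)
/-- Raw monads. -/
noncomputable def RM : Cls :=
  SG EF fun M => SG (decode (retTyV M)) fun _ => decode (bindTyV M)
/-- Raw higher-order functors. -/
noncomputable def RH : Cls :=
  SG HT fun H => SG (PI RF fun F => decode (fmapTyV (App H (fstV F)))) fun _ =>
    PI RF fun F => PI RF fun G => PI (decode (transV (fstV F) (fstV G))) fun _ =>
      decode (transV (App H (fstV F)) (App H (fstV G)))
/-- Handlers. -/
noncomputable def HD (H : V) : Cls :=
  SG RM fun M => decode (transV (App (fstV H) (fstV M)) (fstV M))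

theorem bdd_RF : Bdd RF := bdd_SG bdd_EF fun _ _ _ => bdd_decode _
theorem bdd_RM : Bdd RM :=
  bdd_SG bdd_EF fun _ _ _ => bdd_SG (bdd_decode _) fun _ _ _ => bdd_decode _
theorem bdd_RH : Bdd RH :=
  bdd_SG bdd_HT fun _ _ _ => bdd_SG (bdd_PI bdd_RF fun _ _ _ => bdd_decode _) fun _ _ _ =>
    bdd_PI bdd_RF fun _ _ _ => bdd_PI bdd_RF fun _ _ _ => bdd_PI (bdd_decode _) fun _ _ _ =>
      bdd_decode _
theorem bdd_HD (H : V) : Bdd (HD H) := bdd_SG bdd_RM fun _ _ _ => bdd_decode _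

theorem RF_isEf {F : V} {d : D} (h : RF F d) : IsEf (fstV F) := h.2.1
theorem RM_isEf {M : V} {d : D} (h : RM M d) : IsEf (fstV M) := h.2.1
theorem RH_isHt {H : V} {d : D} (h : RH H d) : IsHt (fstV H) := h.2.1
theorem HD_rm {H h : V} {d : D} (hh : HD H h d) : RM (fstV h) (d₁ d) := hh.2.1
theorem HD_isEf {H h : V} {d : D} (hh : HD H h d) : IsEf (fstV (fstV h)) := RM_isEf (HD_rm hh)

noncomputable def mRetV (m A a : V) : V :=
  appTV A (App (fstV m) A) (appAllV (fun α => tfunV α (App (fstV m) α)) (fstV (sndV m)) A) a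

/-- The realizer selects the `ret` field of the nested pair, applies it to a dummy `∅` for the type
argument, and then to the realizer of `a`. -/
theorem mRetV_mem {m A a : V} {d e : D} (hm : RM m d) (hA : IsTy A) (ha : decode A a e) :
    decode (App (fstV m) A) (mRetV m A a) (d₁ (d₂ d) ⬝ ∅ ⬝ e) := by
  have hf := RM_isEf hm
  have h : decode (allV TY fun α => tfunV α (App (fstV m) α)) (fstV (sndV m)) (d₁ (d₂ d)) :=
    hm.2.2.2.1
  have h' := appAllV_mem (e := ∅) (fun α _ => isTy_tfunV α (App (fstV m) α)) h hA
  exact appTV_mem (hf.app hA) h' ha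

/-! ### Computations -/

/-- `h .0 A` for a handler `h`. -/
noncomputable def hc (h A : V) : V := App (fstV (fstV h)) A

/-- Computations, in continuation-passing style over all handlers. -/
noncomputable def CO (H A : V) : Cls :=
  PI (HD H) fun h => PI TY fun B => PI (FN A (hc h B)) fun _ => decode (hc h B)

theorem bdd_CO (H A : V) : Bdd (CO H A) :=
  bdd_PI (bdd_HD H) fun _ _ _ => bdd_PI bdd_TY fun _ _ _ => bdd_PI (bdd_FN _ _) fun _ _ _ =>
    bdd_decode _

/-- The final codomain is an object type and hence modest; no modesty is required of the class of
handlers. This gives computations an isomorphic object type, namely thunks. -/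
theorem mod_CO (H A : V) : Mod (CO H A) :=
  mod_PI fun _ _ hh => mod_PI fun _ _ hB => mod_PI fun _ _ _ => ((HD_isEf hh).app hB).mod

noncomputable def coV (H A : V) : V := encode (CO H A)
noncomputable def thV (H A : V) : V := mo (CO H A)

@[simp] theorem decode_coV (H A : V) : decode (coV H A) = CO H A := decode_encode (bdd_CO H A)
@[simp] theorem isTy_thV (H A : V) : IsTy (thV H A) := isTy_mo _

/-- The computation that sends a handler `h`, a result type `B` and a continuation `k` to
`g h B k`. -/
noncomputable def coLam (H A : V) (g : V → V → V → V) : V :=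
  Lam (HD H) fun h => Lam TY fun B => Lam (FN A (hc h B)) fun k => g h B k

noncomputable def run (m h B k : V) : V := App (App (App m h) B) k

/-- Graphs can be evaluated only at realized arguments. Hence the equational lemmas below keep
supplying some realizer of the continuation, whatever it may be. -/
theorem run_coLam {H A h B k : V} {g : V → V → V → V} {d e : D} (hh : HD H h d) (hB : IsTy B)
    (hk : FN A (hc h B) k e) : run (coLam H A g) h B k = g h B k := by
  rw [run, coLam, App_Lam (bdd_HD H) hh, App_Lam bdd_TY (r := ∅) hB, App_Lam (bdd_FN _ _) hk]

theorem coLam_congr {H A : V} {g g' : V → V → V → V}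
    (e : ∀ h d B k s, HD H h d → IsTy B → FN A (hc h B) k s → g h B k = g' h B k) :
    coLam H A g = coLam H A g' :=
  Lam_congr fun h d hh => Lam_congr fun B _ hB => Lam_congr fun k s hk => e h d B k s hh hB hk

theorem coLam_mem {H A : V} {g : V → V → V → V} {d : D}
    (hg : ∀ h d' B k s, HD H h d' → IsTy B → FN A (hc h B) k s → ∀ b,
      decode (hc h B) (g h B k) (d ⬝ d' ⬝ b ⬝ s)) : CO H A (coLam H A g) d :=
  PI_Lam (bdd_HD H) fun h d' hh => PI_Lam bdd_TY fun B b hB => PI_Lam (bdd_FN _ _) fun k s hk =>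
    hg h d' B k s hh hB hk b

/-- The η-law in all three arguments. It reduces equations between computations to equations between
their runs. -/
theorem coLam_run {H A m : V} {d : D} (hm : CO H A m d) : coLam H A (run m) = m := by
  rw [hm.1]
  refine Lam_congr fun h d' hh => ?_
  have h₁ := hm.2 h d' hh
  rw [← hm.1, h₁.1]
  refine Lam_congr fun B b hB => ?_
  exact (h₁.2 B b hB).1.symm

theorem run_mem {H A m h B k : V} {d d' s b : D} (hm : CO H A m d) (hh : HD H h d') (hB : IsTy B)
    (hk : FN A (hc h B) k s) : decode (hc h B) (run m h B k) (d ⬝ d' ⬝ b ⬝ s) :=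
  ((hm.2 h d' hh).2 B b hB).2 k s hk

noncomputable def valV (H A a : V) : V := coLam H A fun _ _ k => App k a

/-- The continuation that runs `k a` with the continuation `r`. -/
noncomputable def contV (A k h C r : V) : V := Lam (decode A) fun a => run (App k a) h C r

/-- Sequencing passes to `m` the continuation that first runs `k`. The `bind` of the handler is not
used. -/
noncomputable def letV (H A B m k : V) : V :=
  coLam H B fun h C r => run m h C (contV A k h C r)

noncomputable def retK (h A : V) : V := Lam (decode A) (mRetV (fstV h) A)

/-- The result type of the run is `A` itself, with `ret` of the handler as the final continuation.
-/
noncomputable def hdlV (A h c : V) : V := run c h A (retK h A)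

end Realiz

namespace Realiz

open Graph LccLF LccLF.Tm

/-! ## Computation rules for the interpretation -/

section

variable {K : Type} (κ : K → V) (ρ : ℕ → V)

@[simp] theorem val_var (i : ℕ) : val κ (.var i) ρ = ρ i := (rfl)
@[simp] theorem val_con (c : K) : val κ (con c) ρ = κ c := (rfl)
@[simp] theorem val_lam (A t : Tm K) :
    val κ (lam A t) ρ = Lam (cls κ A ρ) fun x => val κ t (x ∷ₛ ρ) := (rfl)
@[simp] theorem val_app (f a : Tm K) : val κ (app f a) ρ = App (val κ f ρ) (val κ a ρ) := (rfl)
@[simp] theorem val_fst (p : Tm K) : val κ (fst p) ρ = fstV (val κ p ρ) := (rfl)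
@[simp] theorem val_snd (p : Tm K) : val κ (snd p) ρ = sndV (val κ p ρ) := (rfl)
@[simp] theorem val_pair (a b : Tm K) :
    val κ (pair a b) ρ = ZFSet.pair (val κ a ρ) (val κ b ρ) := (rfl)
@[simp] theorem cls_pi (A B : Tm K) :
    cls κ (pi A B) ρ = PI (cls κ A ρ) fun x => cls κ B (x ∷ₛ ρ) := (rfl)
@[simp] theorem cls_sigma (A B : Tm K) :
    cls κ (sigma A B) ρ = SG (cls κ A ρ) fun x => cls κ B (x ∷ₛ ρ) := (rfl)

theorem val_rename (r : ℕ → ℕ) (t : Tm K) :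
    val κ (rename r t) ρ = val κ t fun i => ρ (r i) := congrArg Prod.fst (interp_rename ..)
theorem cls_rename (r : ℕ → ℕ) (t : Tm K) :
    cls κ (rename r t) ρ = cls κ t fun i => ρ (r i) := congrArg Prod.snd (interp_rename ..)

@[simp] theorem val_wk_one (t : Tm K) (x : V) : val κ (wk 1 t) (x ∷ₛ ρ) = val κ t ρ :=
  val_rename ..
@[simp] theorem val_wk_two (t : Tm K) (x y : V) : val κ (wk 2 t) (x ∷ₛ y ∷ₛ ρ) = val κ t ρ :=
  val_rename ..
@[simp] theorem val_wk_three (t : Tm K) (x y z : V) :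
    val κ (wk 3 t) (x ∷ₛ y ∷ₛ z ∷ₛ ρ) = val κ t ρ := val_rename ..
@[simp] theorem val_wk_four (t : Tm K) (x y z w : V) :
    val κ (wk 4 t) (x ∷ₛ y ∷ₛ z ∷ₛ w ∷ₛ ρ) = val κ t ρ := val_rename ..
@[simp] theorem val_wk_five (t : Tm K) (x y z w u : V) :
    val κ (wk 5 t) (x ∷ₛ y ∷ₛ z ∷ₛ w ∷ₛ u ∷ₛ ρ) = val κ t ρ := val_rename ..
@[simp] theorem cls_wk_one (t : Tm K) (x : V) : cls κ (wk 1 t) (x ∷ₛ ρ) = cls κ t ρ :=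
  cls_rename ..
@[simp] theorem cls_wk_two (t : Tm K) (x y : V) : cls κ (wk 2 t) (x ∷ₛ y ∷ₛ ρ) = cls κ t ρ :=
  cls_rename ..
@[simp] theorem cls_wk_three (t : Tm K) (x y z : V) :
    cls κ (wk 3 t) (x ∷ₛ y ∷ₛ z ∷ₛ ρ) = cls κ t ρ := cls_rename ..

@[simp] theorem cls_arrow (A B : Tm K) :
    cls κ (arrow A B) ρ = PI (cls κ A ρ) fun _ => cls κ B ρ := by simp [arrow]
@[simp] theorem cls_prod (A B : Tm K) :
    cls κ (prod A B) ρ = SG (cls κ A ρ) fun _ => cls κ B ρ := by simp [prod]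

/-- Proofs of equations between elements that are not type formers. -/
theorem eq_var_mem {A f a : Tm K} {i : ℕ} {r : D} (h : val κ (app f a) ρ = ρ i)
    (hr : cls κ A ρ (val κ (app f a) ρ) r) : cls κ (eq A (app f a) (.var i)) ρ ∅ r :=
  ⟨rfl, h, hr, rfl, rfl⟩

end

/-! ### Isomorphism records -/

/-- Both maps preserve realizers, so the identity tracks them. The identity also realizes the two
inverse laws, because a proof of an equation carries a realizer of its left-hand side and that side
equals the argument. -/
theorem iso_mem {κ : Fha.Name → V} {ρ : ℕ → V} {A B : Fha.T} {C C' : Cls} {f g : V → V}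
    (hA : cls κ A ρ = C) (hB : cls κ B ρ = C') (bC : Bdd C) (bC' : Bdd C')
    (hf : ∀ x r, C x r → C' (f x) r) (hg : ∀ y r, C' y r → C (g y) r)
    (hgf : ∀ x r, C x r → g (f x) = x) (hfg : ∀ y r, C' y r → f (g y) = y) :
    cls κ (Fha.iso A B) ρ (isoV C C' f g) isoR := by
  simp only [Fha.iso, cls_sigma, cls_arrow, cls_prod, cls_wk_one, cls_wk_two, cls_pi, hA, hB]
  refine SG_pair (PI_Lam bC fun x r hx => by simpa using hf x r hx)
    (SG_pair (PI_Lam bC' fun x r hx => by simpa using hg x r hx)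
      (SG_pair (PI_Lam bC fun x r hx => ?_) (PI_Lam bC' fun x r hx => ?_)))
  · have e : App (Lam C' g) (App (Lam C f) x) = x := by
      rw [App_Lam bC hx, App_Lam bC' (hf x r hx), hgf x r hx]
    exact eq_var_mem _ _ (i := 0) e (by simpa [e, hA] using hx)
  · have e : App (Lam C f) (App (Lam C' g) x) = x := by
      rw [App_Lam bC' hx, App_Lam bC (hg x r hx), hfg x r hx]
    exact eq_var_mem _ _ (i := 0) e (by simpa [e, hB] using hx)

theorem moIso_mem {κ : Fha.Name → V} {ρ : ℕ → V} {A B : Fha.T} {C : Cls}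
    (hA : cls κ A ρ = decode (mo C)) (hB : cls κ B ρ = C) (bC : Bdd C) (hC : Mod C) :
    cls κ (Fha.iso A B) ρ (moIso C) isoR :=
  iso_mem hA hB (bdd_decode _) bC (fun _ _ => rep_mem hC) (fun _ _ => quo_mem hC)
    (fun _ _ => quo_rep hC) (fun _ _ => rep_quo hC)

theorem fst_isoV_app {C C' : Cls} {f g : V → V} (bC : Bdd C) {x : V} {r : D} (hx : C x r) :
    App (fstV (isoV C C' f g)) x = f x := by simp [isoV, App_Lam bC hx]

theorem snd_isoV_app {C C' : Cls} {f g : V → V} (bC' : Bdd C') {x : V} {r : D} (hx : C' x r) :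
    App (fstV (sndV (isoV C C' f g))) x = g x := by simp [isoV, App_Lam bC' hx]

theorem moIso_fwd {C : Cls} {x : V} {r : D} (hx : decode (mo C) x r) :
    App (fstV (moIso C)) x = rep C x := fst_isoV_app (bdd_decode _) hx

theorem moIso_bwd {C : Cls} (bC : Bdd C) {x : V} {r : D} (hx : C x r) :
    App (fstV (sndV (moIso C))) x = quo C x := snd_isoV_app bC hx

/-! ## Interpretation of the declared names -/

/-- Booleans: every realizer realizes its own element. -/
noncomputable def BL : Cls := fun x r => x = inj r

theorem mod_BL : Mod BL := fun _ _ _ h h' => h.trans h'.symm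

/-- Continuations. -/
def KC (H A B : V) : Cls := PI (decode A) fun _ => CO H B

theorem bdd_KC (H A B : V) : Bdd (KC H A B) := bdd_PI (bdd_decode A) fun _ _ _ => bdd_CO H B

/-- Predicates on the elements of a kind. -/
noncomputable def FAM (k : V) : Cls := PI (EL k) fun _ => TY

theorem bdd_FAM (k : V) : Bdd (FAM k) := bdd_PI (bdd_EL k) fun _ _ _ => bdd_TY

noncomputable def thF (H : V) : V := Lam TY (thV H)
noncomputable def opTyV (H A : V) : V := App (App (fstV H) (thF H)) A

theorem isEf_thF (H : V) : IsEf (thF H) := isEf_Lam fun _ _ => isTy_thV _ _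

/-- The interpretation of the declared names; `o` interprets `op`. -/
noncomputable def kap (o : V) : Fha.Name → V
  | .ki => encode KI
  | .el => Lam KI fun k => encode (EL k)
  | .ty => tyV
  | .kfun => Lam KI fun k => Lam KI fun l => kfunV k l
  | .unit => mo UN
  | .bool => mo BL
  | .tfun => Lam TY fun A => Lam TY fun B => tfunV A B
  | .all => Lam KI fun k => Lam (FAM k) fun F => allV (EL k) (App F)
  | .kfunIso => Lam KI fun k => Lam KI fun l =>
      isoV (EL (kfunV k l)) (EL (kfunV k l)) (fun f => f) fun f => f
  | .tm => Lam TY fun A => A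
  | .unitIso => moIso UN
  | .tfunIso => Lam TY fun A => Lam TY fun B => moIso (FN A B)
  | .allIso => Lam KI fun k => Lam (FAM k) fun F => moIso (ALL (EL k) (App F))
  | .tt => quo BL (inj (∅ : D))
  | .ff => quo BL (inj (Set.univ : D))
  | .co => Lam RH fun H => Lam TY fun A => coV H A
  | .val => Lam RH fun H => Lam TY fun A => Lam (decode A) fun a => valV H A a
  | .letIn => Lam RH fun H => Lam TY fun A => Lam TY fun B => Lam (CO H A) fun m =>
      Lam (KC H A B) fun k => letV H A B m k
  | .valLet => Lam RH fun H => Lam TY fun A => Lam TY fun B => Lam (decode A) fun _ =>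
      Lam (KC H A B) fun _ => ∅
  | .letVal => Lam RH fun H => Lam TY fun A => Lam (CO H A) fun _ => ∅
  | .letAssoc => Lam RH fun H => Lam TY fun A => Lam TY fun B => Lam TY fun C =>
      Lam (CO H A) fun _ => Lam (KC H A B) fun _ => Lam (KC H B C) fun _ => ∅
  | .th => Lam RH fun H => Lam TY fun A => thV H A
  | .thIso => Lam RH fun H => Lam TY fun A => moIso (CO H A)
  | .op => o
  | .letOp => Lam RH fun H => Lam TY fun A => Lam TY fun B => Lam TY fun C =>
      Lam (decode (opTyV H A)) fun _ => Lam (KC H A B) fun _ => Lam (KC H B C) fun _ => ∅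
  | .hdl => Lam RH fun H => Lam TY fun A => Lam (HD H) fun h => Lam (CO H A) fun c => hdlV A h c
  | .hdlVal => Lam RH fun H => Lam TY fun A => Lam (HD H) fun _ => Lam (decode A) fun _ => ∅
  | .hdlOp => Lam RH fun H => Lam TY fun A => Lam TY fun B => Lam (HD H) fun _ =>
      Lam (decode (opTyV H A)) fun _ => Lam (KC H A B) fun _ => ∅

section

open Fha

variable {o : V} {ρ : ℕ → V}

@[simp] theorem cls_ki : cls (kap o) ki ρ = KI := decode_encode bdd_KI

theorem cls_el {k : T} (hk : IsKi (val (kap o) k ρ)) :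
    cls (kap o) (el k) ρ = EL (val (kap o) k ρ) := by
  change decode (App (Lam KI fun k => encode (EL k)) (val (kap o) k ρ)) = _
  rw [App_Lam bdd_KI (r := ∅) hk, decode_encode (bdd_EL _)]

@[simp] theorem val_ty : val (kap o) ty ρ = tyV := rfl

theorem val_kfun {k l : T} (hk : IsKi (val (kap o) k ρ)) (hl : IsKi (val (kap o) l ρ)) :
    val (kap o) (kfun k l) ρ = kfunV (val (kap o) k ρ) (val (kap o) l ρ) := by
  change App (App (Lam KI fun k => Lam KI fun l => kfunV k l) (val (kap o) k ρ)) (val (kap o) l ρ) = _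
  rw [App_Lam bdd_KI (r := ∅) hk, App_Lam bdd_KI (r := ∅) hl]

@[simp] theorem val_efty : val (kap o) efty ρ = kfunV tyV tyV := val_kfun isKi_tyV isKi_tyV
@[simp] theorem val_htyco : val (kap o) htyco ρ = kfunV (kfunV tyV tyV) (kfunV tyV tyV) := by
  rw [htyco, val_kfun] <;> simp

@[simp] theorem cls_el_ty : cls (kap o) (el ty) ρ = TY := by rw [cls_el] <;> simp
@[simp] theorem cls_el_efty : cls (kap o) (el efty) ρ = EF := by rw [cls_el] <;> simp
@[simp] theorem cls_el_htyco : cls (kap o) (el htyco) ρ = HT := by rw [cls_el] <;> simp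

theorem val_tfun {A B : T} (hA : IsTy (val (kap o) A ρ)) (hB : IsTy (val (kap o) B ρ)) :
    val (kap o) (tfun A B) ρ = tfunV (val (kap o) A ρ) (val (kap o) B ρ) := by
  change App (App (Lam TY fun A => Lam TY fun B => tfunV A B) (val (kap o) A ρ)) (val (kap o) B ρ) = _
  rw [App_Lam bdd_TY (r := ∅) hA, App_Lam bdd_TY (r := ∅) hB]

theorem cls_tm {A : T} (hA : IsTy (val (kap o) A ρ)) :
    cls (kap o) (tm A) ρ = decode (val (kap o) A ρ) := by
  change decode (App (Lam TY fun A => A) (val (kap o) A ρ)) = _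
  rw [App_Lam bdd_TY (r := ∅) hA]

theorem val_all {k F : T} {r : D} (hk : IsKi (val (kap o) k ρ))
    (hF : FAM (val (kap o) k ρ) (val (kap o) F ρ) r) :
    val (kap o) (all k F) ρ = allV (EL (val (kap o) k ρ)) (App (val (kap o) F ρ)) := by
  change App (App (Lam KI fun k => Lam (FAM k) fun F => allV (EL k) (App F)) (val (kap o) k ρ))
    (val (kap o) F ρ) = _
  rw [App_Lam bdd_KI (r := ∅) hk, App_Lam (bdd_FAM _) hF]

/-- The body of a polymorphic type denotes the family `g`. -/
def Fam (o : V) (ρ : ℕ → V) (t : T) (g : V → V) : Prop :=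
  ∀ α, IsTy α → val (kap o) t (α ∷ₛ ρ) = g α ∧ IsTy (g α)

theorem Fam.val_eq {t : T} {g : V → V} (h : Fam o ρ t g) :
    val (kap o) (lam (el ty) t) ρ = Lam TY g := by
  simpa using Lam_congr (C := TY) fun α _ hα => (h α hα).1

theorem FAM_Lam {g : V → V} (h : ∀ α, IsTy α → IsTy (g α)) (r : D) : FAM tyV (Lam TY g) r := by
  rw [FAM, EL_tyV]
  exact PI_Lam bdd_TY fun α _ hα => h α hα

theorem Fam.val_all {t : T} {g : V → V} (h : Fam o ρ t g) :
    val (kap o) (all ty (lam (el ty) t)) ρ = allV TY g := by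
  rw [Realiz.val_all (k := ty) (r := ∅) isKi_tyV (by
    rw [h.val_eq]; exact FAM_Lam (fun α hα => (h α hα).2) _), h.val_eq]
  simpa using allV_congr (C := TY) fun α r hα => App_Lam bdd_TY (r := r) hα

/-- The isomorphism for `kfun` acts as the identity, so application at function kinds becomes plain
set-theoretic application. -/
theorem val_appK {k l f a : T} {r : D} (hk : IsKi (val (kap o) k ρ))
    (hl : IsKi (val (kap o) l ρ))
    (hf : EL (kfunV (val (kap o) k ρ) (val (kap o) l ρ)) (val (kap o) f ρ) r) :
    val (kap o) (appK k l f a) ρ = App (val (kap o) f ρ) (val (kap o) a ρ) := by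
  change App (App (fstV (App (App (Lam KI fun k => Lam KI fun l =>
      isoV (EL (kfunV k l)) (EL (kfunV k l)) (fun f => f) fun f => f) (val (kap o) k ρ))
      (val (kap o) l ρ))) (val (kap o) f ρ)) (val (kap o) a ρ) = _
  rw [App_Lam bdd_KI (r := ∅) hk, App_Lam bdd_KI (r := ∅) hl, fst_isoV_app (bdd_EL _) hf]

theorem val_efApp {F A : T} (hF : IsEf (val (kap o) F ρ)) :
    val (kap o) (efApp F A) ρ = App (val (kap o) F ρ) (val (kap o) A ρ) :=
  val_appK (r := ∅) isKi_tyV isKi_tyV (by simpa using hF)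

theorem val_hApp {H F : T} (hH : IsHt (val (kap o) H ρ)) :
    val (kap o) (hApp H F) ρ = App (val (kap o) H ρ) (val (kap o) F ρ) :=
  val_appK (r := ∅) (by simp) (by simp) (by simpa using hH)

theorem val_absK_ty {t : T} {g : V → V} (h : Fam o ρ t g) :
    val (kap o) (absK ty ty t) ρ = Lam TY g := by
  have h' : EL (kfunV tyV tyV) (Lam TY g) ∅ := by
    simpa using isEf_Lam fun α hα => (h α hα).2
  change App (fstV (sndV (App (App (Lam KI fun k => Lam KI fun l =>
      isoV (EL (kfunV k l)) (EL (kfunV k l)) (fun f => f) fun f => f) tyV) tyV)))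
      (val (kap o) (lam (el ty) t) ρ) = _
  rw [App_Lam bdd_KI (r := ∅) isKi_tyV, App_Lam bdd_KI (r := ∅) isKi_tyV, h.val_eq,
    snd_isoV_app (bdd_EL _) h']

/-! ### The types of the derived notions -/

theorem fmapFam₂_fam {F A : T} {F' A' : V} (eF : val (kap o) F ρ = F')
    (eA : val (kap o) A ρ = A') (hF : IsEf F') (hA : IsTy A') :
    Fam o ρ (tfun (tfun (wk 1 A) (v 0)) (tfun (efApp (wk 1 F) (wk 1 A)) (efApp (wk 1 F) (v 0))))
      fun β => tfunV (tfunV A' β) (tfunV (App F' A') (App F' β)) :=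
  fun β hβ => ⟨by simp (maxDischargeDepth := 8) [val_tfun, val_efApp, eF, eA, hF, hA, hβ, hF.app],
    by simp⟩

theorem fmapFam₁_fam {F : T} {F' : V} (eF : val (kap o) F ρ = F') (hF : IsEf F') :
    Fam o ρ (all ty (fmapFam₂ (wk 1 F) (v 0))) fun α => allV TY fun β =>
      tfunV (tfunV α β) (tfunV (App F' α) (App F' β)) :=
  fun _ hα => ⟨(fmapFam₂_fam (by simp [eF]) (by simp) hF hα).val_all, by simp⟩

theorem val_fmapTy {F : T} (hF : IsEf (val (kap o) F ρ)) :
    val (kap o) (fmapTy F) ρ = fmapTyV (val (kap o) F ρ) := (fmapFam₁_fam rfl hF).val_all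

theorem retFam_fam {M : T} {M' : V} (eM : val (kap o) M ρ = M') (hM : IsEf M') :
    Fam o ρ (tfun (v 0) (efApp (wk 1 M) (v 0))) fun α => tfunV α (App M' α) :=
  fun α hα => ⟨by simp (maxDischargeDepth := 8) [val_tfun, val_efApp, eM, hM, hα, hM.app], by simp⟩

theorem val_retTy {M : T} (hM : IsEf (val (kap o) M ρ)) :
    val (kap o) (retTy M) ρ = retTyV (val (kap o) M ρ) := (retFam_fam rfl hM).val_all

theorem bindFam₂_fam {M A : T} {M' A' : V} (eM : val (kap o) M ρ = M')
    (eA : val (kap o) A ρ = A') (hM : IsEf M') (hA : IsTy A') :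
    Fam o ρ (tfun (efApp (wk 1 M) (wk 1 A))
      (tfun (tfun (wk 1 A) (efApp (wk 1 M) (v 0))) (efApp (wk 1 M) (v 0))))
      fun β => tfunV (App M' A') (tfunV (tfunV A' (App M' β)) (App M' β)) :=
  fun β hβ => ⟨by simp (maxDischargeDepth := 8) [val_tfun, val_efApp, eM, eA, hM, hA, hβ, hM.app],
    by simp⟩

theorem bindFam₁_fam {M : T} {M' : V} (eM : val (kap o) M ρ = M') (hM : IsEf M') :
    Fam o ρ (all ty (bindFam₂ (wk 1 M) (v 0))) fun α => allV TY fun β =>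
      tfunV (App M' α) (tfunV (tfunV α (App M' β)) (App M' β)) :=
  fun _ hα => ⟨(bindFam₂_fam (by simp [eM]) (by simp) hM hα).val_all, by simp⟩

theorem val_bindTy {M : T} (hM : IsEf (val (kap o) M ρ)) :
    val (kap o) (bindTy M) ρ = bindTyV (val (kap o) M ρ) := (bindFam₁_fam rfl hM).val_all

theorem transFam_fam {F G : T} {F' G' : V} (eF : val (kap o) F ρ = F')
    (eG : val (kap o) G ρ = G') (hF : IsEf F') (hG : IsEf G') :
    Fam o ρ (tfun (efApp (wk 1 F) (v 0)) (efApp (wk 1 G) (v 0)))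
      fun α => tfunV (App F' α) (App G' α) :=
  fun α hα => ⟨by simp (maxDischargeDepth := 8) [val_tfun, val_efApp, eF, eG, hF, hG, hα, hF.app,
    hG.app], by simp⟩

theorem val_trans {F G : T} (hF : IsEf (val (kap o) F ρ)) (hG : IsEf (val (kap o) G ρ)) :
    val (kap o) (trans F G) ρ = transV (val (kap o) F ρ) (val (kap o) G ρ) :=
  (transFam_fam rfl rfl hF hG).val_all

@[simp] theorem isTy_fmapTyV (F : V) : IsTy (fmapTyV F) := isTy_mo _
@[simp] theorem isTy_retTyV (F : V) : IsTy (retTyV F) := isTy_mo _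
@[simp] theorem isTy_bindTyV (F : V) : IsTy (bindTyV F) := isTy_mo _
@[simp] theorem isTy_transV (F G : V) : IsTy (transV F G) := isTy_mo _

@[simp] theorem cls_RawFunctor : cls (kap o) RawFunctor ρ = RF := by
  rw [RawFunctor, cls_sigma]
  refine SG_congr (by simp) fun F r hF => ?_
  replace hF : IsEf F := by simpa using hF
  rw [cls_tm] <;> simp [val_fmapTy, hF]

@[simp] theorem cls_RawMonad : cls (kap o) RawMonad ρ = RM := by
  rw [RawMonad, cls_sigma]
  refine SG_congr (by simp) fun F r hF => ?_
  replace hF : IsEf F := by simpa using hF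
  rw [cls_prod, cls_tm, cls_tm] <;> simp [val_retTy, val_bindTy, hF]

@[simp] theorem cls_RawHFunctor : cls (kap o) RawHFunctor ρ = RH := by
  rw [RawHFunctor, cls_sigma]
  refine SG_congr (by simp) fun H r hH => ?_
  replace hH : IsHt H := by simpa using hH
  rw [cls_prod]
  congr 1
  · rw [cls_pi]
    refine PI_congr (by simp) fun F r hF => ?_
    replace hF : RF F r := by simpa using hF
    rw [cls_tm] <;> simp [val_fmapTy, val_hApp, hH, hH.app (RF_isEf hF)]
  · funext _
    rw [cls_pi]
    refine PI_congr (by simp) fun F r hF => ?_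
    replace hF : RF F r := by simpa using hF
    rw [cls_pi]
    refine PI_congr (by simp) fun G r hG => ?_
    replace hG : RF G r := by simpa using hG
    rw [cls_arrow, cls_tm, cls_tm] <;>
      simp [val_trans, val_hApp, hH, hH.app (RF_isEf hF), hH.app (RF_isEf hG), RF_isEf hF,
        RF_isEf hG]

theorem cls_Handler {H : T} (hH : IsHt (fstV (val (kap o) H ρ))) :
    cls (kap o) (Handler H) ρ = HD (val (kap o) H ρ) := by
  rw [Handler, cls_sigma]
  refine SG_congr (by simp) fun M r hM => ?_
  replace hM : RM M r := by simpa using hM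
  rw [cls_tm] <;> simp [val_trans, val_hApp, hH, hH.app (RM_isEf hM), RM_isEf hM]

end

end Realiz

namespace Realiz

open Graph LccLF LccLF.Tm

/-! ## Laws of computations -/

/-- First projection. -/
def Lm.p₁ (t : Lm) : Lm := .app t (.cst dtrue)
/-- Second projection. -/
def Lm.p₂ (t : Lm) : Lm := .app t (.cst dfalse)

@[simp] theorem ev_p₁ (t : Lm) (γ : ℕ → D) : ev (Lm.p₁ t) γ = d₁ (ev t γ) := (rfl)
@[simp] theorem ev_p₂ (t : Lm) (γ : ℕ → D) : ev (Lm.p₂ t) γ = d₂ (ev t γ) := (rfl)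

/-- Realizer of `val`. -/
def valR : D := cl (.lam (.lam (.lam (.lam (.app (.var 0) (.var 3))))))

/-- Realizer of `let`. -/
def letR : D := cl (.lam (.lam (.lam (.lam (.lam (.app (.app (.app (.var 4) (.var 2)) (.var 1))
  (.lam (.app (.app (.app (.app (.var 4) (.var 0)) (.var 3)) (.var 2)) (.var 1)))))))))

/-- Realizer of `hdl`. -/
def hdlR : D := cl (.lam (.lam (.app (.app (.app (.var 0) (.var 1)) (.cst ∅))
  (.lam (.app (.app (Lm.p₁ (Lm.p₂ (Lm.p₁ (.var 2)))) (.cst ∅)) (.var 0))))))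

theorem valV_mem {H A a : V} {d : D} (ha : decode A a d) : CO H A (valV H A a) (valR ⬝ d) :=
  coLam_mem fun h d' B k s hh hB hk b => by simpa [valR] using hk.2 a d ha

/-- The realizer `b` of the result type is existential because any realizer of a type is acceptable;
callers use the one at hand or `∅`. -/
theorem contV_mem {H A B k h C r : V} {d e s t : D} (hk : KC H A B k d) (hh : HD H h e)
    (hC : IsTy C) (hr : FN B (hc h C) r s) (ht : ∀ a, ∃ b, t ⬝ a = d ⬝ a ⬝ e ⬝ b ⬝ s) :
    FN A (hc h C) (contV A k h C r) t :=
  PI_Lam (bdd_decode A) fun a q ha => by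
    obtain ⟨b, e⟩ := ht q
    rw [e]
    exact run_mem (hk.2 a q ha) hh hC hr

theorem exists_contV_mem {H A B k h C r : V} {d e s : D} (hk : KC H A B k d) (hh : HD H h e)
    (hC : IsTy C) (hr : FN B (hc h C) r s) : ∃ t, FN A (hc h C) (contV A k h C r) t :=
  ⟨cl (.lam (.app (.app (.app (.app (.cst d) (.var 0)) (.cst e)) (.cst ∅)) (.cst s))),
    contV_mem hk hh hC hr fun _ => ⟨∅, by simp⟩⟩

theorem letV_mem {H A B m k : V} {d e : D} (hm : CO H A m d) (hk : KC H A B k e) :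
    CO H B (letV H A B m k) (letR ⬝ d ⬝ e) :=
  coLam_mem fun h d' C r s hh hC hr b => by
    have := run_mem (b := b) hm hh hC (contV_mem hk hh hC hr
      (t := ev (.lam (.app (.app (.app (.app (.var 4)
        (.var 0)) (.var 3)) (.var 2)) (.var 1))) (s ∷ₛ b ∷ₛ d' ∷ₛ e ∷ₛ d ∷ₛ fun _ => ∅))
      fun _ => ⟨b, by simp⟩)
    simpa [letR] using this

/-- Running a value applies the composed continuation to it, which runs `k a`; η removes the outer
abstraction. -/
theorem letV_val {H A B a k : V} {d e : D} (ha : decode A a d) (hk : KC H A B k e) :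
    letV H A B (valV H A a) k = App k a := by
  rw [← coLam_run (hk.2 a d ha)]
  refine coLam_congr fun h d' C r s hh hC hr => ?_
  obtain ⟨t, ht⟩ := exists_contV_mem hk hh hC hr
  rw [valV, run_coLam hh hC ht, contV, App_Lam (bdd_decode A) ha]

theorem letV_ret {H A m : V} {d : D} (hm : CO H A m d) :
    letV H A A m (Lam (decode A) (valV H A)) = m := by
  refine Eq.trans ?_ (coLam_run hm)
  refine coLam_congr fun h d' C r s hh hC hr => ?_
  -- Composing with `val` leaves a continuation unchanged, by β for `run` and η for `r`.
  have : contV A (Lam (decode A) (valV H A)) h C r = r := by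
    rw [hr.1]
    refine Lam_congr fun a q ha => ?_
    rw [← hr.1, App_Lam (bdd_decode A) ha, valV, run_coLam hh hC hr]
  rw [this]

theorem contV_Lam {A h C r : V} {g : V → V} :
    contV A (Lam (decode A) g) h C r = Lam (decode A) fun a => run (g a) h C r :=
  Lam_congr fun a q ha => by rw [App_Lam (bdd_decode A) ha]

/-- Continuing with `let (k a) k'` and then `r` is the same as continuing with `k`, then `k'`, then
`r`. This is the common core of associativity and of the commutation of `let` with `op`. -/
theorem contV_let {H A B C h E r k k' : V} {e s : D} (hh : HD H h e)
    (hE : IsTy E) (hr : FN C (hc h E) r s) :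
    contV A (Lam (decode A) fun a => letV H B C (App k a) k') h E r =
      contV A k h E (contV B k' h E r) := by
  rw [contV_Lam]
  refine Lam_congr fun a q ha => ?_
  rw [letV, run_coLam hh hE hr]

theorem letV_assoc {H A B C m k k' : V} {d : D} (hk' : KC H B C k' d) :
    letV H B C (letV H A B m k) k' =
      letV H A C m (Lam (decode A) fun a => letV H B C (App k a) k') := by
  refine coLam_congr fun h d' E r s hh hE hr => ?_
  obtain ⟨t, ht⟩ := exists_contV_mem hk' hh hE hr
  rw [letV, run_coLam hh hE ht, contV_let hh hE hr]

theorem retK_mem {H A h : V} {e t : D} (hh : HD H h e) (hA : IsTy A)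
    (ht : ∀ a, t ⬝ a = d₁ (d₂ (d₁ e)) ⬝ ∅ ⬝ a) : FN A (hc h A) (retK h A) t :=
  PI_Lam (bdd_decode A) fun _ q ha => ht q ▸ mRetV_mem (HD_rm hh) hA ha

theorem exists_retK_mem {H A h : V} {e : D} (hh : HD H h e) (hA : IsTy A) :
    ∃ t, FN A (hc h A) (retK h A) t :=
  ⟨d₁ (d₂ (d₁ e)) ⬝ ∅, retK_mem hh hA fun _ => rfl⟩

theorem hdlV_mem {H A h c : V} {d e : D} (hA : IsTy A) (hh : HD H h e) (hc' : CO H A c d) :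
    decode (hc h A) (hdlV A h c) (hdlR ⬝ e ⬝ d) := by
  have := run_mem (b := ∅) hc' hh hA (retK_mem (t := ev (.lam (.app (.app (Lm.p₁ (Lm.p₂
    (Lm.p₁ (.var 2)))) (.cst ∅)) (.var 0))) (d ∷ₛ e ∷ₛ fun _ => ∅)) hh hA fun _ => by simp)
  simpa [hdlR, hdlV] using this

/-- A value applies its continuation, and here the continuation is `ret`. -/
theorem hdlV_val {H A h a : V} {d e : D} (hA : IsTy A) (hh : HD H h e) (ha : decode A a d) :
    hdlV A h (valV H A a) = mRetV (fstV h) A a := by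
  obtain ⟨t, ht⟩ := exists_retK_mem hh hA
  rw [hdlV, valV, run_coLam hh hA ht, retK, App_Lam (bdd_decode A) ha]

/-! ## Interpretation of computations -/

section

open Fha

variable {o : V} {ρ : ℕ → V}

theorem cls_co {H A : T} {r : D} (hH : RH (val (kap o) H ρ) r) (hA : IsTy (val (kap o) A ρ)) :
    cls (kap o) (co H A) ρ = CO (val (kap o) H ρ) (val (kap o) A ρ) := by
  change decode (App (App (Lam RH fun H => Lam TY fun A => coV H A) (val (kap o) H ρ))
    (val (kap o) A ρ)) = _
  rw [App_Lam bdd_RH hH, App_Lam bdd_TY (r := ∅) hA, decode_coV]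

theorem val_valFun {H A : T} {r : D} (hH : RH (val (kap o) H ρ) r)
    (hA : IsTy (val (kap o) A ρ)) : val (kap o) (valFun H A) ρ =
      Lam (decode (val (kap o) A ρ)) (valV (val (kap o) H ρ) (val (kap o) A ρ)) := by
  change App (App (Lam RH fun H => Lam TY fun A => Lam (decode A) fun a => valV H A a)
    (val (kap o) H ρ)) (val (kap o) A ρ) = _
  rw [App_Lam bdd_RH hH, App_Lam bdd_TY (r := ∅) hA]

theorem val_val {H A a : T} {r s : D} (hH : RH (val (kap o) H ρ) r)
    (hA : IsTy (val (kap o) A ρ)) (ha : decode (val (kap o) A ρ) (val (kap o) a ρ) s) :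
    val (kap o) (Fha.val H A a) ρ =
      valV (val (kap o) H ρ) (val (kap o) A ρ) (val (kap o) a ρ) := by
  rw [Fha.val, val_app, val_valFun hH hA, App_Lam (bdd_decode _) ha]

theorem val_letIn {H A B m k : T} {r s t : D} (hH : RH (val (kap o) H ρ) r)
    (hA : IsTy (val (kap o) A ρ)) (hB : IsTy (val (kap o) B ρ))
    (hm : CO (val (kap o) H ρ) (val (kap o) A ρ) (val (kap o) m ρ) s)
    (hk : KC (val (kap o) H ρ) (val (kap o) A ρ) (val (kap o) B ρ) (val (kap o) k ρ) t) :
    val (kap o) (letIn H A B m k) ρ = letV (val (kap o) H ρ) (val (kap o) A ρ)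
      (val (kap o) B ρ) (val (kap o) m ρ) (val (kap o) k ρ) := by
  change App (App (App (App (App (kap o .letIn) (val (kap o) H ρ)) (val (kap o) A ρ))
    (val (kap o) B ρ)) (val (kap o) m ρ)) (val (kap o) k ρ) = _
  rw [kap, App_Lam bdd_RH hH, App_Lam bdd_TY (r := ∅) hA, App_Lam bdd_TY (r := ∅) hB,
    App_Lam (bdd_CO _ _) hm, App_Lam (bdd_KC _ _ _) hk]

theorem val_th {H A : T} {r : D} (hH : RH (val (kap o) H ρ) r) (hA : IsTy (val (kap o) A ρ)) :
    val (kap o) (th H A) ρ = thV (val (kap o) H ρ) (val (kap o) A ρ) := by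
  change App (App (Lam RH fun H => Lam TY fun A => thV H A) (val (kap o) H ρ))
    (val (kap o) A ρ) = _
  rw [App_Lam bdd_RH hH, App_Lam bdd_TY (r := ∅) hA]

theorem val_thFun {H : T} {r : D} (hH : RH (val (kap o) H ρ) r) :
    val (kap o) (thFun H) ρ = thF (val (kap o) H ρ) :=
  val_absK_ty fun α hα => ⟨by rw [val_th (r := r)] <;> simp [hH, hα], isTy_thV _ _⟩

theorem App_thF {H A : V} (hA : IsTy A) : App (thF H) A = thV H A := App_Lam bdd_TY (r := ∅) hA

theorem val_opTy {H A : T} {r : D} (hH : RH (val (kap o) H ρ) r) :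
    val (kap o) (opTy H A) ρ = opTyV (val (kap o) H ρ) (val (kap o) A ρ) := by
  have h := RH_isHt hH
  rw [opTy, hfApp, val_efApp, val_hApp, val_thFun hH, val_fst, opTyV]
  · simpa
  · rw [val_hApp, val_thFun hH]
    · exact h.app (isEf_thF _)
    · simpa

theorem isTy_opTyV {H A : V} {r : D} (hH : RH H r) (hA : IsTy A) : IsTy (opTyV H A) :=
  ((RH_isHt hH).app (isEf_thF _)).app hA

theorem val_up {H A t : T} {r s : D} (hH : RH (val (kap o) H ρ) r)
    (hA : IsTy (val (kap o) A ρ))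
    (ht : decode (thV (val (kap o) H ρ) (val (kap o) A ρ)) (val (kap o) t ρ) s) :
    val (kap o) (up H A t) ρ =
      rep (CO (val (kap o) H ρ) (val (kap o) A ρ)) (val (kap o) t ρ) := by
  change App (fstV (App (App (Lam RH fun H => Lam TY fun A => moIso (CO H A))
    (val (kap o) H ρ)) (val (kap o) A ρ))) (val (kap o) t ρ) = _
  rw [App_Lam bdd_RH hH, App_Lam bdd_TY (r := ∅) hA, moIso_fwd ht]

theorem val_down {H A c : T} {r s : D} (hH : RH (val (kap o) H ρ) r)
    (hA : IsTy (val (kap o) A ρ))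
    (hc : CO (val (kap o) H ρ) (val (kap o) A ρ) (val (kap o) c ρ) s) :
    val (kap o) (down H A c) ρ =
      quo (CO (val (kap o) H ρ) (val (kap o) A ρ)) (val (kap o) c ρ) := by
  change App (fstV (sndV (App (App (Lam RH fun H => Lam TY fun A => moIso (CO H A))
    (val (kap o) H ρ)) (val (kap o) A ρ)))) (val (kap o) c ρ) = _
  rw [App_Lam bdd_RH hH, App_Lam bdd_TY (r := ∅) hA, moIso_bwd (bdd_CO _ _) hc]

theorem val_hdl {H A h c : T} {r s t : D} (hH : RH (val (kap o) H ρ) r)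
    (hA : IsTy (val (kap o) A ρ)) (hh : HD (val (kap o) H ρ) (val (kap o) h ρ) s)
    (hc : CO (val (kap o) H ρ) (val (kap o) A ρ) (val (kap o) c ρ) t) :
    val (kap o) (hdl H A h c) ρ =
      hdlV (val (kap o) A ρ) (val (kap o) h ρ) (val (kap o) c ρ) := by
  change App (App (App (App (kap o .hdl) (val (kap o) H ρ)) (val (kap o) A ρ))
    (val (kap o) h ρ)) (val (kap o) c ρ) = _
  rw [kap, App_Lam bdd_RH hH, App_Lam bdd_TY (r := ∅) hA, App_Lam (bdd_HD _) hh,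
    App_Lam (bdd_CO _ _) hc]

theorem val_mApp {m A : T} {r : D} (hm : RM (val (kap o) m ρ) r) :
    val (kap o) (mApp m A) ρ = App (fstV (val (kap o) m ρ)) (val (kap o) A ρ) := by
  rw [mApp, val_efApp] <;> simp [RM_isEf hm]

theorem val_appT {A B f a : T} {r : D} (hA : IsTy (val (kap o) A ρ))
    (hB : IsTy (val (kap o) B ρ))
    (hf : decode (tfunV (val (kap o) A ρ) (val (kap o) B ρ)) (val (kap o) f ρ) r) :
    val (kap o) (appT A B f a) ρ =
      appTV (val (kap o) A ρ) (val (kap o) B ρ) (val (kap o) f ρ) (val (kap o) a ρ) := by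
  change App (App (fstV (App (App (Lam TY fun A => Lam TY fun B => moIso (FN A B))
    (val (kap o) A ρ)) (val (kap o) B ρ))) (val (kap o) f ρ)) (val (kap o) a ρ) = _
  rw [App_Lam bdd_TY (r := ∅) hA, App_Lam bdd_TY (r := ∅) hB, moIso_fwd hf,
    appTV]

theorem val_absT {A B f : T} {r : D} (hA : IsTy (val (kap o) A ρ))
    (hB : IsTy (val (kap o) B ρ))
    (hf : FN (val (kap o) A ρ) (val (kap o) B ρ) (val (kap o) f ρ) r) :
    val (kap o) (absT A B f) ρ =
      quo (FN (val (kap o) A ρ) (val (kap o) B ρ)) (val (kap o) f ρ) := by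
  change App (fstV (sndV (App (App (Lam TY fun A => Lam TY fun B => moIso (FN A B))
    (val (kap o) A ρ)) (val (kap o) B ρ)))) (val (kap o) f ρ) = _
  rw [App_Lam bdd_TY (r := ∅) hA, App_Lam bdd_TY (r := ∅) hB, 
    moIso_bwd (bdd_FN _ _) hf]

/-- The value of the family is a graph, and the quantifier reads it only at object types, where it
agrees with `g`. -/
theorem allIso_app {t : T} {g : V → V} (h : Fam o ρ t g) :
    App (App (kap o .allIso) tyV) (val (kap o) (lam (el ty) t) ρ) = moIso (ALL TY g) := by
  rw [kap, App_Lam bdd_KI (r := ∅) isKi_tyV, h.val_eq,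
    App_Lam (bdd_FAM _) (FAM_Lam (fun α hα => (h α hα).2) ∅), EL_tyV]
  exact congrArg moIso (ALL_congr fun α r hα => App_Lam bdd_TY hα)

theorem val_appAll {t f a : T} {g : V → V} {r : D} (h : Fam o ρ t g)
    (hf : decode (allV TY g) (val (kap o) f ρ) r) :
    val (kap o) (appAll ty (lam (el ty) t) f a) ρ =
      appAllV g (val (kap o) f ρ) (val (kap o) a ρ) := by
  change App (App (fstV (App (App (kap o .allIso) tyV) (val (kap o) (lam (el ty) t) ρ)))
    (val (kap o) f ρ)) (val (kap o) a ρ) = _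
  rw [allIso_app h, moIso_fwd hf, appAllV]

theorem val_absAll {t u : T} {g : V → V} {r : D} (h : Fam o ρ t g)
    (hu : ALL TY g (Lam TY fun α => val (kap o) u (α ∷ₛ ρ)) r) :
    val (kap o) (absAll ty (lam (el ty) t) u) ρ =
      quo (ALL TY g) (Lam TY fun α => val (kap o) u (α ∷ₛ ρ)) := by
  change App (fstV (sndV (App (App (kap o .allIso) tyV) (val (kap o) (lam (el ty) t) ρ))))
    (val (kap o) (lam (el ty) u) ρ) = _
  rw [allIso_app h, val_lam, cls_el_ty, moIso_bwd (bdd_ALL bdd_TY g) hu]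

theorem val_mRet {m A a : T} {r : D} (hm : RM (val (kap o) m ρ) r)
    (hA : IsTy (val (kap o) A ρ)) : val (kap o) (mRet m A a) ρ =
      mRetV (val (kap o) m ρ) (val (kap o) A ρ) (val (kap o) a ρ) := by
  have hf := RM_isEf hm
  have h₁ : decode (allV TY fun α => tfunV α (App (fstV (val (kap o) m ρ)) α))
    (fstV (sndV (val (kap o) m ρ))) (d₁ (d₂ r)) := hm.2.2.2.1
  have h₂ := appAllV_mem (e := ∅)
    (fun α _ => isTy_tfunV α (App (fstV (val (kap o) m ρ)) α)) h₁ hA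
  have e : val (kap o) (appAll ty (retFam (fst m)) (fst (snd m)) A) ρ = _ :=
    val_appAll (retFam_fam (M := fst m) rfl hf) h₁
  rw [mRet, val_appT hA, e, val_mApp hm]
  · rfl
  · rw [val_mApp hm]; exact hf.app hA
  · rw [e, val_mApp hm]; exact h₂

end

end Realiz

namespace Realiz

open Graph LccLF LccLF.Tm

section

open Fha

variable {o : V} {ρ : ℕ → V}

/-! ## Typing of derived notions -/

theorem appT_mem {A B f a : T} {A' B' : V} {d e : D} (eA : val (kap o) A ρ = A')
    (eB : val (kap o) B ρ = B') (hA : IsTy A') (hB : IsTy B')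
    (hf : decode (tfunV A' B') (val (kap o) f ρ) d) (ha : decode A' (val (kap o) a ρ) e) :
    decode B' (val (kap o) (appT A B f a) ρ) (d ⬝ e) := by
  subst eA eB
  rw [val_appT hA hB hf]
  exact appTV_mem hB hf ha

theorem absT_mem {A B f : T} {A' B' : V} {d : D} (eA : val (kap o) A ρ = A')
    (eB : val (kap o) B ρ = B') (hA : IsTy A') (hB : IsTy B')
    (hf : FN A' B' (val (kap o) f ρ) d) :
    decode (tfunV A' B') (val (kap o) (absT A B f) ρ) d := by
  subst eA eB
  rw [val_absT hA hB hf]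
  exact quo_mem (mod_FN _ hB) hf

theorem absT_lam_mem {A B t : T} {A' B' : V} {d : D} (eA : val (kap o) A ρ = A')
    (eB : val (kap o) B ρ = B') (hA : IsTy A') (hB : IsTy B')
    (ht : ∀ x r, decode A' x r → decode B' (val (kap o) t (x ∷ₛ ρ)) (d ⬝ r)) :
    decode (tfunV A' B') (val (kap o) (absT A B (lam (tm A) t)) ρ) d := by
  refine absT_mem eA eB hA hB ?_
  rw [val_lam, cls_tm (eA ▸ hA), eA]
  exact PI_Lam (bdd_decode _) ht

theorem appAll_mem {t f a : T} {g : V → V} {d e : D} (h : Fam o ρ t g)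
    (hf : decode (allV TY g) (val (kap o) f ρ) d) {a' : V} (ea : val (kap o) a ρ = a')
    (ha : IsTy a') :
    decode (g a') (val (kap o) (appAll ty (lam (el ty) t) f a) ρ) (d ⬝ e) := by
  rw [val_appAll h hf, ea]
  exact appAllV_mem (fun α hα => (h α hα).2) hf ha

theorem absAll_mem {t u : T} {g : V → V} {d : D} (h : Fam o ρ t g)
    (hu : ∀ α r, IsTy α → decode (g α) (val (kap o) u (α ∷ₛ ρ)) (d ⬝ r)) :
    decode (allV TY g) (val (kap o) (absAll ty (lam (el ty) t) u) ρ) d := by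
  have hu' : ALL TY g (Lam TY fun α => val (kap o) u (α ∷ₛ ρ)) d :=
    PI_Lam bdd_TY fun α r hα => hu α r hα
  rw [val_absAll h hu']
  exact quo_mem (mod_ALL fun α _ hα => (h α hα).2) hu'

theorem mRet_mem {m A a : T} {m' A' : V} {d e : D} (em : val (kap o) m ρ = m')
    (eA : val (kap o) A ρ = A') (hm : RM m' d) (hA : IsTy A')
    (ha : decode A' (val (kap o) a ρ) e) :
    decode (App (fstV m') A') (val (kap o) (mRet m A a) ρ) (d₁ (d₂ d) ⬝ ∅ ⬝ e) := by
  subst em eA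
  rw [val_mRet hm hA]
  exact mRetV_mem hm hA ha

theorem mBind_mem {m A B c k : T} {m' A' B' : V} {d e s : D} (em : val (kap o) m ρ = m')
    (eA : val (kap o) A ρ = A') (eB : val (kap o) B ρ = B') (hm : RM m' d) (hA : IsTy A')
    (hB : IsTy B') (hc : decode (App (fstV m') A') (val (kap o) c ρ) e)
    (hk : decode (tfunV A' (App (fstV m') B')) (val (kap o) k ρ) s) :
    decode (App (fstV m') B') (val (kap o) (mBind m A B c k) ρ)
      (d₂ (d₂ d) ⬝ ∅ ⬝ ∅ ⬝ e ⬝ s) := by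
  have hf := RM_isEf hm
  have hA' := hf.app hA
  have hB' := hf.app hB
  have hm' : RM (val (kap o) m ρ) d := em ▸ hm
  have e₁ : val (kap o) (mApp m A) ρ = App (fstV m') A' := by rw [val_mApp hm', em, eA]
  have e₂ : val (kap o) (mApp m B) ρ = App (fstV m') B' := by rw [val_mApp hm', em, eB]
  have e₃ : val (kap o) (tfun A (mApp m B)) ρ = tfunV A' (App (fstV m') B') := by
    rw [val_tfun, eA, e₂] <;> simpa [eA, e₂]
  have h₀ : decode (bindTyV (fstV m')) (val (kap o) (snd (snd m)) ρ) (d₂ (d₂ d)) := by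
    simpa [em] using hm.2.2.2.2
  have f₁ := bindFam₁_fam (o := o) (ρ := ρ) (M := fst m) (by rw [val_fst, em]) hf
  have h₁ := appAll_mem (e := ∅) f₁ h₀ eA hA
  have h₂ := appAll_mem (e := ∅) (bindFam₂_fam (M := fst m) (by rw [val_fst, em]) eA hf hA) h₁ eB hB
  refine appT_mem e₃ e₂ (isTy_tfunV _ _) hB' (appT_mem e₁ ?_ hA' (isTy_tfunV _ _) h₂ hc) hk
  rw [val_tfun, e₂, e₃] <;> simp [e₃, e₂, hB']

/-- Realizer of `fctOfMnd`. -/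
def fctR : D := cl (.lam (.app (.app (.cst dpair) (.cst ∅)) (.lam (.lam (.lam (.lam
  (.app (.app (.app (.app (Lm.p₂ (Lm.p₂ (.var 4))) (.cst ∅)) (.cst ∅)) (.var 0))
    (.lam (.app (.app (Lm.p₁ (Lm.p₂ (.var 5))) (.cst ∅)) (.app (.var 2) (.var 0)))))))))))

/-- The realizer `fctR` follows the defining term of `fctOfMnd`, with `∅` for each type argument.
Only the types of `ret` and `bind` matter; no monad law is used. -/
theorem fct_mem {m : T} {d : D} (hm : RM (val (kap o) m ρ) d) :
    RF (val (kap o) (fctOfMnd m) ρ) (fctR ⬝ d) := by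
  have hf := RM_isEf hm
  have em : ∀ A {σ : ℕ → V} {n : T}, val (kap o) n σ = val (kap o) m ρ →
      val (kap o) (mApp n A) σ = App (fstV (val (kap o) m ρ)) (val (kap o) A σ) :=
    fun A σ n e => by rw [val_mApp (r := d), e]; rwa [e]
  simp only [fctR, cl_lam_dapp, ev_app, ev_cst]
  rw [fctOfMnd, val_pair, val_fst]
  refine SG_pair hf (absAll_mem (fmapFam₁_fam (val_fst ..) hf) fun α r hα => ?_)
  rw [ev_lam_dapp]
  refine absAll_mem (fmapFam₂_fam (by simp) (by simp) hf hα) fun β r hβ => ?_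
  rw [ev_lam_dapp]
  have hα' := hf.app hα
  have hβ' := hf.app hβ
  refine absT_lam_mem (by simp [val_tfun, hα, hβ]) ?_ (isTy_tfunV _ _) (isTy_tfunV _ _)
    fun f r hf' => ?_
  · rw [val_tfun] <;> simp [em, hα', hβ']
  rw [ev_lam_dapp]
  refine absT_lam_mem (by simp [em]) (by simp [em]) hα' hβ' fun c r hc => ?_
  rw [ev_lam_dapp]
  refine mBind_mem (by simp) (by simp) (by simp) hm hα hβ hc
    (absT_lam_mem (by simp) (by simp [em]) hα hβ' fun a r ha => ?_)
  rw [ev_lam_dapp]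
  exact mRet_mem (by simp) (by simp) hm hβ
    (appT_mem (by simp) (by simp) hα hβ hf' ha)

theorem up_mem {H A t : T} {H' A' : V} {d e : D} (eH : val (kap o) H ρ = H')
    (eA : val (kap o) A ρ = A') (hH : RH H' d) (hA : IsTy A')
    (ht : decode (thV H' A') (val (kap o) t ρ) e) : CO H' A' (val (kap o) (up H A t) ρ) e := by
  subst eH eA
  rw [val_up hH hA ht]
  exact rep_mem (mod_CO _ _) ht

theorem down_mem {H A c : T} {H' A' : V} {d e : D} (eH : val (kap o) H ρ = H')
    (eA : val (kap o) A ρ = A') (hH : RH H' d) (hA : IsTy A')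
    (hc : CO H' A' (val (kap o) c ρ) e) :
    decode (thV H' A') (val (kap o) (down H A c) ρ) e := by
  subst eH eA
  rw [val_down hH hA hc]
  exact quo_mem (mod_CO _ _) hc

theorem letIn_mem {H A B m k : T} {H' A' B' : V} {d e s : D} (eH : val (kap o) H ρ = H')
    (eA : val (kap o) A ρ = A') (eB : val (kap o) B ρ = B') (hH : RH H' s) (hA : IsTy A')
    (hB : IsTy B') (hm : CO H' A' (val (kap o) m ρ) d) (hk : KC H' A' B' (val (kap o) k ρ) e) :
    CO H' B' (val (kap o) (letIn H A B m k) ρ) (letR ⬝ d ⬝ e) := by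
  subst eH eA eB
  rw [val_letIn hH hA hB hm hk]
  exact letV_mem hm hk

theorem cont_mem {A t : T} {H' A' B' : V} {d : D} (eA : val (kap o) A ρ = A') (hA : IsTy A')
    (ht : ∀ x r, decode A' x r → CO H' B' (val (kap o) t (x ∷ₛ ρ)) (d ⬝ r)) :
    KC H' A' B' (val (kap o) (lam (tm A) t) ρ) d := by
  rw [val_lam, cls_tm (eA ▸ hA), eA]
  exact PI_Lam (bdd_decode _) ht

theorem hdl_mem {H A h c : T} {H' A' h' : V} {d e s : D} (eH : val (kap o) H ρ = H')
    (eA : val (kap o) A ρ = A') (eh : val (kap o) h ρ = h') (hH : RH H' s) (hA : IsTy A')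
    (hh : HD H' h' e) (hc : CO H' A' (val (kap o) c ρ) d) :
    decode (App (fstV (fstV h')) A') (val (kap o) (hdl H A h c) ρ) (hdlR ⬝ e ⬝ d) := by
  subst eH eA eh
  rw [val_hdl hH hA hh hc]
  exact hdlV_mem hA hh hc

/-- Realizer of `thMnd`. -/
def thMndR : D := dpair ⬝ ∅ ⬝ (dpair ⬝ cl (.lam (.lam (.app (.cst valR) (.var 0)))) ⬝
  cl (.lam (.lam (.lam (.lam (.app (.app (.cst letR) (.var 1))
    (.lam (.app (.var 1) (.var 0)))))))))

theorem val_thApp {H A : T} {H' A' : V} {d : D} (eH : val (kap o) H ρ = thF H')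
    (eA : val (kap o) A ρ = A') (_ : RH H' d) (hA : IsTy A') :
    val (kap o) (efApp H A) ρ = thV H' A' := by
  rw [val_efApp, eH, eA, App_thF hA]
  rw [eH]
  exact isEf_thF _

/-- Passing between thunks and computations preserves realizers, so the realizers of `val` and `let`
suffice; nothing of the realizer of `H` enters. -/
theorem thMnd_mem {H : T} {d : D} (hH : RH (val (kap o) H ρ) d) :
    RM (val (kap o) (thMnd H) ρ) thMndR := by
  have eT := val_thFun (o := o) (ρ := ρ) hH
  have hT := isEf_thF (val (kap o) H ρ)
  have ea := fun A (hA : IsTy A) => App_thF (H := val (kap o) H ρ) hA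
  rw [thMnd, val_pair, val_pair, eT]
  refine SG_pair hT (SG_pair ?_ ?_)
  · refine absAll_mem (retFam_fam eT hT) fun α r hα => ?_
    rw [cl_lam_dapp, ea α hα]
    refine absT_lam_mem (by simp) (val_thApp (by simp [eT]) (by simp) hH hα) hα (isTy_thV _ _)
      fun a r ha => ?_
    rw [ev_lam_dapp]
    refine down_mem (by simp) (by simp) hH hα ?_
    rw [val_val (r := d) (s := r)] <;> simp [hH, hα, ha, valV_mem]
  · refine absAll_mem (bindFam₁_fam eT hT) fun α r hα => ?_
    rw [cl_lam_dapp]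
    refine absAll_mem (bindFam₂_fam (by simp [eT]) (by simp) hT hα) fun β r hβ => ?_
    rw [ev_lam_dapp, ea α hα, ea β hβ]
    have hα' := isTy_thV (val (kap o) H ρ) α
    have hβ' := isTy_thV (val (kap o) H ρ) β
    have e₁ : ∀ {σ : ℕ → V} {F A : T}, val (kap o) F σ = thF (val (kap o) H ρ) →
        IsTy (val (kap o) A σ) →
        val (kap o) (efApp F A) σ = thV (val (kap o) H ρ) (val (kap o) A σ) :=
      fun e hA => val_thApp e rfl hH hA
    refine absT_lam_mem (by simp [e₁, eT, hα]) ?_ hα' (isTy_tfunV _ _) fun m r hm => ?_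
    · rw [val_tfun, val_tfun] <;> simp [e₁, eT, hα, hβ, val_tfun]
    rw [ev_lam_dapp]
    have e₂ : val (kap o) (tfun (v 2) (efApp (wk 3 (thFun H)) (v 1))) (m ∷ₛ β ∷ₛ α ∷ₛ ρ) =
        tfunV α (thV (val (kap o) H ρ) β) := by
      rw [val_tfun] <;> simp [e₁, eT, hα, hβ]
    refine absT_lam_mem e₂ (by simp [e₁, eT, hβ]) (isTy_tfunV _ _) hβ' fun k r hk => ?_
    rw [ev_lam_dapp]
    refine down_mem (by simp) (by simp) hH hβ ?_
    refine letIn_mem (by simp) (by simp) (by simp) hH hα hβ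
      (up_mem (by simp) (by simp) hH hα hm) (cont_mem (by simp) hα fun a r ha => ?_)
    rw [ev_lam_dapp]
    exact up_mem (by simp) (by simp) hH hβ
      (appT_mem (by simp) (by simp [e₁, eT, hβ]) hα hβ' hk ha)

/-- Realizer of `hdlTrans`. -/
def hdlTransR : D := cl (.lam (.lam (.lam (.app (.app (.cst hdlR) (.var 2)) (.var 0)))))

theorem hdlTrans_mem {H h : T} {d e : D} (hH : RH (val (kap o) H ρ) d)
    (hh : HD (val (kap o) H ρ) (val (kap o) h ρ) e) :
    decode (transV (thF (val (kap o) H ρ)) (fstV (fstV (val (kap o) h ρ))))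
      (val (kap o) (hdlTrans H h) ρ) (hdlTransR ⬝ e) := by
  have eT := val_thFun (o := o) (ρ := ρ) hH
  have hT := isEf_thF (val (kap o) H ρ)
  have hM := HD_isEf hh
  refine absAll_mem (transFam_fam eT rfl hT hM) fun α r hα => ?_
  have e₁ : ∀ {σ : ℕ → V} {F A : T}, val (kap o) F σ = thF (val (kap o) H ρ) →
      IsTy (val (kap o) A σ) →
      val (kap o) (efApp F A) σ = thV (val (kap o) H ρ) (val (kap o) A σ) :=
    fun e hA => val_thApp e rfl hH hA
  simp only [hdlTransR, cl_lam_dapp, ev_lam_dapp, App_thF hα]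
  refine absT_lam_mem (by simp [e₁, eT, hα]) ?_ (isTy_thV _ _) (hM.app hα) fun c r hc => ?_
  · rw [val_mApp (r := d₁ e)] <;> simp [HD_rm hh]
  rw [ev_lam_dapp]
  exact hdl_mem (by simp) (by simp) (by simp) hH hα hh (up_mem (by simp) (by simp) hH hα hc)

theorem hfApp_eq {H F A : T} {H' F' A' : V} (eH : val (kap o) H ρ = H')
    (eF : val (kap o) F ρ = F') (eA : val (kap o) A ρ = A') (hH : IsHt (fstV H'))
    (hF : IsEf F') : val (kap o) (hfApp H F A) ρ = App (App (fstV H') F') A' := by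
  subst eH eF eA
  have h : val (kap o) (hApp (fst H) F) ρ = _ := val_hApp (H := fst H) hH
  rw [hfApp, val_efApp, h, val_fst]
  rw [h]
  exact hH.app hF

/-- The `hmap` field is applied to two realized functors and to the realized handling
transformation. Handling inside the operation is thus an ordinary function argument and needs no
induction on computations. -/
theorem hdlArg_mem {H A h p : T} {d e s : D} (hH : RH (val (kap o) H ρ) d)
    (hA : IsTy (val (kap o) A ρ)) (hh : HD (val (kap o) H ρ) (val (kap o) h ρ) e)
    (hp : decode (opTyV (val (kap o) H ρ) (val (kap o) A ρ)) (val (kap o) p ρ) s) :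
    decode (App (App (fstV (val (kap o) H ρ)) (fstV (fstV (val (kap o) h ρ))))
      (val (kap o) A ρ)) (val (kap o) (hdlArg H A h p) ρ)
      (d₂ (d₂ d) ⬝ (fctR ⬝ thMndR) ⬝ (fctR ⬝ d₁ e) ⬝ (hdlTransR ⬝ e) ⬝ ∅ ⬝ s) := by
  have hM := HD_isEf hh
  have hHt := RH_isHt hH
  have eT := val_thFun (o := o) (ρ := ρ) hH
  have hT := isEf_thF (val (kap o) H ρ)
  have h₁ := fct_mem (thMnd_mem hH)
  have h₂ := fct_mem (m := fst h) (HD_rm hh)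
  have e₁ : fstV (val (kap o) (fctOfMnd (thMnd H)) ρ) = thF (val (kap o) H ρ) := by
    simp [fctOfMnd, thMnd, eT]
  have e₂ : fstV (val (kap o) (fctOfMnd (fst h)) ρ) = fstV (fstV (val (kap o) h ρ)) := by
    simp [fctOfMnd]
  have h₃ := ((hH.2.2.2.2.2 _ _ h₁).2 _ _ h₂).2 (val (kap o) (hdlTrans H h) ρ)
    (hdlTransR ⬝ e) (by rw [e₁, e₂]; exact hdlTrans_mem hH hh)
  rw [e₁, e₂] at h₃
  have g₁ : val (kap o) (hApp (fst H) (thFun H)) ρ = App (fstV (val (kap o) H ρ))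
    (thF (val (kap o) H ρ)) := by rw [val_hApp, eT, val_fst]; exact hHt
  have g₂ : val (kap o) (hApp (fst H) (fst (fst h))) ρ = App (fstV (val (kap o) H ρ))
    (fstV (fstV (val (kap o) h ρ))) := by rw [val_hApp, val_fst, val_fst, val_fst]; exact hHt
  have f := transFam_fam g₁ g₂ (hHt.app hT) (hHt.app hM)
  have h₄ := appAll_mem (f := hmap H (fctOfMnd (thMnd H)) (fctOfMnd (fst h)) (hdlTrans H h)) (a := A)
    (e := ∅) f h₃ rfl hA
  exact appT_mem (val_opTy hH) (hfApp_eq rfl rfl rfl hHt hM) ((hHt.app hT).app hA)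
    ((hHt.app hM).app hA) h₄ hp

theorem malg_mem {H h A p : T} {d e s : D} (hH : RH (val (kap o) H ρ) d)
    (hA : IsTy (val (kap o) A ρ)) (hh : HD (val (kap o) H ρ) (val (kap o) h ρ) e)
    (hp : decode (App (App (fstV (val (kap o) H ρ)) (fstV (fstV (val (kap o) h ρ))))
      (val (kap o) A ρ)) (val (kap o) p ρ) s) :
    decode (App (fstV (fstV (val (kap o) h ρ))) (val (kap o) A ρ))
      (val (kap o) (malg H h A p) ρ) (d₂ e ⬝ ∅ ⬝ s) := by
  have hM := HD_isEf hh
  have hHt := RH_isHt hH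
  have g : val (kap o) (hApp (fst H) (fst (fst h))) ρ = App (fstV (val (kap o) H ρ))
    (fstV (fstV (val (kap o) h ρ))) := by rw [val_hApp, val_fst, val_fst, val_fst]; exact hHt
  have f := transFam_fam (G := fst (fst h)) g rfl (hHt.app hM) hM
  have h₁ : decode (transV (App (fstV (val (kap o) H ρ)) (fstV (fstV (val (kap o) h ρ))))
    (fstV (fstV (val (kap o) h ρ)))) (sndV (val (kap o) h ρ)) (d₂ e) := hh.2.2
  have h₂ := appAll_mem (f := snd h) (a := A) (e := ∅) f h₁ rfl hA
  exact appT_mem (hfApp_eq rfl rfl rfl hHt hM) (val_mApp (m := fst h) (HD_rm hh))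
    ((hHt.app hM).app hA) (hM.app hA) h₂ hp

/-- The handling of the operation call `p`, continued by `k`. -/
def opBody (H A B h p k : T) : T :=
  mBind (fst h) A B (malg H h A (hdlArg H A h p)) (absT A (mApp (fst h) B) k)

/-- Realizer of `opBody`, with variables for the realizers of `H`, `p`, `h` and `k`. -/
def opBodyR (d s e t : D) : D :=
  d₂ (d₂ (d₁ e)) ⬝ ∅ ⬝ ∅ ⬝ (d₂ e ⬝ ∅ ⬝ (d₂ (d₂ d) ⬝ (fctR ⬝ thMndR) ⬝ (fctR ⬝ d₁ e) ⬝
    (hdlTransR ⬝ e) ⬝ ∅ ⬝ s)) ⬝ t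

theorem opBody_mem {H A B h p k : T} {d e s t : D} (hH : RH (val (kap o) H ρ) d)
    (hA : IsTy (val (kap o) A ρ)) (hB : IsTy (val (kap o) B ρ))
    (hh : HD (val (kap o) H ρ) (val (kap o) h ρ) e)
    (hp : decode (opTyV (val (kap o) H ρ) (val (kap o) A ρ)) (val (kap o) p ρ) s)
    (hk : FN (val (kap o) A ρ) (hc (val (kap o) h ρ) (val (kap o) B ρ)) (val (kap o) k ρ) t) :
    decode (hc (val (kap o) h ρ) (val (kap o) B ρ)) (val (kap o) (opBody H A B h p k) ρ)
      (opBodyR d s e t) :=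
  mBind_mem (val_fst ..) rfl rfl (HD_rm hh) hA hB
    (malg_mem hH hA hh (hdlArg_mem hH hA hh hp))
    (absT_mem rfl (val_mApp (m := fst h) (HD_rm hh)) hA ((HD_isEf hh).app hB) hk)

end

end Realiz

namespace Realiz

open Graph LccLF LccLF.Tm

/-! ## Operations -/

section

open Fha

/-- The semantic counterpart of `opBody`. -/
noncomputable def opBodyV (H A B h p k : V) : V :=
  val (kap ∅) (opBody (v 0) (v 1) (v 2) (v 3) (v 4) (v 5))
    (H ∷ₛ A ∷ₛ B ∷ₛ h ∷ₛ p ∷ₛ k ∷ₛ fun _ => ∅)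

theorem cls_app {K : Type} (κ : K → V) (f a : Tm K) (ρ : ℕ → V) :
    cls κ (app f a) ρ = decode (App (val κ f ρ) (val κ a ρ)) := (rfl)

/-- The handling of an operation call never mentions `op`. Its value can therefore be computed with
`∅` for `op`, as in `opBodyV`, before the interpretation of `op` exists. -/
theorem val_opBody {o : V} {ρ : ℕ → V} (H A B h p k : T) :
    val (kap o) (opBody H A B h p k) ρ = opBodyV (val (kap o) H ρ) (val (kap o) A ρ)
      (val (kap o) B ρ) (val (kap o) h ρ) (val (kap o) p ρ) (val (kap o) k ρ) := by
  simp only [opBodyV, opBody, mBind, mRet, mApp, malg, hdlArg, hfApp, opTy, hApp, hmap,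
    hdlTrans, hdl, up, down, thMnd, fctOfMnd, thFun, th, letIn, Fha.val, valFun, appT, absT, appAll,
    absAll, appK, absK, efApp, fmapFam₁, fmapFam₂, retFam, bindFam₁, bindFam₂, transFam, tfun, all,
    el, tm, ty, efty, kfun, app2, app3, fwd, bwd, val_app, val_con, val_lam, val_fst, val_snd, val_pair, val_var,
    val_wk_one, val_wk_two, val_wk_three, val_wk_four, val_wk_five, cls_app, scons_zero, scons_succ]
  -- What remains differs only in the interpretation of `op`, and every name that occurs has the
  -- same interpretation on both sides.
  rfl

theorem opBodyV_mem {H A B h p k : V} {d e s t : D} (hH : RH H d) (hA : IsTy A) (hB : IsTy B)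
    (hh : HD H h e) (hp : decode (opTyV H A) p s) (hk : FN A (hc h B) k t) :
    decode (hc h B) (opBodyV H A B h p k) (opBodyR d s e t) :=
  opBody_mem (o := ∅) (ρ := H ∷ₛ A ∷ₛ B ∷ₛ h ∷ₛ p ∷ₛ k ∷ₛ fun _ => ∅) (H := v 0) (A := v 1)
    (B := v 2) (h := v 3) (p := v 4) (k := v 5) hH hA hB hh hp hk

/-- The operation call `p` with continuation `k`. -/
noncomputable def opV (H A B p k : V) : V :=
  coLam H B fun h C r => opBodyV H A C h p (contV A k h C r)

/-- Realizer of `op`. -/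
def opR : D := cl (.lam (.lam (.lam (.lam (.lam (.lam
  (.app (.app (.app (.app (Lm.p₂ (Lm.p₂ (Lm.p₁ (.var 2)))) (.cst ∅)) (.cst ∅))
    (.app (.app (Lm.p₂ (.var 2)) (.cst ∅))
      (.app (.app (.app (.app (.app (Lm.p₂ (Lm.p₂ (.var 5))) (.cst (fctR ⬝ thMndR)))
        (.app (.cst fctR) (Lm.p₁ (.var 2)))) (.app (.cst hdlTransR) (.var 2))) (.cst ∅))
        (.var 4))))
    (.lam (.app (.app (.app (.app (.var 4) (.var 0)) (.var 3)) (.var 2)) (.var 1))))))))))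

theorem opV_mem {H A B p k : V} {d s e : D} (hH : RH H d) (hA : IsTy A)
    (hp : decode (opTyV H A) p s) (hk : KC H A B k e) :
    CO H B (opV H A B p k) (opR ⬝ d ⬝ s ⬝ e) :=
  coLam_mem fun h d' C r q hh hC hr b => by
    have := opBodyV_mem hH hA hC hh hp (contV_mem hk hh hC hr
      (t := ev (.lam (.app (.app (.app (.app (.var 4) (.var 0)) (.var 3)) (.var 2)) (.var 1)))
        (q ∷ₛ b ∷ₛ d' ∷ₛ e ∷ₛ s ∷ₛ d ∷ₛ fun _ => ∅)) fun _ => ⟨b, by simp⟩)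
    simpa [opR, opBodyR] using this

/-- An operation passes its continuation on only through `contV`, so `contV_let` moves `k'` under
the call. -/
theorem letV_op {H A B C p k k' : V} {d : D} (hk' : KC H B C k' d) :
    letV H B C (opV H A B p k) k' =
      opV H A C p (Lam (decode A) fun a => letV H B C (App k a) k') := by
  refine coLam_congr fun h d' E r s hh hE hr => ?_
  obtain ⟨t, ht⟩ := exists_contV_mem hk' hh hE hr
  rw [opV, run_coLam hh hE ht, contV_let hh hE hr]

/-- The definition of `opV` with the continuation `ret` is the required right-hand side. -/
theorem hdlV_op {H A B h p k : V} {e : D} (hB : IsTy B) (hh : HD H h e) :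
    hdlV B h (opV H A B p k) =
      opBodyV H A B h p (Lam (decode A) fun a => hdlV B h (App k a)) := by
  obtain ⟨t, ht⟩ := exists_retK_mem hh hB
  rw [hdlV, opV, run_coLam hh hB ht]
  -- Running `k a` with the continuation `ret` is by definition `hdlV B h (App k a)`.
  rfl

noncomputable def opC : V :=
  Lam RH fun H => Lam TY fun A => Lam TY fun B => Lam (decode (opTyV H A)) fun p =>
    Lam (KC H A B) fun k => opV H A B p k

/-- The interpretation of the signature. -/
noncomputable abbrev kappa : Name → V := kap opC

variable {ρ : ℕ → V}

theorem val_op {H A B p k : T} {r s t : D} (hH : RH (val kappa H ρ) r)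
    (hA : IsTy (val kappa A ρ)) (hB : IsTy (val kappa B ρ))
    (hp : decode (opTyV (val kappa H ρ) (val kappa A ρ)) (val kappa p ρ) s)
    (hk : KC (val kappa H ρ) (val kappa A ρ) (val kappa B ρ) (val kappa k ρ) t) :
    val kappa (op H A B p k) ρ = opV (val kappa H ρ) (val kappa A ρ)
      (val kappa B ρ) (val kappa p ρ) (val kappa k ρ) := by
  change App (App (App (App (App opC (val kappa H ρ)) (val kappa A ρ))
    (val kappa B ρ)) (val kappa p ρ)) (val kappa k ρ) = _
  rw [opC, App_Lam bdd_RH hH, App_Lam bdd_TY (r := ∅) hA, App_Lam bdd_TY (r := ∅) hB,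
    App_Lam (bdd_decode _) hp, App_Lam (bdd_KC _ _ _) hk]

/-! ## The signature is realized -/

theorem of_cls {C C' : Cls} {x : V} {d : D} (h : C = C') (hx : C' x d) : C x d := h ▸ hx

theorem pi_mem {κ : Name → V} {A B : T} {C : Cls} {g : V → V} {d : D} (hA : cls κ A ρ = C)
    (bC : Bdd C) (h : ∀ x r, C x r → cls κ B (x ∷ₛ ρ) (g x) (d ⬝ r)) :
    cls κ (pi A B) ρ (Lam C g) d := by
  subst hA
  exact PI_Lam bC h

theorem arrow_mem {κ : Name → V} {A B : T} {C : Cls} {g : V → V} {d : D} (hA : cls κ A ρ = C)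
    (bC : Bdd C) (h : ∀ x r, C x r → cls κ B ρ (g x) (d ⬝ r)) :
    cls κ (arrow A B) ρ (Lam C g) d :=
  pi_mem hA bC fun x r hx => by simpa using h x r hx

/-- A true equation is realized by any realizer of the common value of its two sides. -/
theorem equation_mem {κ : Name → V} {A a b : T} {C : Cls} {x : V} {d : D}
    (sa : Sm (interp κ a ρ)) (sb : Sm (interp κ b ρ)) (ea : val κ a ρ = x) (eb : val κ b ρ = x)
    (hA : cls κ A ρ = C) (hx : C x d) : cls κ (eq A a b) ρ ∅ d := by
  subst ea hA
  exact ⟨rfl, eb.symm, hx, sa, sb⟩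

/-! ### Classes and values of expressions at prescribed arguments -/

section

variable {A B H k h : T} {A' B' H' k' h' : V} {r : D}

theorem cls_el_of (ek : val kappa k ρ = k') (hk : IsKi k') : cls kappa (el k) ρ = EL k' := by
  subst ek; exact cls_el hk

theorem cls_tm_of (eA : val kappa A ρ = A') (hA : IsTy A') : cls kappa (tm A) ρ = decode A' := by
  subst eA; exact cls_tm hA

theorem cls_fam_of (ek : val kappa k ρ = k') (hk : IsKi k') :
    cls kappa (arrow (el k) (el ty)) ρ = FAM k' := by
  rw [cls_arrow, cls_el_of ek hk, cls_el_ty, FAM]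

theorem cls_co_of (eH : val kappa H ρ = H') (eA : val kappa A ρ = A') (hH : RH H' r)
    (hA : IsTy A') : cls kappa (co H A) ρ = CO H' A' := by
  subst eH eA; exact cls_co hH hA

theorem cls_cont_of (eH : val kappa H ρ = H') (eA : val kappa A ρ = A')
    (eB : val kappa B ρ = B') (hH : RH H' r) (hA : IsTy A') (hB : IsTy B') :
    cls kappa (arrow (tm A) (co H B)) ρ = KC H' A' B' := by
  rw [cls_arrow, cls_tm_of eA hA, cls_co_of eH eB hH hB, KC]

theorem cls_opTy_of (eH : val kappa H ρ = H') (eA : val kappa A ρ = A') (hH : RH H' r)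
    (hA : IsTy A') : cls kappa (tm (opTy H A)) ρ = decode (opTyV H' A') := by
  subst eH eA; exact cls_tm_of (val_opTy hH) (isTy_opTyV hH hA)

theorem cls_Handler_of (eH : val kappa H ρ = H') (hH : RH H' r) :
    cls kappa (Handler H) ρ = HD H' := by
  subst eH; exact cls_Handler (RH_isHt hH)

theorem cls_hc_of (eh : val kappa h ρ = h') (eA : val kappa A ρ = A') (hh : HD H' h' r)
    (hA : IsTy A') : cls kappa (tm (mApp (fst h) A)) ρ = decode (hc h' A') := by
  subst eh eA
  exact cls_tm_of (val_mApp (m := fst h) (HD_rm hh)) ((HD_isEf hh).app hA)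

variable {m a p : T} {m' a' p' : V} {s t : D}

theorem val_val_of (eH : val kappa H ρ = H') (eA : val kappa A ρ = A')
    (ea : val kappa a ρ = a') (hH : RH H' r) (hA : IsTy A') (ha : decode A' a' s) :
    val kappa (Fha.val H A a) ρ = valV H' A' a' := by
  subst eH eA ea; exact val_val hH hA ha

theorem val_letIn_of (eH : val kappa H ρ = H') (eA : val kappa A ρ = A')
    (eB : val kappa B ρ = B') (em : val kappa m ρ = m') (ek : val kappa k ρ = k')
    (hH : RH H' r) (hA : IsTy A') (hB : IsTy B') (hm : CO H' A' m' s) (hk : KC H' A' B' k' t) :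
    val kappa (letIn H A B m k) ρ = letV H' A' B' m' k' := by
  subst eH eA eB em ek; exact val_letIn hH hA hB hm hk

theorem val_op_of (eH : val kappa H ρ = H') (eA : val kappa A ρ = A')
    (eB : val kappa B ρ = B') (ep : val kappa p ρ = p') (ek : val kappa k ρ = k')
    (hH : RH H' r) (hA : IsTy A') (hB : IsTy B') (hp : decode (opTyV H' A') p' s)
    (hk : KC H' A' B' k' t) : val kappa (op H A B p k) ρ = opV H' A' B' p' k' := by
  subst eH eA eB ep ek; exact val_op hH hA hB hp hk

theorem val_hdl_of (eH : val kappa H ρ = H') (eA : val kappa A ρ = A')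
    (eh : val kappa h ρ = h') (em : val kappa m ρ = m') (hH : RH H' r) (hA : IsTy A')
    (hh : HD H' h' s) (hm : CO H' A' m' t) : val kappa (hdl H A h m) ρ = hdlV A' h' m' := by
  subst eH eA eh em; exact val_hdl hH hA hh hm

theorem val_lam_of {g : V → V} (eA : val kappa A ρ = A') (hA : IsTy A')
    (hm : ∀ x r, decode A' x r → val kappa m (x ∷ₛ ρ) = g x) :
    val kappa (lam (tm A) m) ρ = Lam (decode A') g := by
  rw [val_lam, cls_tm_of eA hA]; exact Lam_congr hm

end

/-- The right-hand sides of the associativity laws apply graphs to this composed continuation, which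
must be realized for the application to compute. -/
theorem exists_let_cont {H A B C k k' : V} {d e : D} (hk : KC H A B k d) (hk' : KC H B C k' e) :
    ∃ t, KC H A C (Lam (decode A) fun a => letV H B C (App k a) k') t :=
  ⟨cl (.lam (.app (.app (.cst letR) (.app (.cst d) (.var 0))) (.cst e))),
    PI_Lam (bdd_decode A) fun a r ha => by simpa using letV_mem (hk.2 a r ha) hk'⟩

/-- The declared name `c` is realized. -/
def Realized (c : Name) : Prop := ∃ d : D, ∀ ρ, cls kappa (signature c) ρ (kappa c) d

theorem realized_ki : Realized .ki := ⟨∅, fun _ => trivial⟩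

theorem realized_el : Realized .el :=
  ⟨∅, fun _ => arrow_mem cls_ki bdd_KI fun _ _ _ => trivial⟩

theorem realized_ty : Realized .ty := ⟨∅, fun _ => of_cls cls_ki isKi_tyV⟩

theorem realized_kfun : Realized .kfun :=
  ⟨∅, fun _ => arrow_mem cls_ki bdd_KI fun _ _ _ => arrow_mem cls_ki bdd_KI fun _ _ _ =>
    of_cls cls_ki (isKi_kfunV _ _)⟩

theorem realized_unit : Realized .unit := ⟨∅, fun _ => of_cls cls_el_ty (isTy_mo _)⟩

theorem realized_bool : Realized .bool := ⟨∅, fun _ => of_cls cls_el_ty (isTy_mo _)⟩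

theorem realized_tfun : Realized .tfun :=
  ⟨∅, fun _ => arrow_mem cls_el_ty bdd_TY fun _ _ _ => arrow_mem cls_el_ty bdd_TY fun _ _ _ =>
    of_cls cls_el_ty (isTy_mo _)⟩

theorem realized_all : Realized .all :=
  ⟨∅, fun _ => pi_mem cls_ki bdd_KI fun k _ hk => arrow_mem (cls_fam_of rfl hk) (bdd_FAM k)
    fun _ _ _ => of_cls cls_el_ty (isTy_mo _)⟩

/-- A realizer that ignores two arguments. -/
def const₂ (d : D) : D := cl (.lam (.lam (.cst d)))

@[simp] theorem const₂_dapp (d a b : D) : const₂ d ⬝ a ⬝ b = d := by simp [const₂]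

theorem realized_kfunIso : Realized .kfunIso :=
  ⟨const₂ isoR, fun ρ => pi_mem cls_ki bdd_KI fun k _ hk => pi_mem cls_ki bdd_KI fun l _ hl => by
    rw [const₂_dapp]
    refine iso_mem (A := el (kfun (v 1) (v 0))) (cls_el_of (val_kfun hk hl) (isKi_kfunV _ _)) ?_
      (bdd_EL _) (bdd_EL _) (fun _ _ h => h) (fun _ _ h => h) (fun _ _ _ => rfl) fun _ _ _ => rfl
    rw [cls_arrow, cls_el_of (k := v 1) (k' := k) rfl hk, cls_el_of (k := v 0) (k' := l) rfl hl,
      EL_kfunV]⟩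

theorem realized_tm : Realized .tm :=
  ⟨∅, fun _ => arrow_mem cls_el_ty bdd_TY fun _ _ _ => trivial⟩

theorem mod_UN : Mod UN := fun _ _ _ h h' => h.trans h'.symm

theorem realized_unitIso : Realized .unitIso :=
  ⟨isoR, fun _ => moIso_mem (cls_tm_of rfl (isTy_mo _)) rfl bdd_UN mod_UN⟩

theorem realized_tfunIso : Realized .tfunIso :=
  ⟨const₂ isoR, fun ρ => pi_mem cls_el_ty bdd_TY fun A _ hA =>
    pi_mem cls_el_ty bdd_TY fun B _ hB => by
      rw [const₂_dapp]
      refine moIso_mem (A := tm (tfun (v 1) (v 0))) (cls_tm_of (val_tfun hA hB) (isTy_mo _)) ?_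
        (bdd_FN A B) (mod_FN A hB)
      rw [cls_arrow, cls_tm_of (A := v 1) (A' := A) rfl hA, cls_tm_of (A := v 0) (A' := B) rfl hB,
        FN]⟩

theorem realized_allIso : Realized .allIso :=
  ⟨const₂ isoR, fun ρ => pi_mem cls_ki bdd_KI fun k _ hk =>
    pi_mem (cls_fam_of rfl hk) (bdd_FAM k) fun F r hF => by
      rw [const₂_dapp]
      refine moIso_mem (A := tm (all (v 1) (v 0))) (cls_tm_of (val_all (r := r) hk hF) (isTy_mo _))
        ?_ (bdd_ALL (bdd_EL k) (App F)) (mod_ALL fun x s hx => hF.2 x s hx)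
      rw [cls_pi, cls_el_of (k := v 1) (k' := k) rfl hk]
      exact PI_congr rfl fun x s hx => cls_tm_of rfl (hF.2 x s hx)⟩

theorem cls_tm_bool : cls kappa (tm bool) ρ = decode (mo BL) := cls_tm_of rfl (isTy_mo _)

theorem realized_tt : Realized .tt := ⟨∅, fun _ => of_cls cls_tm_bool (quo_mem mod_BL rfl)⟩

theorem realized_ff : Realized .ff := ⟨Set.univ, fun _ => of_cls cls_tm_bool (quo_mem mod_BL rfl)⟩

theorem realized_co : Realized .co :=
  ⟨∅, fun _ => arrow_mem cls_RawHFunctor bdd_RH fun _ _ _ =>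
    arrow_mem cls_el_ty bdd_TY fun _ _ _ => trivial⟩

theorem realized_val : Realized .val :=
  ⟨const₂ valR, fun _ => pi_mem cls_RawHFunctor bdd_RH fun H _ hH =>
    pi_mem cls_el_ty bdd_TY fun A _ hA => by
      rw [const₂_dapp]
      exact arrow_mem (cls_tm_of rfl hA) (bdd_decode A) fun a _ ha =>
        of_cls (cls_co_of rfl rfl hH hA) (valV_mem ha)⟩

theorem realized_letIn : Realized .letIn :=
  ⟨cl (.lam (.lam (.lam (.cst letR)))), fun _ => pi_mem cls_RawHFunctor bdd_RH fun H _ hH =>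
    pi_mem cls_el_ty bdd_TY fun A _ hA => pi_mem cls_el_ty bdd_TY fun B _ hB => by
      simp only [cl_lam_dapp, ev_lam_dapp, ev_cst]
      exact arrow_mem (cls_co_of rfl rfl hH hA) (bdd_CO H A) fun m _ hm =>
        arrow_mem (cls_cont_of rfl rfl rfl hH hA hB) (bdd_KC H A B) fun k _ hk =>
          of_cls (cls_co_of rfl rfl hH hB) (letV_mem hm hk)⟩

theorem realized_valLet : Realized .valLet :=
  -- The proof must carry a realizer of the common value; the right-hand side `k a` supplies one.
  ⟨cl (.lam (.lam (.lam (.lam (.lam (.app (.var 0) (.var 1))))))), fun ρ =>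
    pi_mem cls_RawHFunctor bdd_RH fun H _ hH => pi_mem cls_el_ty bdd_TY fun A _ hA =>
    pi_mem cls_el_ty bdd_TY fun B _ hB => pi_mem (cls_tm_of rfl hA) (bdd_decode A)
    fun a _ ha => pi_mem (cls_cont_of rfl rfl rfl hH hA hB) (bdd_KC H A B) fun k _ hk => by
      simp only [cl_lam_dapp, ev_lam_dapp, ev_app, ev_var, scons_zero, scons_one]
      have e₀ : val kappa (Fha.val (v 4) (v 3) (v 1)) (k ∷ₛ a ∷ₛ B ∷ₛ A ∷ₛ H ∷ₛ ρ) = valV H A a :=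
        val_val_of rfl rfl rfl hH hA ha
      have e₁ : val kappa (letIn (v 4) (v 3) (v 2) (Fha.val (v 4) (v 3) (v 1)) (v 0))
          (k ∷ₛ a ∷ₛ B ∷ₛ A ∷ₛ H ∷ₛ ρ) = letV H A B (valV H A a) k :=
        val_letIn_of rfl rfl rfl e₀ rfl hH hA hB (valV_mem ha) hk
      exact equation_mem rfl rfl (e₁.trans (letV_val ha hk)) rfl
        (cls_co_of (H := v 4) (A := v 2) rfl rfl hH hB) (hk.2 a _ ha)⟩

theorem realized_letVal : Realized .letVal :=
  ⟨cl (.lam (.lam (.lam (.var 0)))), fun ρ =>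
    pi_mem cls_RawHFunctor bdd_RH fun H _ hH => pi_mem cls_el_ty bdd_TY fun A _ hA =>
    pi_mem (cls_co_of rfl rfl hH hA) (bdd_CO H A) fun m _ hm => by
      simp only [cl_lam_dapp, ev_lam_dapp, ev_var, scons_zero]
      have e₀ : val kappa (valFun (v 2) (v 1)) (m ∷ₛ A ∷ₛ H ∷ₛ ρ) = Lam (decode A) (valV H A) :=
        val_valFun (H := v 2) (A := v 1) hH hA
      have e₁ : val kappa (letIn (v 2) (v 1) (v 1) (v 0) (valFun (v 2) (v 1)))
          (m ∷ₛ A ∷ₛ H ∷ₛ ρ) = letV H A A m (Lam (decode A) (valV H A)) :=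
        val_letIn_of rfl rfl rfl rfl e₀ hH hA hA hm (t := valR)
          (PI_Lam (bdd_decode A) fun a _ ha => valV_mem ha)
      exact equation_mem rfl rfl (e₁.trans (letV_ret hm)) rfl
        (cls_co_of (H := v 2) (A := v 1) rfl rfl hH hA) hm⟩

theorem realized_letAssoc : Realized .letAssoc :=
  -- The realizer computes the left-hand side of the law; by `letV_assoc` it also realizes the
  -- right-hand side.
  ⟨cl (.lam (.lam (.lam (.lam (.lam (.lam (.lam (.app (.app (.cst letR)
    (.app (.app (.cst letR) (.var 2)) (.var 1))) (.var 0))))))))), fun ρ =>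
    pi_mem cls_RawHFunctor bdd_RH fun H _ hH => pi_mem cls_el_ty bdd_TY fun A _ hA =>
    pi_mem cls_el_ty bdd_TY fun B _ hB => pi_mem cls_el_ty bdd_TY fun C _ hC =>
    pi_mem (cls_co_of rfl rfl hH hA) (bdd_CO H A) fun m _ hm =>
    pi_mem (cls_cont_of rfl rfl rfl hH hA hB) (bdd_KC H A B) fun k _ hk =>
    pi_mem (cls_cont_of rfl rfl rfl hH hB hC) (bdd_KC H B C) fun k' _ hk' => by
      obtain ⟨t, ht⟩ := exists_let_cont hk hk'
      have h := letV_mem hm hk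
      simp only [cl_lam_dapp, ev_lam_dapp, ev_app, ev_cst]
      have eK : val kappa (lam (tm (v 5)) (letIn (v 7) (v 5) (v 4) (app (v 2) (v 0)) (v 1)))
          (k' ∷ₛ k ∷ₛ m ∷ₛ C ∷ₛ B ∷ₛ A ∷ₛ H ∷ₛ ρ) =
            Lam (decode A) fun a => letV H B C (App k a) k' :=
        val_lam_of (A := v 5) rfl hA fun a _ ha => val_letIn_of (H := v 7) (A := v 5) (B := v 4)
          (m := app (v 2) (v 0)) (k := v 1) rfl rfl rfl rfl rfl hH hB hC (hk.2 a _ ha) hk'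
      have e₀ : val kappa (letIn (v 6) (v 5) (v 4) (v 2) (v 1))
          (k' ∷ₛ k ∷ₛ m ∷ₛ C ∷ₛ B ∷ₛ A ∷ₛ H ∷ₛ ρ) = letV H A B m k :=
        val_letIn_of rfl rfl rfl rfl rfl hH hA hB hm hk
      have e₁ : val kappa (letIn (v 6) (v 4) (v 3) (letIn (v 6) (v 5) (v 4) (v 2) (v 1)) (v 0))
          (k' ∷ₛ k ∷ₛ m ∷ₛ C ∷ₛ B ∷ₛ A ∷ₛ H ∷ₛ ρ) = letV H B C (letV H A B m k) k' :=
        val_letIn_of rfl rfl rfl e₀ rfl hH hB hC h hk'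
      have e₂ : val kappa (letIn (v 6) (v 5) (v 3) (v 2)
          (lam (tm (v 5)) (letIn (v 7) (v 5) (v 4) (app (v 2) (v 0)) (v 1))))
          (k' ∷ₛ k ∷ₛ m ∷ₛ C ∷ₛ B ∷ₛ A ∷ₛ H ∷ₛ ρ) =
            letV H A C m (Lam (decode A) fun a => letV H B C (App k a) k') :=
        val_letIn_of rfl rfl rfl rfl eK hH hA hC hm ht
      exact equation_mem rfl rfl e₁ (e₂.trans (letV_assoc hk').symm)
        (cls_co_of (H := v 6) (A := v 3) rfl rfl hH hC) (letV_mem h hk')⟩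

theorem realized_th : Realized .th :=
  ⟨∅, fun _ => arrow_mem cls_RawHFunctor bdd_RH fun _ _ _ =>
    arrow_mem cls_el_ty bdd_TY fun _ _ _ => of_cls cls_el_ty (isTy_mo _)⟩

theorem realized_thIso : Realized .thIso :=
  ⟨const₂ isoR, fun _ => pi_mem cls_RawHFunctor bdd_RH fun H _ hH =>
    pi_mem cls_el_ty bdd_TY fun A _ hA => by
      rw [const₂_dapp]
      exact moIso_mem (cls_tm_of (val_th hH hA) (isTy_mo _)) (cls_co_of rfl rfl hH hA)
        (bdd_CO H A) (mod_CO H A)⟩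

theorem realized_op : Realized .op :=
  -- The two type arguments are discarded, but the realizer of `H` is kept because its `hmap` is
  -- called.
  ⟨cl (.lam (.lam (.lam (.app (.cst opR) (.var 2))))), fun _ =>
    pi_mem cls_RawHFunctor bdd_RH fun H _ hH => pi_mem cls_el_ty bdd_TY fun A _ hA =>
    pi_mem cls_el_ty bdd_TY fun B _ hB => by
      simp only [cl_lam_dapp, ev_lam_dapp, ev_app, ev_cst]
      exact arrow_mem (cls_opTy_of rfl rfl hH hA) (bdd_decode _) fun p _ hp =>
        arrow_mem (cls_cont_of rfl rfl rfl hH hA hB) (bdd_KC H A B) fun k _ hk =>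
          of_cls (cls_co_of rfl rfl hH hB) (opV_mem hH hA hp hk)⟩

theorem realized_letOp : Realized .letOp :=
  ⟨cl (.lam (.lam (.lam (.lam (.lam (.lam (.lam (.app (.app (.cst letR)
    (.app (.app (.app (.cst opR) (.var 6)) (.var 2)) (.var 1))) (.var 0))))))))), fun ρ =>
    pi_mem cls_RawHFunctor bdd_RH fun H _ hH => pi_mem cls_el_ty bdd_TY fun A _ hA =>
    pi_mem cls_el_ty bdd_TY fun B _ hB => pi_mem cls_el_ty bdd_TY fun C _ hC =>
    pi_mem (cls_opTy_of rfl rfl hH hA) (bdd_decode _) fun p _ hp =>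
    pi_mem (cls_cont_of rfl rfl rfl hH hA hB) (bdd_KC H A B) fun k _ hk =>
    pi_mem (cls_cont_of rfl rfl rfl hH hB hC) (bdd_KC H B C) fun k' _ hk' => by
      obtain ⟨t, ht⟩ := exists_let_cont hk hk'
      have h := opV_mem hH hA hp hk
      simp only [cl_lam_dapp, ev_lam_dapp, ev_app, ev_cst]
      have eK : val kappa (lam (tm (v 5)) (letIn (v 7) (v 5) (v 4) (app (v 2) (v 0)) (v 1)))
          (k' ∷ₛ k ∷ₛ p ∷ₛ C ∷ₛ B ∷ₛ A ∷ₛ H ∷ₛ ρ) =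
            Lam (decode A) fun a => letV H B C (App k a) k' :=
        val_lam_of (A := v 5) rfl hA fun a _ ha => val_letIn_of (H := v 7) (A := v 5) (B := v 4)
          (m := app (v 2) (v 0)) (k := v 1) rfl rfl rfl rfl rfl hH hB hC (hk.2 a _ ha) hk'
      have e₀ : val kappa (op (v 6) (v 5) (v 4) (v 2) (v 1))
          (k' ∷ₛ k ∷ₛ p ∷ₛ C ∷ₛ B ∷ₛ A ∷ₛ H ∷ₛ ρ) = opV H A B p k :=
        val_op_of rfl rfl rfl rfl rfl hH hA hB hp hk
      have e₁ : val kappa (letIn (v 6) (v 4) (v 3) (op (v 6) (v 5) (v 4) (v 2) (v 1)) (v 0))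
          (k' ∷ₛ k ∷ₛ p ∷ₛ C ∷ₛ B ∷ₛ A ∷ₛ H ∷ₛ ρ) = letV H B C (opV H A B p k) k' :=
        val_letIn_of rfl rfl rfl e₀ rfl hH hB hC h hk'
      have e₂ : val kappa (op (v 6) (v 5) (v 3) (v 2)
          (lam (tm (v 5)) (letIn (v 7) (v 5) (v 4) (app (v 2) (v 0)) (v 1))))
          (k' ∷ₛ k ∷ₛ p ∷ₛ C ∷ₛ B ∷ₛ A ∷ₛ H ∷ₛ ρ) =
            opV H A C p (Lam (decode A) fun a => letV H B C (App k a) k') :=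
        val_op_of rfl rfl rfl rfl eK hH hA hC hp ht
      exact equation_mem rfl rfl e₁ (e₂.trans (letV_op hk').symm)
        (cls_co_of (H := v 6) (A := v 3) rfl rfl hH hC) (letV_mem h hk')⟩

theorem realized_hdl : Realized .hdl :=
  ⟨const₂ hdlR, fun _ => pi_mem cls_RawHFunctor bdd_RH fun H _ hH =>
    pi_mem cls_el_ty bdd_TY fun A _ hA => by
      rw [const₂_dapp]
      exact pi_mem (cls_Handler_of rfl hH) (bdd_HD H) fun h _ hh =>
        arrow_mem (cls_co_of rfl rfl hH hA) (bdd_CO H A) fun c _ hc =>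
          of_cls (cls_hc_of rfl rfl hh hA) (hdlV_mem hA hh hc)⟩

theorem realized_hdlVal : Realized .hdlVal :=
  ⟨cl (.lam (.lam (.lam (.lam (.app (.app (.cst hdlR) (.var 1)) (.app (.cst valR) (.var 0))))))),
    fun ρ => pi_mem cls_RawHFunctor bdd_RH fun H _ hH => pi_mem cls_el_ty bdd_TY fun A _ hA =>
    pi_mem (cls_Handler_of rfl hH) (bdd_HD H) fun h _ hh =>
    pi_mem (cls_tm_of rfl hA) (bdd_decode A) fun a _ ha => by
      simp only [cl_lam_dapp, ev_lam_dapp, ev_app, ev_cst]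
      have e₀ : val kappa (Fha.val (v 3) (v 2) (v 0)) (a ∷ₛ h ∷ₛ A ∷ₛ H ∷ₛ ρ) = valV H A a :=
        val_val_of rfl rfl rfl hH hA ha
      have e₁ : val kappa (hdl (v 3) (v 2) (v 1) (Fha.val (v 3) (v 2) (v 0)))
          (a ∷ₛ h ∷ₛ A ∷ₛ H ∷ₛ ρ) = hdlV A h (valV H A a) :=
        val_hdl_of rfl rfl rfl e₀ hH hA hh (valV_mem ha)
      have e₂ : val kappa (mRet (fst (v 1)) (v 2) (v 0)) (a ∷ₛ h ∷ₛ A ∷ₛ H ∷ₛ ρ) =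
          mRetV (fstV h) A a :=
        val_mRet (o := opC) (m := fst (v 1)) (A := v 2) (a := v 0) (HD_rm hh) hA
      exact equation_mem rfl rfl e₁ (e₂.trans (hdlV_val hA hh ha).symm)
        (cls_hc_of (h := v 1) (A := v 2) rfl rfl hh hA) (hdlV_mem hA hh (valV_mem ha))⟩

theorem realized_hdlOp : Realized .hdlOp :=
  ⟨cl (.lam (.lam (.lam (.lam (.lam (.lam (.app (.app (.cst hdlR) (.var 2))
    (.app (.app (.app (.cst opR) (.var 5)) (.var 1)) (.var 0))))))))), fun ρ =>
    pi_mem cls_RawHFunctor bdd_RH fun H _ hH => pi_mem cls_el_ty bdd_TY fun A _ hA =>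
    pi_mem cls_el_ty bdd_TY fun B _ hB => pi_mem (cls_Handler_of rfl hH) (bdd_HD H) fun h _ hh =>
    pi_mem (cls_opTy_of rfl rfl hH hA) (bdd_decode _) fun p _ hp =>
    pi_mem (cls_cont_of rfl rfl rfl hH hA hB) (bdd_KC H A B) fun k _ hk => by
      have ho := opV_mem hH hA hp hk
      simp only [cl_lam_dapp, ev_lam_dapp, ev_app, ev_cst]
      have eK : val kappa (lam (tm (v 4)) (hdl (v 6) (v 4) (v 3) (app (v 1) (v 0))))
          (k ∷ₛ p ∷ₛ h ∷ₛ B ∷ₛ A ∷ₛ H ∷ₛ ρ) = Lam (decode A) fun a => hdlV B h (App k a) :=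
        val_lam_of (A := v 4) rfl hA fun a _ ha => val_hdl_of (H := v 6) (A := v 4) (h := v 3)
          (m := app (v 1) (v 0)) rfl rfl rfl rfl hH hB hh (hk.2 a _ ha)
      have e₀ : val kappa (op (v 5) (v 4) (v 3) (v 1) (v 0))
          (k ∷ₛ p ∷ₛ h ∷ₛ B ∷ₛ A ∷ₛ H ∷ₛ ρ) = opV H A B p k :=
        val_op_of rfl rfl rfl rfl rfl hH hA hB hp hk
      have e₁ : val kappa (hdl (v 5) (v 3) (v 2) (op (v 5) (v 4) (v 3) (v 1) (v 0)))
          (k ∷ₛ p ∷ₛ h ∷ₛ B ∷ₛ A ∷ₛ H ∷ₛ ρ) = hdlV B h (opV H A B p k) :=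
        val_hdl_of rfl rfl rfl e₀ hH hB hh ho
      -- The right-hand side of the declared equation unfolds to `opBody`, so its value is
      -- `opBodyV`, and `hdlV_op` identifies that with the handled operation.
      have e₂ : val kappa (opBody (v 5) (v 4) (v 3) (v 2) (v 1)
          (lam (tm (v 4)) (hdl (v 6) (v 4) (v 3) (app (v 1) (v 0)))))
          (k ∷ₛ p ∷ₛ h ∷ₛ B ∷ₛ A ∷ₛ H ∷ₛ ρ) = hdlV B h (opV H A B p k) := by
        rw [hdlV_op hB hh, ← eK]
        exact val_opBody (o := opC) (v 5) (v 4) (v 3) (v 2) (v 1) _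
      exact equation_mem rfl rfl e₁ e₂
        (cls_hc_of (h := v 2) (A := v 3) rfl rfl hh hB) (hdlV_mem hB hh ho)⟩

theorem realized (c : Name) : Realized c := by
  cases c with
  | ki => exact realized_ki
  | el => exact realized_el
  | ty => exact realized_ty
  | kfun => exact realized_kfun
  | unit => exact realized_unit
  | bool => exact realized_bool
  | tfun => exact realized_tfun
  | all => exact realized_all
  | kfunIso => exact realized_kfunIso
  | tm => exact realized_tm
  | unitIso => exact realized_unitIso
  | tfunIso => exact realized_tfunIso
  | allIso => exact realized_allIso
  | tt => exact realized_tt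
  | ff => exact realized_ff
  | co => exact realized_co
  | val => exact realized_val
  | letIn => exact realized_letIn
  | valLet => exact realized_valLet
  | letVal => exact realized_letVal
  | letAssoc => exact realized_letAssoc
  | th => exact realized_th
  | thIso => exact realized_thIso
  | op => exact realized_op
  | letOp => exact realized_letOp
  | hdl => exact realized_hdl
  | hdlVal => exact realized_hdlVal
  | hdlOp => exact realized_hdlOp

/-! ### Separation of the booleans -/

/-- The two names denote the elements realized only by `∅` and only by the full set; `rep` recovers
these elements, and the token `atom` distinguishes the two realizers. -/
theorem tt_ne_ff : kappa .tt ≠ kappa .ff := by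
  intro h
  have h' : rep BL (quo BL (inj (∅ : D))) = rep BL (quo BL (inj (Set.univ : D))) :=
    congrArg (rep BL) h
  rw [rep_quo mod_BL (r := ∅) rfl, rep_quo mod_BL (r := Set.univ) rfl, inj_inj] at h'
  exact (h' ▸ Set.mem_univ Tok.atom : Tok.atom ∈ (∅ : D))

end

end Realiz

theorem mainTheorem3 : ¬ Fha.ClosedEq Fha.tt Fha.ff Fha.bool := by
  intro h
  have hv := Realiz.soundness Realiz.kappa Fha.signature Realiz.realized h
  -- Every environment satisfies the empty context, so a constant one serves; equality of the
  -- interpretations gives equality of the values.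
  exact Realiz.tt_ne_ff (congrArg Prod.fst (hv.2 (fun _ => ∅) (fun _ => ∅) trivial))
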